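/- Let $\mathcal H$ be a separable complex Hilbert space, with bounded operators $\mathcal B(\mathcal H)$, operator norm $\|\cdot\|$, Schatten classes $\mathcal S^p$ and norms $\|T\|_p=(\operatorname{Tr}|T|^p)^{1/p}$, and let $u(x):=x-i$. Notation. For a continuous function $g:\mathbb R\to\mathbb C$, $\hat g$ is its distributional Fourier transform, normalised by $\hat g(y)=\frac1{2\pi}\int_{\mathbb R} g(x)e^{-ixy}\,dx$ for $g\in L^1$. For integers $s,n\ge 0$, $$\mathcal W_s^n:=\{f\in C^n(\mathbb R):\ \widehat{(fu^m)^{(k)}}\in L^1(\mathbb R)\text{ for all } m=0,\dots,s \text{ and } k=0,\dots,n\}.$$ For $f\in C^n$ the divided differences are $f^{[0]}:=f$ and $$f^{[n]}(x_0,\dots,x_n):=\lim_{x\to x_n}\frac{f^{[n-1]}(x_0,\dots,x_{n-2},x)-f^{[n-1]}(x_0,\dots,x_{n-2},x_{n-1})}{x-x_{n-1}}.$$ For (possibly unbounded) self-adjoint operators $H_0,\dots,H_n$ in $\mathcal H$ with spectral measures $E_{H_j}$, for $\phi:\mathbb R^{n+1}\to\mathbb C$ and $V_1,\dots,V_n\in\mathcal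 B(\mathcal H)$, put $E^j_{l,m}:=E_{H_j}([\frac lm,\frac{l+1}m))$. The multiple operator integral is the iterated limit in $\mathcal B(\mathcal H)$ $$T^{H_0,\dots,H_n}_\phi(V_1,\dots,V_n):=\lim_{m\to\infty}\lim_{N\to\infty}\sum_{|l_0|,\dots,|l_n|<N}\phi\Big(\frac{l_0}m,\dots,\frac{l_n}m\Big)E^0_{l_0,m}V_1E^1_{l_1,m}\cdots V_nE^n_{l_n,m}$$ if it exists in operator norm, and $T^H_\phi:=T^{H,\dots,H}_\phi$. Theorem. Let $s\ge1$ be an integer and let $H$ be self-adjoint in $\mathcal H$ with $(H-i)^{-1}\in\mathcal S^s$. For every integer $n\ge0$, every $f\in\mathcal W_s^n$ and all $V_1,\dots,V_n\in\mathcal B(\mathcal H)$, the multiple operator integral $T^H_{f^{[n]}}(V_1,\dots,V_n)$ exists, is trace class, and satisfies $$\big\|T^H_{f^{[n]}}(V_1,\dots,V_n)\big\|_1\le c_{s,n}(f)\,\|V_1\|\cdots\|V_n\|\,\big\|(H-i)^{-1}\big\|_s^s,$$ where $$c_{s,n}(f):=\sum_{k=0}^{\min(s,n)}\binom sk\frac{\big\|\widehat{(fu^{s-k})^{(n-k)}}\big\|_{L^1}}{(n-k)!}.$$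 More generally, for every bounded self-adjoint operator $V$ on $\mathcal H$, $T^{H+V,H,\dots,H}_{f^{[n]}}(V_1,\dots,V_n)$ (with $H+V$ as the first of the $n+1$ operators) exists, is trace class, and satisfies $$\big\|T^{H+V,H,\dots,H}_{f^{[n]}}(V_1,\dots,V_n)\big\|_1\le c_{s,n}(f)\,\|V_1\|\cdots\|V_n\|\,(1+\|V\|)^s\,\big\|(H-i)^{-1}\big\|_s^s.$$ -/

import Mathlib

open Filter Topology MeasureTheory
open scoped InnerProductSpace ENNReal

noncomputable section

namespace MOI

section Functions

/-- The divided difference `f^{[n]}(x₀, …, xₙ)`, by the recursion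
`f^{[n]}(x₀,…,xₙ) = lim_{x → xₙ} (f^{[n-1]}(x₀,…,x_{n-2},x) - f^{[n-1]}(x₀,…,x_{n-1})) / (x - x_{n-1})`.
For `f` of class `C^n` this limit is the difference quotient if `xₙ ≠ x_{n-1}`, and the
derivative of `x ↦ f^{[n-1]}(x₀,…,x_{n-2},x)` at `x_{n-1}` if `xₙ = x_{n-1}`, that is, `dslope`. -/
def dividedDiff (f : ℝ → ℂ) : (n : ℕ) → (Fin (n + 1) → ℝ) → ℂ
  | 0, x => f (x 0)
  | n + 1, x =>
      dslope (fun t : ℝ => dividedDiff f n (Function.update (Fin.init x) (Fin.last n) t))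
        (x (Fin.last n).castSucc) (x (Fin.last (n + 1)))

/-- The function `f u^m`, where `u(x) = x - i`. -/
def weighted (f : ℝ → ℂ) (m : ℕ) : ℝ → ℂ := fun x => f x * ((x : ℂ) - Complex.I) ^ m

/-- The distributional Fourier transform of the locally integrable function `g` is the
`L¹`-function `h`.  The normalisation is `ĝ(y) = (2π)⁻¹ ∫ g(x) e^{-ixy} dx` for `g ∈ L¹`.
For a distribution, `⟨ĝ, φ⟩ = ⟨g, φ̂⟩` for all Schwartz functions `φ` with `ψ := φ̂ ∈ C_c^∞`,
that is, for all `φ` of the form `φ(y) = ∫ ψ(x) e^{ixy} dx` with `ψ ∈ C_c^∞`. -/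
def HasFourierTransformL1 (g h : ℝ → ℂ) : Prop :=
  Integrable h ∧
    ∀ ψ : ℝ → ℂ, ContDiff ℝ (⊤ : ℕ∞) ψ → HasCompactSupport ψ →
      ∫ y, h y * (∫ x, ψ x * Complex.exp (Complex.I * x * y)) = ∫ x, g x * ψ x

/-- The Fourier transform of `g`, if it is in `L¹` (it is then determined up to null sets). -/
def fourierTransform (g : ℝ → ℂ) : ℝ → ℂ := by
  classical exact if h : ∃ k, HasFourierTransformL1 g k then h.choose else 0

/-- `‖ĝ‖₁`. -/
def fourierNorm (g : ℝ → ℂ) : ℝ := ∫ y, ‖fourierTransform g y‖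

/-- The function class `W_s^n`: the `f ∈ C^n` such that the Fourier transform of `(f u^m)^{(k)}`
is in `L¹` for all `m = 0, …, s` and `k = 0, …, n`. -/
def classW (s n : ℕ) : Set (ℝ → ℂ) :=
  {f | ContDiff ℝ n f ∧
    ∀ m ≤ s, ∀ k ≤ n, ∃ h, HasFourierTransformL1 (iteratedDeriv k (weighted f m)) h}

/-- `c_{s,n}(f) = ∑_{k=0}^{min(s,n)} (s choose k) ‖((f u^{s-k})^{(n-k)})^‖₁ / (n-k)!`. -/
def constC (s n : ℕ) (f : ℝ → ℂ) : ℝ :=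
  ∑ k ∈ Finset.range (min s n + 1),
    (s.choose k : ℝ) * fourierNorm (iteratedDeriv (n - k) (weighted f (s - k)))
      / ((n - k).factorial : ℝ)

end Functions

variable {𝓗 : Type*} [NormedAddCommGroup 𝓗] [InnerProductSpace ℂ 𝓗]

section Schatten

variable [CompleteSpace 𝓗]

/-- The trace `∑ᵢ ⟨bᵢ, T bᵢ⟩ ∈ [0, ∞]` of a positive bounded operator `T` (it does not depend on
the orthonormal basis `b`). -/
def posTrace (T : 𝓗 →L[ℂ] 𝓗) : ℝ≥0∞ :=
  let b := (exists_hilbertBasis ℂ 𝓗).choose_spec.choose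
  ∑' i, ENNReal.ofReal (RCLike.re ⟪b i, T (b i)⟫_ℂ)

/-- `Tr (|T|^p)`, where `|T| = (T^* T)^{1/2}`. -/
def schattenTrace (p : ℝ) (T : 𝓗 →L[ℂ] 𝓗) : ℝ≥0∞ := posTrace (CFC.abs T ^ p)

/-- `T` belongs to the Schatten class `S^p` (`0 < p < ∞`). -/
def MemSchatten (p : ℝ) (T : 𝓗 →L[ℂ] 𝓗) : Prop := schattenTrace p T < ∞

/-- The Schatten norm `‖T‖_p = (Tr |T|^p)^{1/p}` of `T ∈ S^p`. -/
def schattenNorm (p : ℝ) (T : 𝓗 →L[ℂ] 𝓗) : ℝ := (schattenTrace p T).toReal ^ (1 / p)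

end Schatten

section Resolvent

/-- `R` is the inverse of `H - z`, bounded and everywhere defined. -/
def IsResolventAt (H : 𝓗 →ₗ.[ℂ] 𝓗) (z : ℂ) (R : 𝓗 →L[ℂ] 𝓗) : Prop :=
  (∀ φ : 𝓗, ∃ hφ : R φ ∈ H.domain, H ⟨R φ, hφ⟩ - z • R φ = φ) ∧
    ∀ φ : H.domain, R (H φ - z • (φ : 𝓗)) = φ

/-- The resolvent `(H - z)⁻¹`. -/
def resolventAt (H : 𝓗 →ₗ.[ℂ] 𝓗) (z : ℂ) : 𝓗 →L[ℂ] 𝓗 := by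
  classical exact if h : ∃ R, IsResolventAt H z R then h.choose else 0

end Resolvent

section SpectralMeasure

variable [CompleteSpace 𝓗]

variable (𝓗) in
/-- A projection-valued measure on the Borel subsets of `ℝ` (the values on other sets are
irrelevant). -/
structure ProjValuedMeasure where
  /-- the projection attached to a set -/
  proj : Set ℝ → (𝓗 →L[ℂ] 𝓗)
  isStarProjection : ∀ S, MeasurableSet S → IsStarProjection (proj S)
  empty : proj ∅ = 0
  univ : proj Set.univ = 1
  inter : ∀ S T, MeasurableSet S → MeasurableSet T → proj (S ∩ T) = proj S * proj T
  iUnion : ∀ S : ℕ → Set ℝ, (∀ i, MeasurableSet (S i)) → Pairwise (Function.onFun Disjoint S) →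
    ∀ ψ : 𝓗, HasSum (fun i => proj (S i) ψ) (proj (⋃ i, S i) ψ)

theorem ProjValuedMeasure.re_inner_nonneg (P : ProjValuedMeasure 𝓗) (ψ : 𝓗) {S : Set ℝ}
    (hS : MeasurableSet S) : 0 ≤ RCLike.re ⟪ψ, P.proj S ψ⟫_ℂ := by
  have h := P.isStarProjection S hS
  have h1 : P.proj S (P.proj S ψ) = P.proj S ψ := by
    have := congrArg (fun T : 𝓗 →L[ℂ] 𝓗 => T ψ) h.isIdempotentElem.eq
    simpa using this
  have h2 : ⟪ψ, P.proj S ψ⟫_ℂ = ⟪P.proj S ψ, P.proj S ψ⟫_ℂ := by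
    have h3 := (ContinuousLinearMap.isSelfAdjoint_iff_isSymmetric.mp h.isSelfAdjoint)
      ψ (P.proj S ψ)
    simp only [ContinuousLinearMap.coe_coe] at h3
    rw [h3, h1]
  rw [h2]
  exact inner_self_nonneg

/-- The scalar measure `S ↦ ⟨ψ, P(S) ψ⟩`. -/
def ProjValuedMeasure.scalarMeasure (P : ProjValuedMeasure 𝓗) (ψ : 𝓗) : Measure ℝ :=
  Measure.ofMeasurable (fun S _ => ENNReal.ofReal (RCLike.re ⟪ψ, P.proj S ψ⟫_ℂ))
    (by simp [P.empty])
    (by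
      intro S hS hd
      have h := P.iUnion S hS hd ψ
      have h1 : HasSum (fun i => RCLike.re ⟪ψ, P.proj (S i) ψ⟫_ℂ)
          (RCLike.re ⟪ψ, P.proj (⋃ i, S i) ψ⟫_ℂ) := by
        have h2 := h.mapL (innerSL ℂ ψ)
        exact h2.mapL (RCLike.reCLM (K := ℂ))
      rw [← h1.tsum_eq, ENNReal.ofReal_tsum_of_nonneg
        (fun i => P.re_inner_nonneg ψ (hS i)) h1.summable])

/-- `H = ∫ x dP(x)`: the domain of `H` consists of the `ψ` with `∫ x² d⟨ψ, P ψ⟩ < ∞`, and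
`⟨ψ, H ψ⟩ = ∫ x d⟨ψ, P ψ⟩` for such `ψ`. -/
def ProjValuedMeasure.IsSpectralMeasureOf (P : ProjValuedMeasure 𝓗) (H : 𝓗 →ₗ.[ℂ] 𝓗) : Prop :=
  (∀ ψ : 𝓗, ψ ∈ H.domain ↔ ∫⁻ x, ENNReal.ofReal (x ^ 2) ∂(P.scalarMeasure ψ) < ∞) ∧
    ∀ ψ : H.domain, ⟪(ψ : 𝓗), H ψ⟫_ℂ = ((∫ x, x ∂(P.scalarMeasure (ψ : 𝓗)) : ℝ) : ℂ)

/-- The spectral measure `E_H` of a self-adjoint operator `H`. -/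
def spectralMeasure (H : 𝓗 →ₗ.[ℂ] 𝓗) : Set ℝ → (𝓗 →L[ℂ] 𝓗) := by
  classical exact
    if h : ∃ P : ProjValuedMeasure 𝓗, P.IsSpectralMeasureOf H then h.choose.proj else 0

end SpectralMeasure

section MultipleOperatorIntegral

variable [CompleteSpace 𝓗]

/-- The spectral projection `E_H([l/m, (l+1)/m))`. -/
def specProj (H : 𝓗 →ₗ.[ℂ] 𝓗) (m : ℕ) (l : ℤ) : 𝓗 →L[ℂ] 𝓗 :=
  spectralMeasure H (Set.Ico ((l : ℝ) / m) (((l : ℝ) + 1) / m))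

/-- `∑_{|l₀|,…,|lₙ| < N} φ(l₀/m, …, lₙ/m) E⁰_{l₀,m} V₁ E¹_{l₁,m} ⋯ Vₙ Eⁿ_{lₙ,m}`. -/
def partialSum {n : ℕ} (H : Fin (n + 1) → (𝓗 →ₗ.[ℂ] 𝓗)) (φ : (Fin (n + 1) → ℝ) → ℂ)
    (V : Fin n → (𝓗 →L[ℂ] 𝓗)) (m N : ℕ) : 𝓗 →L[ℂ] 𝓗 :=
  ∑ l ∈ Fintype.piFinset (fun _ : Fin (n + 1) => Finset.Ioo (-(N : ℤ)) (N : ℤ)),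
    φ (fun j => (l j : ℝ) / m) •
      (specProj (H 0) m (l 0) *
        (List.ofFn fun j : Fin n => V j * specProj (H j.succ) m (l j.succ)).prod)

/-- `T` is the multiple operator integral `T^{H₀,…,Hₙ}_φ(V₁, …, Vₙ)`: the iterated limit
`lim_{m → ∞} lim_{N → ∞}` of the partial sums exists in the operator norm and equals `T`. -/
def IsMultipleOperatorIntegral {n : ℕ} (H : Fin (n + 1) → (𝓗 →ₗ.[ℂ] 𝓗))
    (φ : (Fin (n + 1) → ℝ) → ℂ) (V : Fin n → (𝓗 →L[ℂ] 𝓗)) (T : 𝓗 →L[ℂ] 𝓗) : Prop :=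
  ∃ S : ℕ → (𝓗 →L[ℂ] 𝓗),
    (∀ m : ℕ, 1 ≤ m → Tendsto (fun N : ℕ => partialSum H φ V m N) atTop (𝓝 (S m))) ∧
      Tendsto S atTop (𝓝 T)

/-- `H + V`, with the domain of `H`, for a bounded operator `V`. -/
def perturb (H : 𝓗 →ₗ.[ℂ] 𝓗) (V : 𝓗 →L[ℂ] 𝓗) : 𝓗 →ₗ.[ℂ] 𝓗 := (V : 𝓗 →ₗ[ℂ] 𝓗) +ᵥ H

end MultipleOperatorIntegral

end MOI

end

open Filter Topology MeasureTheory
open scoped InnerProductSpace ENNReal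

noncomputable section

namespace MOI

section

/-! ### Divided differences -/

/-! Since `R = (H - i)⁻¹` lies in a Schatten class, it is compact, so `H` has an orthonormal
eigenbasis with only finitely many eigenvalues, counted with multiplicity, in each bounded interval.
The same holds for `H + W`, whose resolvent is `R K` with `K = 1 - W (H + W - i)⁻¹`. The multiple
operator integral thus becomes a limit of finite sums over eigenvectors (`symbolSum`), and all
estimates are made for such sums, uniformly in the finite index sets.

Operator norm: Hermite–Genocchi writes `f^{[n]}` as a mean of `f^{(n)}` over a simplex. Fourier
inversion then exhibits it as an integral of products of exponentials, one in each variable. For a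
product symbol the sum collapses to `D₀ V₁ D₁ ⋯ Vₙ Dₙ` with diagonal contractions `D_j`, so the sum
is bounded by the `L¹`-norm of the Fourier transform of `f^{(n)}`, divided by `n!`, times `∏ ‖V_j‖`.

Existence: by `dividedDiff_mul_sub_I`, `(f u)^{[n]} = u(x_j) f^{[n]} + f^{[n-1]}` with `x_j` omitted
in the last term. Solving for `f^{[n]}` gains a factor `u(x_j)⁻¹` in any chosen variable, which is
small away from finitely many eigenvalues. Hence the finite sums are Cauchy in norm
(`cauchySeq_symbolSum`). The partial sums in the definition are such sums at eigenvalues rounded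
down to multiples of `1 / m`; dominated convergence in the Fourier representation removes the
rounding, uniformly in the index sets (`exists_symbolSum_sub_le`).

Trace norm: the same rule at the first variable, used `s` times, extracts a resolvent on the left
each time, while the symbol either passes from `f u^m` to `f u^{m+1}` or loses a variable. Each
resulting term is `A₁ R ⋯ A_s R` times a bounded sum, and Hölder's inequality applies
(`traceBound_prod_mul_symbolSum`). Counting the choices by Pascal's rule gives the binomial
coefficients of the constant. Hölder's inequality is itself derived from a layer cake argument
(`norm_sum_prod_mul_le`), and the trace norm is controlled by duality with functionals bounded by
`‖x‖ ‖y‖` on rank one operators, a form of the bound that passes to norm limits. -/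

/-- `f` is of class `C^n` and its derivatives up to order `n` are bounded. -/
def BoundedDerivs (n : ℕ) (f : ℝ → ℂ) : Prop :=
  ContDiff ℝ n f ∧ ∀ k ≤ n, ∃ C, ∀ x, ‖iteratedDeriv k f x‖ ≤ C

theorem BoundedDerivs.mono {n m : ℕ} {f : ℝ → ℂ} (h : BoundedDerivs n f) (hm : m ≤ n) :
    BoundedDerivs m f :=
  ⟨h.1.of_le (by exact_mod_cast hm), fun k hk => h.2 k (hk.trans hm)⟩

/-- A parametrisation of the simplex `{θ ∈ [0,1]^{n+1} : ∑ θ_j = 1}`, with density `w`. -/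
structure SimplexParam (n : ℕ) where
  /-- the parameter space -/
  Ω : Type
  /-- its `σ`-algebra -/
  [mΩ : MeasurableSpace Ω]
  /-- the measure on the parameter space -/
  ν : Measure Ω
  [prob : IsProbabilityMeasure ν]
  /-- the density -/
  w : Ω → ℝ
  /-- the barycentric coordinates -/
  θ : Ω → Fin (n + 1) → ℝ
  measurable_w : Measurable w
  measurable_θ : ∀ j, Measurable fun ω => θ ω j
  w_mem : ∀ ω, w ω ∈ Set.Icc (0 : ℝ) 1
  θ_mem : ∀ ω, θ ω (Fin.last n) ∈ Set.Icc (0 : ℝ) 1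
  -- All moments of the last coordinate are recorded because `SimplexParam.succ` multiplies the
  -- density by that coordinate; the case `k = 0` is the total mass `1 / n!`.
  moment : ∀ k : ℕ, ∫ ω, w ω * θ ω (Fin.last n) ^ k ∂ν = (k.factorial : ℝ) / (n + k).factorial

attribute [instance] SimplexParam.mΩ SimplexParam.prob

theorem integral_unitInterval_pow (k : ℕ) :
    ∫ t : unitInterval, (t : ℝ) ^ k = 1 / ((k : ℝ) + 1) := by
  have h := integral_subtype_comap (μ := (volume : Measure ℝ)) (s := Set.Icc (0 : ℝ) 1)
    measurableSet_Icc (fun t : ℝ => t ^ k)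
  refine h.trans ?_
  rw [integral_Icc_eq_integral_Ioc, ← intervalIntegral.integral_of_le zero_le_one, integral_pow]
  simp

/-- The parametrisation of the point. -/
def SimplexParam.zero : SimplexParam 0 where
  Ω := Unit
  ν := Measure.dirac ()
  w := fun _ => 1
  θ := fun _ _ => 1
  measurable_w := measurable_const
  measurable_θ := fun _ => measurable_const
  w_mem := fun _ => by simp
  θ_mem := fun _ => by simp
  moment := fun k => by
    have : (k.factorial : ℝ) ≠ 0 := by positivity
    simp [this]

/-- Splitting the last coordinate. -/
def SimplexParam.succ {n : ℕ} (P : SimplexParam n) : SimplexParam (n + 1) where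
  Ω := P.Ω × unitInterval
  ν := P.ν.prod volume
  -- The last mass `θₙ` is divided into `θₙ (1 - t)` and `θₙ t`; the factor `θₙ` is the Jacobian of
  -- this substitution.
  w := fun p => P.w p.1 * P.θ p.1 (Fin.last n)
  θ := fun p => Fin.snoc (α := fun _ => ℝ)
    (Function.update (P.θ p.1) (Fin.last n) (P.θ p.1 (Fin.last n) * (1 - p.2)))
    (P.θ p.1 (Fin.last n) * p.2)
  measurable_w := by
    have h1 := P.measurable_w
    have h2 := P.measurable_θ
    fun_prop
  measurable_θ := by
    have h2 := P.measurable_θ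
    intro j
    refine Fin.lastCases ?_ (fun j => ?_) j
    · simp only [Fin.snoc_last]
      fun_prop
    · simp only [Fin.snoc_castSucc]
      by_cases hj : j = Fin.last n
      · subst hj
        simp only [Function.update_self]
        fun_prop
      · simp only [Function.update_of_ne hj]
        fun_prop
  w_mem := fun p => ⟨mul_nonneg (P.w_mem _).1 (P.θ_mem _).1,
    mul_le_one₀ (P.w_mem _).2 (P.θ_mem _).1 (P.θ_mem _).2⟩
  θ_mem := fun p => by
    simp only [Fin.snoc_last]
    exact ⟨mul_nonneg (P.θ_mem _).1 p.2.2.1, mul_le_one₀ (P.θ_mem _).2 p.2.2.1 p.2.2.2⟩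
  moment := fun k => by
    simp only [Fin.snoc_last]
    have h := integral_prod_mul (μ := P.ν) (ν := (volume : Measure unitInterval))
      (fun ω => P.w ω * P.θ ω (Fin.last n) ^ (k + 1)) (fun t => (t : ℝ) ^ k)
    rw [P.moment (k + 1), integral_unitInterval_pow] at h
    calc _ = ∫ z : P.Ω × unitInterval, P.w z.1 * P.θ z.1 (Fin.last n) ^ (k + 1) * (z.2 : ℝ) ^ k
          ∂P.ν.prod volume := integral_congr_ae (Eventually.of_forall fun z => by ring)
      _ = _ := by
        rw [h, Nat.factorial_succ, show n + (k + 1) = n + 1 + k by ring]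
        push_cast
        field_simp

/-- The parametrisation of the `n`-simplex. -/
def simplexParam : (n : ℕ) → SimplexParam n
  | 0 => SimplexParam.zero
  | n + 1 => (simplexParam n).succ

theorem SimplexParam.integral_w {n : ℕ} (P : SimplexParam n) :
    ∫ ω, P.w ω ∂P.ν = 1 / (n.factorial : ℝ) := by
  simpa using P.moment 0

theorem SimplexParam.integrable_w {n : ℕ} (P : SimplexParam n) : Integrable P.w P.ν :=
  Integrable.of_bound P.measurable_w.aestronglyMeasurable 1 (Eventually.of_forall fun ω => by
    rw [Real.norm_of_nonneg (P.w_mem ω).1]; exact (P.w_mem ω).2)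

theorem SimplexParam.measurable_dot {n : ℕ} (P : SimplexParam n) (x : Fin (n + 1) → ℝ) :
    Measurable fun ω => ∑ j, P.θ ω j * x j :=
  Finset.measurable_sum _ fun j _ => (P.measurable_θ j).mul_const _

/-- The mean of `φ` over the simplex with vertices `x_0, …, x_n`. -/
def SimplexParam.mean {n : ℕ} (P : SimplexParam n) (φ : ℝ → ℂ) (x : Fin (n + 1) → ℝ) : ℂ :=
  ∫ ω, (P.w ω : ℂ) * φ (∑ j, P.θ ω j * x j) ∂P.ν

theorem SimplexParam.integrable_mean {n : ℕ} (P : SimplexParam n) {φ : ℝ → ℂ} (hφ : Continuous φ)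
    {C : ℝ} (hC : ∀ x, ‖φ x‖ ≤ C) (x : Fin (n + 1) → ℝ) :
    Integrable (fun ω => (P.w ω : ℂ) * φ (∑ j, P.θ ω j * x j)) P.ν := by
  refine P.integrable_w.ofReal.mul_bdd (c := C)
    (hφ.measurable.comp (P.measurable_dot x)).aestronglyMeasurable
    (Eventually.of_forall fun ω => hC _)

theorem SimplexParam.continuous_mean {n : ℕ} (P : SimplexParam n) {φ : ℝ → ℂ} (hφ : Continuous φ)
    {C : ℝ} (hC : ∀ x, ‖φ x‖ ≤ C) : Continuous (P.mean φ) := by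
  refine continuous_of_dominated (bound := fun ω => C)
    (fun x => (P.integrable_mean hφ hC x).aestronglyMeasurable) (fun x => ?_)
    (integrable_const _) (Eventually.of_forall fun ω => ?_)
  · refine Eventually.of_forall fun ω => ?_
    rw [norm_mul, Complex.norm_real, Real.norm_of_nonneg (P.w_mem ω).1]
    exact (mul_le_of_le_one_left (norm_nonneg _) (P.w_mem ω).2).trans (hC _)
  · fun_prop

theorem integral_unitInterval_deriv {φ φ' : ℝ → ℂ} (hd : ∀ x, HasDerivAt φ (φ' x) x)
    (hφ' : Continuous φ') (z δ : ℝ) :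
    ∫ t : unitInterval, (δ : ℂ) * φ' (z + t * δ) = φ (z + δ) - φ z := by
  have h := integral_subtype_comap (μ := (volume : Measure ℝ)) (s := Set.Icc (0 : ℝ) 1)
    measurableSet_Icc (fun t : ℝ => (δ : ℂ) * φ' (z + t * δ))
  refine h.trans ?_
  rw [integral_Icc_eq_integral_Ioc, ← intervalIntegral.integral_of_le zero_le_one]
  have h1 : ∀ t : ℝ, HasDerivAt (fun t : ℝ => φ (z + t * δ)) ((δ : ℂ) * φ' (z + t * δ)) t := by
    intro t
    have h2 : HasDerivAt (fun t : ℝ => z + t * δ) δ t := by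
      simpa using ((hasDerivAt_id t).mul_const δ).const_add z
    have h3 := (hd (z + t * δ)).scomp t h2
    rw [Complex.real_smul] at h3
    exact h3
  rw [intervalIntegral.integral_eq_sub_of_hasDerivAt (fun t _ => h1 t)
    (Continuous.intervalIntegrable (by fun_prop) _ _)]
  simp

theorem SimplexParam.succ_dot {n : ℕ} (P : SimplexParam n) (p : P.Ω × unitInterval)
    (x : Fin (n + 2) → ℝ) :
    ∑ j, P.succ.θ p j * x j = (∑ j, P.θ p.1 j * Fin.init x j) + p.2 *
      (P.θ p.1 (Fin.last n) * (x (Fin.last (n + 1)) - x (Fin.last n).castSucc)) := by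
  rw [Fin.sum_univ_castSucc, Fin.sum_univ_castSucc, Fin.sum_univ_castSucc]
  simp only [SimplexParam.succ, Fin.snoc_last, Fin.snoc_castSucc, Function.update_self, Fin.init]
  have : ∀ j : Fin n, Function.update (P.θ p.1) (Fin.last n)
      (P.θ p.1 (Fin.last n) * (1 - (p.2 : ℝ))) j.castSucc = P.θ p.1 j.castSucc := fun j =>
    Function.update_of_ne (Fin.castSucc_lt_last j).ne _ _
  simp only [this]
  ring

theorem SimplexParam.dot_update {n : ℕ} (P : SimplexParam n) (ω : P.Ω) (y : Fin (n + 1) → ℝ)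
    (t : ℝ) : ∑ j, P.θ ω j * Function.update y (Fin.last n) t j =
      (∑ j, P.θ ω j * y j) + P.θ ω (Fin.last n) * (t - y (Fin.last n)) := by
  rw [Fin.sum_univ_castSucc, Fin.sum_univ_castSucc]
  have : ∀ j : Fin n, Function.update y (Fin.last n) t j.castSucc = y j.castSucc := fun j =>
    Function.update_of_ne (Fin.castSucc_lt_last j).ne _ _
  simp only [this, Function.update_self]
  ring

/-- The fundamental theorem of calculus on the segment along which only the last node moves. The
argument changes by `θₙ δ`; the density of `P.succ` absorbs `θₙ` and `δ` is left in front. -/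
theorem SimplexParam.mean_update_sub {n : ℕ} (P : SimplexParam n) {φ φ' : ℝ → ℂ}
    (hd : ∀ x, HasDerivAt φ (φ' x) x) (hφ' : Continuous φ') {C C' : ℝ} (hC : ∀ x, ‖φ x‖ ≤ C)
    (hC' : ∀ x, ‖φ' x‖ ≤ C') (x : Fin (n + 2) → ℝ) :
    P.mean φ (Function.update (Fin.init x) (Fin.last n) (x (Fin.last (n + 1)))) -
      P.mean φ (Fin.init x) =
      ((x (Fin.last (n + 1)) - x (Fin.last n).castSucc : ℝ) : ℂ) * P.succ.mean φ' x := by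
  have hφ : Continuous φ := continuous_iff_continuousAt.2 fun x => (hd x).continuousAt
  rw [SimplexParam.mean, SimplexParam.mean, ← integral_sub (P.integrable_mean hφ hC _)
    (P.integrable_mean hφ hC _), SimplexParam.mean]
  have hi := P.succ.integrable_mean hφ' hC' x
  change _ = _ * ∫ p : P.Ω × unitInterval, _ ∂(P.ν.prod volume)
  change Integrable _ (P.ν.prod volume) at hi
  rw [integral_prod _ hi, ← integral_const_mul]
  congr 1
  ext ω
  set δ := x (Fin.last (n + 1)) - x (Fin.last n).castSucc with hδ
  have h1 := integral_unitInterval_deriv hd hφ' (∑ j, P.θ ω j * Fin.init x j)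
    (P.θ ω (Fin.last n) * δ)
  rw [P.dot_update, ← mul_sub]
  change (P.w ω : ℂ) * (φ (_ + P.θ ω (Fin.last n) * δ) - _) = _
  rw [← h1, ← integral_const_mul, ← integral_const_mul]
  congr 1
  ext t
  rw [P.succ_dot (ω, t) x]
  simp only [SimplexParam.succ]
  push_cast
  ring

theorem hasDerivAt_iteratedDeriv {n : ℕ} {f : ℝ → ℂ} (hf : ContDiff ℝ ((n + 1 : ℕ)) f) (x : ℝ) :
    HasDerivAt (iteratedDeriv n f) (iteratedDeriv (n + 1) f x) x := by
  rw [iteratedDeriv_succ]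
  have := hf.differentiable_iteratedDeriv n (by exact_mod_cast Nat.lt_succ_self n)
  exact (this x).hasDerivAt

/-- The case of coinciding nodes: by `mean_update_sub` the slope is itself a mean over the larger
simplex, which depends continuously on the moving node. -/
theorem SimplexParam.hasDerivAt_mean {n : ℕ} (P : SimplexParam n) {f : ℝ → ℂ}
    (hf : BoundedDerivs (n + 1) f) (x : Fin (n + 2) → ℝ)
    (hx : x (Fin.last (n + 1)) = x (Fin.last n).castSucc) :
    HasDerivAt (fun t => P.mean (iteratedDeriv n f) (Function.update (Fin.init x) (Fin.last n) t))
      (P.succ.mean (iteratedDeriv (n + 1) f) x) (x (Fin.last n).castSucc) := by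
  obtain ⟨C, hC⟩ := hf.2 n (Nat.le_succ n)
  obtain ⟨C', hC'⟩ := hf.2 (n + 1) le_rfl
  have hφ' : Continuous (iteratedDeriv (n + 1) f) := hf.1.continuous_iteratedDeriv _ le_rfl
  set a := x (Fin.last n).castSucc with ha
  rw [hasDerivAt_iff_tendsto_slope]
  have h1 : Tendsto (fun t => P.succ.mean (iteratedDeriv (n + 1) f)
      (Function.update x (Fin.last (n + 1)) t)) (𝓝[≠] a)
      (𝓝 (P.succ.mean (iteratedDeriv (n + 1) f) x)) := by
    have h2 : Continuous fun t => P.succ.mean (iteratedDeriv (n + 1) f)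
        (Function.update x (Fin.last (n + 1)) t) :=
      (P.succ.continuous_mean hφ' hC').comp (by fun_prop)
    have h3 := (h2.tendsto a).mono_left (nhdsWithin_le_nhds (s := {a}ᶜ))
    have h4 : Function.update x (Fin.last (n + 1)) a = x := by
      rw [← hx, Function.update_eq_self]
    rwa [h4] at h3
  refine h1.congr' ?_
  filter_upwards [self_mem_nhdsWithin] with t ht
  have ht' : t ≠ a := ht
  have h4 := P.mean_update_sub (hasDerivAt_iteratedDeriv hf.1) hφ' hC hC'
    (Function.update x (Fin.last (n + 1)) t)
  have h5 : Fin.init (Function.update x (Fin.last (n + 1)) t) = Fin.init x := by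
    simp
  have h6 : Function.update x (Fin.last (n + 1)) t (Fin.last n).castSucc = a :=
    Function.update_of_ne (Fin.castSucc_lt_last _).ne _ _
  rw [h5, h6, Function.update_self] at h4
  have h7 : Function.update (Fin.init x) (Fin.last n) a = Fin.init x := by
    rw [ha]; exact Function.update_eq_self (Fin.last n) (Fin.init x)
  rw [slope_def_module, h7, h4, Complex.real_smul, ← mul_assoc, ← Complex.ofReal_mul,
    inv_mul_cancel₀ (sub_ne_zero.2 ht'), Complex.ofReal_one, one_mul]

/-- The Hermite–Genocchi formula. -/
theorem dividedDiff_eq_mean (n : ℕ) {f : ℝ → ℂ} (hf : BoundedDerivs n f) (x : Fin (n + 1) → ℝ) :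
    dividedDiff f n x = (simplexParam n).mean (iteratedDeriv n f) x := by
  induction n with
  | zero =>
    have h : ∀ g : Unit → ℂ, ∫ ω, g ω ∂(Measure.dirac ()) = g () := fun g => integral_dirac g ()
    refine Eq.trans ?_ (h fun _ => ((1 : ℝ) : ℂ) * iteratedDeriv 0 f (∑ j, 1 * x j)).symm
    simp [dividedDiff]
  | succ n ih =>
    have hf' := hf.mono (Nat.le_succ n)
    rw [dividedDiff]
    simp only [ih hf']
    by_cases hx : x (Fin.last (n + 1)) = x (Fin.last n).castSucc
    · rw [hx, dslope_same]
      exact ((simplexParam n).hasDerivAt_mean hf x hx).deriv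
    · obtain ⟨C, hC⟩ := hf.2 n (Nat.le_succ n)
      obtain ⟨C', hC'⟩ := hf.2 (n + 1) le_rfl
      rw [dslope_of_ne _ hx, slope_def_module]
      have h7 : Function.update (Fin.init x) (Fin.last n) (x (Fin.last n).castSucc) = Fin.init x :=
        Function.update_eq_self (Fin.last n) (Fin.init x)
      rw [h7, (simplexParam n).mean_update_sub (hasDerivAt_iteratedDeriv hf.1)
        (hf.1.continuous_iteratedDeriv _ le_rfl) hC hC', Complex.real_smul, ← mul_assoc,
        ← Complex.ofReal_mul, inv_mul_cancel₀ (sub_ne_zero.2 hx), Complex.ofReal_one, one_mul]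
      rfl

/-- At coinciding nodes `dslope` is a derivative; this guarantees that Leibniz' rule applies to it
inside the recursion. -/
theorem differentiable_dividedDiff_update {n : ℕ} {f : ℝ → ℂ} (hf : BoundedDerivs (n + 1) f)
    (y : Fin (n + 1) → ℝ) :
    Differentiable ℝ fun t => dividedDiff f n (Function.update y (Fin.last n) t) := by
  intro a
  simp only [dividedDiff_eq_mean n (hf.mono (Nat.le_succ n))]
  have h := (simplexParam n).hasDerivAt_mean hf
    (Fin.snoc (α := fun _ => ℝ) (Function.update y (Fin.last n) a) a) (by simp)
  simpa using h.differentiableAt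

/-! ### The product rule for multiplication by `x - i` -/

theorem dslope_comm (f : ℝ → ℂ) (a b : ℝ) : dslope f a b = dslope f b a := by
  by_cases h : a = b
  · rw [h]
  · rw [dslope_of_ne _ h, dslope_of_ne _ (Ne.symm h), slope_comm]

theorem dslope_const_mul_add {G K : ℝ → ℂ} (hG : Differentiable ℝ G) (hK : Differentiable ℝ K)
    (c : ℂ) (a b : ℝ) :
    dslope (fun t => c * G t + K t) a b = c * dslope G a b + dslope K a b := by
  by_cases h : b = a
  · subst h
    simp only [dslope_same]
    exact (((hG b).hasDerivAt.const_mul c).add (hK b).hasDerivAt).deriv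
  · simp only [dslope_of_ne _ h, slope_def_module, Complex.real_smul]
    ring

theorem dslope_mul_sub_I_add {G : ℝ → ℂ} (hG : Differentiable ℝ G) (c : ℂ) (a b : ℝ) :
    dslope (fun t : ℝ => ((t : ℂ) - Complex.I) * G t + c) a b =
      ((b : ℂ) - Complex.I) * dslope G a b + G a := by
  by_cases h : b = a
  · subst h
    simp only [dslope_same]
    have h1 : HasDerivAt (fun t : ℝ => (t : ℂ) - Complex.I) 1 b := by
      simpa using (Complex.ofRealCLM.hasDerivAt (x := b)).sub_const Complex.I
    refine ((h1.mul (hG b).hasDerivAt).add_const c).deriv.trans ?_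
    ring
  · simp only [dslope_of_ne _ h, slope_def_module, Complex.real_smul]
    have : ((b : ℂ) - a) ≠ 0 := by
      rw [← Complex.ofReal_sub]; exact_mod_cast sub_ne_zero.2 h
    push_cast
    field_simp
    ring

/-- `f^{[n-1]}`, with the value `0` for `n = 0`. -/
def predDividedDiff (f : ℝ → ℂ) : (n : ℕ) → (Fin n → ℝ) → ℂ
  | 0, _ => 0
  | n + 1, x => dividedDiff f n x

theorem dividedDiff_mul_sub_I_last (n : ℕ) {f g : ℝ → ℂ} (hf : BoundedDerivs n f)
    (hg : ∀ x, g x = ((x : ℂ) - Complex.I) * f x) (x : Fin (n + 1) → ℝ) :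
    dividedDiff g n x = ((x (Fin.last n) : ℂ) - Complex.I) * dividedDiff f n x +
      predDividedDiff f n (Fin.init x) := by
  induction n with
  | zero => simp [dividedDiff, predDividedDiff, hg]
  | succ n ih =>
    simp only [dividedDiff]
    simp only [ih (hf.mono (Nat.le_succ n)), Function.update_self, Fin.init_update_last]
    rw [dslope_mul_sub_I_add (differentiable_dividedDiff_update hf _)]
    congr 2
    exact Function.update_eq_self (Fin.last n) (Fin.init x)

/-- `dslope` is symmetric in its two points, and these are the last two nodes. No further symmetry
of divided differences is needed. -/
theorem dividedDiff_swap_last (n : ℕ) (f : ℝ → ℂ) (x : Fin (n + 2) → ℝ) :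
    dividedDiff f (n + 1) x = dividedDiff f (n + 1)
      (Fin.snoc (α := fun _ => ℝ) (Function.update (Fin.init x) (Fin.last n)
        (x (Fin.last (n + 1)))) (x (Fin.last n).castSucc)) := by
  simp only [dividedDiff]
  rw [dslope_comm]
  simp

/-- `(f u)^{[n]}(x) = u(x_j) f^{[n]}(x) + f^{[n-1]}(x_0, …, x̂_j, …, x_n)` for `u(x) = x - i`. -/
theorem dividedDiff_mul_sub_I (n : ℕ) {f g : ℝ → ℂ} (hf : BoundedDerivs n f)
    (hg : ∀ x, g x = ((x : ℂ) - Complex.I) * f x) (x : Fin (n + 1) → ℝ) (j : Fin (n + 1)) :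
    dividedDiff g n x = ((x j : ℂ) - Complex.I) * dividedDiff f n x +
      predDividedDiff f n (fun k => x (j.succAbove k)) := by
  induction n with
  | zero =>
    rw [Subsingleton.elim (α := Fin 1) j (Fin.last 0), dividedDiff_mul_sub_I_last 0 hf hg]
    congr 1
  | succ n ih =>
    refine Fin.lastCases ?_ (fun j => ?_) j
    · rw [dividedDiff_mul_sub_I_last _ hf hg]
      congr 2
      ext k
      simp [Fin.init]
    refine Fin.lastCases ?_ (fun j => ?_) j
    -- The next to last node is exchanged with the last one, where the rule is already known.
    · rw [dividedDiff_swap_last n g, dividedDiff_mul_sub_I_last _ hf hg,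
        ← dividedDiff_swap_last n f]
      simp only [Fin.snoc_last, Fin.init_snoc]
      congr 2
      ext k
      refine Fin.lastCases ?_ (fun k => ?_) k
      · simp
      · rw [Function.update_of_ne (Fin.castSucc_lt_last k).ne]
        rw [Fin.succAbove_of_castSucc_lt]
        · rfl
        · simp
    -- An earlier node is not touched by the last step of the recursion, so `u(x_j)` is a constant
    -- factor inside `dslope` and the induction hypothesis can be differenced.
    · obtain _ | n := n
      · exact j.elim0
      have hf' := hf.mono (Nat.le_succ (n + 1))
      rw [dividedDiff]
      have hj : ∀ t, Function.update (Fin.init x) (Fin.last (n + 1)) t j.castSucc =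
          x j.castSucc.castSucc := fun t => Function.update_of_ne (Fin.castSucc_lt_last j).ne _ _
      have hrem : ∀ t, (fun k => Function.update (Fin.init x) (Fin.last (n + 1)) t
          (j.castSucc.succAbove k)) = Function.update
            (Fin.init fun k => x (j.castSucc.castSucc.succAbove k)) (Fin.last n) t := by
        intro t
        ext k
        refine Fin.lastCases ?_ (fun k => ?_) k
        · simp [Fin.succAbove_of_lt_succ]
        · rw [Function.update_of_ne (Fin.castSucc_lt_last k).ne, Fin.castSucc_succAbove_castSucc,
            Function.update_of_ne (Fin.castSucc_lt_last _).ne]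
          simp [Fin.init, Fin.castSucc_succAbove_castSucc]
      simp only [ih hf' _ j.castSucc, hj, hrem]
      simp only [predDividedDiff]
      rw [dslope_const_mul_add (differentiable_dividedDiff_update hf _)
        (differentiable_dividedDiff_update hf' _)]
      simp only [dividedDiff]
      congr 2
      · simp [Fin.castSucc_succAbove_castSucc, Fin.succAbove_of_lt_succ]
      have h : j.castSucc.castSucc.succAbove (Fin.last (n + 1)) = Fin.last (n + 2) :=
        (Fin.succAbove_of_le_castSucc _ _ (by simp [Fin.le_def])).trans (Fin.succ_last _)
      rw [h]

end

section

/-! ### Fourier representations -/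

theorem continuous_fourierIntegral {h : ℝ → ℂ} (hh : Integrable h) :
    Continuous fun x : ℝ => ∫ y, h y * Complex.exp (Complex.I * x * y) := by
  refine continuous_of_dominated (bound := fun y => ‖h y‖) (fun x => ?_) (fun x => ?_) hh.norm
    (Eventually.of_forall fun y => by fun_prop)
  · exact hh.aestronglyMeasurable.mul (by fun_prop : Continuous _).aestronglyMeasurable
  · refine Eventually.of_forall fun y => ?_
    rw [norm_mul, show Complex.I * x * y = ((x * y : ℝ) : ℂ) * Complex.I by push_cast; ring,
      Complex.norm_exp_ofReal_mul_I, mul_one]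

/-- Fubini turns the pairing with a test function into a pairing with the inverse transform of `h`,
so the two functions agree almost everywhere; both are continuous, hence they agree everywhere. -/
theorem HasFourierTransformL1.eq_integral {g h : ℝ → ℂ} (H : HasFourierTransformL1 g h)
    (hg : Continuous g) (x : ℝ) : g x = ∫ y, h y * Complex.exp (Complex.I * x * y) := by
  have hG := continuous_fourierIntegral H.1
  have hnorm : ∀ x y : ℝ, ‖Complex.exp (Complex.I * x * y)‖ = 1 := fun x y => by
    rw [show Complex.I * x * y = ((x * y : ℝ) : ℂ) * Complex.I by push_cast; ring,
      Complex.norm_exp_ofReal_mul_I]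
  have hae : g =ᵐ[volume] fun x : ℝ => ∫ y, h y * Complex.exp (Complex.I * x * y) := by
    refine ae_eq_of_integral_contDiff_smul_eq hg.locallyIntegrable hG.locallyIntegrable ?_
    intro ψ hψ hψc
    have h1 := H.2 (fun x => (ψ x : ℂ)) (Complex.ofRealCLM.contDiff.comp hψ)
      (hψc.comp_left (g := fun t : ℝ => (t : ℂ)) Complex.ofReal_zero)
    have hψi : Integrable fun x => (ψ x : ℂ) :=
      (hψ.continuous.integrable_of_hasCompactSupport hψc).ofReal
    have h2 : Integrable (Function.uncurry fun x y : ℝ =>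
        (ψ x : ℂ) * (h y * Complex.exp (Complex.I * x * y))) (volume.prod volume) := by
      have h3 : Integrable (fun p : ℝ × ℝ => ((ψ p.1 : ℂ) * h p.2) *
          Complex.exp (Complex.I * p.1 * p.2)) (volume.prod volume) :=
        (hψi.mul_prod H.1).mul_bdd (c := 1)
          (by fun_prop : Continuous _).aestronglyMeasurable
          (Eventually.of_forall fun p => (hnorm p.1 p.2).le)
      refine h3.congr (Eventually.of_forall fun p => ?_)
      simp only [Function.uncurry]
      ring
    calc ∫ x, ψ x • g x = ∫ x, g x * (ψ x : ℂ) := by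
          congr 1; ext x; rw [Complex.real_smul, mul_comm]
      _ = ∫ y, h y * ∫ x : ℝ, (ψ x : ℂ) * Complex.exp (Complex.I * x * y) := h1.symm
      _ = ∫ y, ∫ x : ℝ, (ψ x : ℂ) * (h y * Complex.exp (Complex.I * x * y)) := by
          congr 1; ext y; rw [← integral_const_mul]
          congr 1; ext x; ring
      _ = ∫ x : ℝ, ∫ y, (ψ x : ℂ) * (h y * Complex.exp (Complex.I * x * y)) :=
          (integral_integral_swap h2).symm
      _ = _ := by
          congr 1; ext x; rw [Complex.real_smul, integral_const_mul]
  exact congrFun ((hg.ae_eq_iff_eq volume hG).1 hae) x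

theorem HasFourierTransformL1.bounded {g h : ℝ → ℂ} (H : HasFourierTransformL1 g h)
    (hg : Continuous g) : ∃ C, ∀ x, ‖g x‖ ≤ C := by
  refine ⟨∫ y, ‖h y‖, fun x => ?_⟩
  rw [H.eq_integral hg]
  refine (norm_integral_le_integral_norm _).trans (le_of_eq ?_)
  congr 1
  ext y
  rw [norm_mul, show Complex.I * x * y = ((x * y : ℝ) : ℂ) * Complex.I by push_cast; ring,
      Complex.norm_exp_ofReal_mul_I, mul_one]

theorem hasFourierTransformL1_fourierTransform {g : ℝ → ℂ}
    (H : ∃ h, HasFourierTransformL1 g h) : HasFourierTransformL1 g (fourierTransform g) := by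
  rw [fourierTransform, dif_pos H]
  exact H.choose_spec

theorem fourierNorm_nonneg (g : ℝ → ℂ) : 0 ≤ fourierNorm g :=
  integral_nonneg fun _ => norm_nonneg _

/-- `φ(x) = ∫ w(ω) exp(i θ(ω)·x) dμ(ω)`, with `‖w‖₁ ≤ C`. -/
def IsFourierIntegral {k : ℕ} (φ : (Fin k → ℝ) → ℂ) (C : ℝ) : Prop :=
  ∃ (Ω : Type) (_ : MeasurableSpace Ω) (μ : Measure Ω) (w : Ω → ℂ) (θ : Ω → Fin k → ℝ),
    Integrable w μ ∧ (∀ j, Measurable fun ω => θ ω j) ∧ ∫ ω, ‖w ω‖ ∂μ ≤ C ∧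
      ∀ x, φ x = ∫ ω, w ω * ∏ j, Complex.exp ((θ ω j * x j : ℝ) * Complex.I) ∂μ

/-- Fourier inversion is inserted into the Hermite–Genocchi formula. The exponential of `∑ θ_j x_j`
splits into one factor per variable, and the mass of the simplex contributes `1 / n!`. -/
theorem isFourierIntegral_dividedDiff {n : ℕ} {g : ℝ → ℂ} (hg : ContDiff ℝ n g)
    (hF : ∀ k ≤ n, ∃ h, HasFourierTransformL1 (iteratedDeriv k g) h) :
    IsFourierIntegral (dividedDiff g n) (fourierNorm (iteratedDeriv n g) / n.factorial) := by
  have hc : ∀ k ≤ n, Continuous (iteratedDeriv k g) := fun k hk =>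
    hg.continuous_iteratedDeriv k (by exact_mod_cast hk)
  have hb : BoundedDerivs n g := ⟨hg, fun k hk => by
    obtain ⟨h, hh⟩ := hF k hk
    exact hh.bounded (hc k hk)⟩
  have hh := hasFourierTransformL1_fourierTransform (hF n le_rfl)
  set h := fourierTransform (iteratedDeriv n g) with hdef
  set P := simplexParam n with hP
  have hw : Integrable (fun p : P.Ω × ℝ => (P.w p.1 : ℂ) * h p.2) (P.ν.prod volume) :=
    P.integrable_w.ofReal.mul_prod hh.1
  refine ⟨P.Ω × ℝ, inferInstance, P.ν.prod volume, fun p => P.w p.1 * h p.2,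
    fun p j => p.2 * P.θ p.1 j, hw,
    fun j => measurable_snd.mul ((P.measurable_θ j).comp measurable_fst), le_of_eq ?_, fun x => ?_⟩
  · have h1 := integral_prod_mul (μ := P.ν) (ν := (volume : Measure ℝ)) P.w (fun y => ‖h y‖)
    rw [P.integral_w] at h1
    calc _ = ∫ p : P.Ω × ℝ, P.w p.1 * ‖h p.2‖ ∂P.ν.prod volume := by
          refine integral_congr_ae (Eventually.of_forall fun p => ?_)
          simp only [norm_mul, Complex.norm_real, Real.norm_of_nonneg (P.w_mem p.1).1]
      _ = _ := by rw [h1, fourierNorm, one_div, inv_mul_eq_div]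
  · have hprod : ∀ p : P.Ω × ℝ, ∏ j, Complex.exp ((p.2 * P.θ p.1 j * x j : ℝ) * Complex.I) =
        Complex.exp (Complex.I * ((∑ j, P.θ p.1 j * x j : ℝ) : ℂ) * p.2) := by
      intro p
      rw [← Complex.exp_sum]
      congr 1
      push_cast
      rw [Finset.mul_sum, Finset.sum_mul]
      exact Finset.sum_congr rfl fun j _ => by ring
    have hi : Integrable (fun p : P.Ω × ℝ => (P.w p.1 : ℂ) * h p.2 *
        ∏ j, Complex.exp ((p.2 * P.θ p.1 j * x j : ℝ) * Complex.I)) (P.ν.prod volume) := by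
      refine hw.mul_bdd (c := 1) ?_ (Eventually.of_forall fun p => ?_)
      · have hθ := P.measurable_θ
        exact Measurable.aestronglyMeasurable (by fun_prop)
      · simp only [norm_prod, Complex.norm_exp_ofReal_mul_I, Finset.prod_const_one, le_refl]
    rw [dividedDiff_eq_mean n hb, SimplexParam.mean, integral_prod _ hi]
    congr 1
    ext ω
    rw [hh.eq_integral (hc n le_rfl), ← integral_const_mul]
    congr 1
    ext y
    rw [hprod (ω, y)]
    exact (mul_assoc _ _ _).symm

/-! ### The weighted functions `f u^m` -/

theorem weighted_zero (f : ℝ → ℂ) : weighted f 0 = f := by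
  ext x; simp [weighted]

theorem weighted_succ (f : ℝ → ℂ) (m : ℕ) (x : ℝ) :
    weighted f (m + 1) x = ((x : ℂ) - Complex.I) * weighted f m x := by
  simp only [weighted]; ring

theorem contDiff_weighted {n : ℕ} {f : ℝ → ℂ} (hf : ContDiff ℝ n f) (m : ℕ) :
    ContDiff ℝ n (weighted f m) :=
  hf.mul ((Complex.ofRealCLM.contDiff.sub contDiff_const).pow m)

theorem boundedDerivs_weighted {s n : ℕ} {f : ℝ → ℂ} (hf : f ∈ classW s n) {m : ℕ} (hm : m ≤ s) :
    BoundedDerivs n (weighted f m) :=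
  ⟨contDiff_weighted hf.1 m, fun k hk => by
    obtain ⟨h, hh⟩ := hf.2 m hm k hk
    exact hh.bounded ((contDiff_weighted hf.1 m).continuous_iteratedDeriv k
      (by exact_mod_cast hk))⟩

theorem isFourierIntegral_dividedDiff_weighted {s n : ℕ} {f : ℝ → ℂ} (hf : f ∈ classW s n)
    {m : ℕ} (hm : m ≤ s) {k : ℕ} (hk : k ≤ n) :
    IsFourierIntegral (dividedDiff (weighted f m) k)
      (fourierNorm (iteratedDeriv k (weighted f m)) / k.factorial) :=
  isFourierIntegral_dividedDiff ((contDiff_weighted hf.1 m).of_le (by exact_mod_cast hk))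
    fun j hj => hf.2 m hm j (hj.trans hk)

theorem dividedDiff_weighted_succ {s n : ℕ} {f : ℝ → ℂ} (hf : f ∈ classW s n)
    {m : ℕ} (hm : m ≤ s) {k : ℕ} (hk : k ≤ n) (x : Fin (k + 1) → ℝ) (j : Fin (k + 1)) :
    dividedDiff (weighted f (m + 1)) k x =
      ((x j : ℂ) - Complex.I) * dividedDiff (weighted f m) k x +
        predDividedDiff (weighted f m) k (fun i => x (j.succAbove i)) :=
  dividedDiff_mul_sub_I k ((boundedDerivs_weighted hf hm).mono hk) (weighted_succ f m) x j

end

section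

variable {𝓗 : Type*} [NormedAddCommGroup 𝓗] [InnerProductSpace ℂ 𝓗]

/-! ### Hilbert bases -/

theorem _root_.HilbertBasis.eq_of_inner {ι : Type*} (b : HilbertBasis ι ℂ 𝓗) {x y : 𝓗}
    (h : ∀ i, ⟪b i, x⟫_ℂ = ⟪b i, y⟫_ℂ) : x = y := by
  refine b.repr.injective (lp.ext (funext fun i => ?_))
  rw [b.repr_apply_apply, b.repr_apply_apply, h]

theorem _root_.HilbertBasis.clm_ext {ι : Type*} (b : HilbertBasis ι ℂ 𝓗) {S T : 𝓗 →L[ℂ] 𝓗}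
    (h : ∀ i, S (b i) = T (b i)) : S = T := by
  refine ContinuousLinearMap.ext_on (s := Set.range b) ?_ ?_
  · have := b.dense_span
    rw [Submodule.dense_iff_topologicalClosure_eq_top]
    exact this
  · rintro _ ⟨i, rfl⟩
    exact h i

theorem isCompactOperator_finset_sum {ι : Type*} (F : Finset ι) (T : ι → 𝓗 →L[ℂ] 𝓗)
    (h : ∀ i ∈ F, IsCompactOperator (T i)) : IsCompactOperator (∑ i ∈ F, T i : 𝓗 →L[ℂ] 𝓗) := by
  classical
  induction F using Finset.induction_on with
  | empty => exact isCompactOperator_zero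
  | insert a F ha ih =>
    rw [Finset.sum_insert ha]
    exact (h a (Finset.mem_insert_self a F)).add
      (ih fun i hi => h i (Finset.mem_insert_of_mem hi))

/-! ### Resolvents of self-adjoint operators -/

theorem IsResolventAt.eq {H : 𝓗 →ₗ.[ℂ] 𝓗} {z : ℂ} {R R' : 𝓗 →L[ℂ] 𝓗}
    (h : IsResolventAt H z R) (h' : IsResolventAt H z R') : R = R' := by
  ext φ
  obtain ⟨hφ, h1⟩ := h'.1 φ
  have h2 := h.2 ⟨R' φ, hφ⟩
  simp only at h2
  rwa [h1] at h2

theorem IsResolventAt.eq_resolventAt {H : 𝓗 →ₗ.[ℂ] 𝓗} {z : ℂ} {R : 𝓗 →L[ℂ] 𝓗}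
    (h : IsResolventAt H z R) : R = resolventAt H z := by
  have h0 : ∃ R, IsResolventAt H z R := ⟨R, h⟩
  rw [resolventAt, dif_pos h0]
  exact h.eq h0.choose_spec

theorem IsResolventAt.sub_eq {H : 𝓗 →ₗ.[ℂ] 𝓗} {z w : ℂ} {R R' : 𝓗 →L[ℂ] 𝓗}
    (h : IsResolventAt H z R) (h' : IsResolventAt H w R') (φ : 𝓗) :
    R φ - R' φ = (z - w) • R (R' φ) := by
  obtain ⟨hφ, h1⟩ := h'.1 φ
  have h2 := h.2 ⟨R' φ, hφ⟩
  simp only at h2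
  have h3 : φ = (H ⟨R' φ, hφ⟩ - z • R' φ) + (z - w) • R' φ := by
    rw [sub_smul]
    refine h1.symm.trans ?_
    abel
  have h4 := congrArg R h3
  rw [map_add, map_smul, h2] at h4
  rw [h4]
  abel

theorem IsResolventAt.commute {H : 𝓗 →ₗ.[ℂ] 𝓗} {z w : ℂ} {R R' : 𝓗 →L[ℂ] 𝓗}
    (h : IsResolventAt H z R) (h' : IsResolventAt H w R') (φ : 𝓗) : R (R' φ) = R' (R φ) := by
  by_cases hzw : z = w
  · subst hzw; rw [h.eq h']
  · have h1 := h.sub_eq h' φ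
    have h2 := h'.sub_eq h φ
    have h3 : (z - w) • R (R' φ) = (z - w) • R' (R φ) := by
      rw [← h1, ← neg_sub w z, neg_smul, ← h2]; abel
    exact smul_right_injective _ (sub_ne_zero.2 hzw) h3

/-- `v` is in the domain of `H`, and `H v = l v`. -/
def IsEigenvec (H : 𝓗 →ₗ.[ℂ] 𝓗) (l : ℝ) (v : 𝓗) : Prop :=
  ∃ h : v ∈ H.domain, H ⟨v, h⟩ = (l : ℂ) • v

theorem ofReal_sub_I_ne_zero (l : ℝ) : (l : ℂ) - Complex.I ≠ 0 := fun h => by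
  simpa using congrArg Complex.im h

theorem ofReal_add_I_ne_zero (l : ℝ) : (l : ℂ) - -Complex.I ≠ 0 := fun h => by
  simpa using congrArg Complex.im h

theorem IsResolventAt.apply_eigenvec {H : 𝓗 →ₗ.[ℂ] 𝓗} {z : ℂ} {R : 𝓗 →L[ℂ] 𝓗}
    (h : IsResolventAt H z R) {l : ℝ} (hz : (l : ℂ) - z ≠ 0) {v : 𝓗} (hv : IsEigenvec H l v) :
    R v = ((l : ℂ) - z)⁻¹ • v := by
  obtain ⟨hd, hv⟩ := hv
  have h2 := h.2 ⟨v, hd⟩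
  simp only at h2
  rw [hv, ← sub_smul, map_smul] at h2
  rw [eq_inv_smul_iff₀ hz, h2]

theorem _root_.IsSelfAdjoint.inner_apply_left [CompleteSpace 𝓗] {H : 𝓗 →ₗ.[ℂ] 𝓗} (hH : IsSelfAdjoint H)
    (x y : H.domain) : ⟪H x, (y : 𝓗)⟫_ℂ = ⟪(x : 𝓗), H y⟫_ℂ := by
  have h := LinearPMap.adjoint_isFormalAdjoint hH.dense_domain
  rw [LinearPMap.isSelfAdjoint_def.1 hH] at h
  exact h x y

/-- The cross term is the real part of `z ⟪H x, x⟫`, which vanishes because `⟪H x, x⟫` is real and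
`z = ±i`. -/
theorem _root_.IsSelfAdjoint.norm_sub_smul_sq [CompleteSpace 𝓗] {H : 𝓗 →ₗ.[ℂ] 𝓗} (hH : IsSelfAdjoint H)
    {z : ℂ} (hz : z = Complex.I ∨ z = -Complex.I) (x : H.domain) :
    ‖H x - z • (x : 𝓗)‖ ^ 2 = ‖H x‖ ^ 2 + ‖(x : 𝓗)‖ ^ 2 := by
  have h1 := IsSelfAdjoint.inner_apply_left hH x x
  have h2 : (⟪H x, (x : 𝓗)⟫_ℂ).im = 0 := by
    have h3 : (starRingEnd ℂ) ⟪H x, (x : 𝓗)⟫_ℂ = ⟪H x, (x : 𝓗)⟫_ℂ := by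
      rw [inner_conj_symm, h1]
    exact Complex.conj_eq_iff_im.1 h3
  have hn : ‖z‖ = 1 := by rcases hz with rfl | rfl <;> simp
  have hre : RCLike.re ⟪H x, z • (x : 𝓗)⟫_ℂ = 0 := by
    rw [inner_smul_right]
    rcases hz with rfl | rfl <;> simp [h2]
  rw [norm_sub_sq (𝕜 := ℂ), hre, norm_smul, hn]
  ring

/-- The norm identity makes `H - z` injective with closed range. A vector orthogonal to the range
lies in the domain of the adjoint, which is `H`, and would be an eigenvector for the non-real value
`conj z`; so the range is everything. -/
theorem _root_.IsSelfAdjoint.exists_isResolventAt [CompleteSpace 𝓗] {H : 𝓗 →ₗ.[ℂ] 𝓗}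
    (hH : IsSelfAdjoint H) {z : ℂ} (hz : z = Complex.I ∨ z = -Complex.I) :
    ∃ R, IsResolventAt H z R := by
  have hnorm : ∀ x : H.domain, ‖(x : 𝓗)‖ ≤ ‖H x - z • (x : 𝓗)‖ := fun x =>
    le_of_sq_le_sq (by rw [hH.norm_sub_smul_sq hz]; nlinarith [sq_nonneg ‖H x‖]) (norm_nonneg _)
  have hnorm' : ∀ x : H.domain, ‖H x‖ ≤ ‖H x - z • (x : 𝓗)‖ := fun x =>
    le_of_sq_le_sq (by rw [hH.norm_sub_smul_sq hz]; nlinarith [sq_nonneg ‖(x : 𝓗)‖]) (norm_nonneg _)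
  set A : H.domain →ₗ[ℂ] 𝓗 := H.toFun - z • H.domain.subtype with hA
  have hAa : ∀ x, A x = H x - z • (x : 𝓗) := fun x => rfl
  have hinj : Function.Injective A := by
    rw [← LinearMap.ker_eq_bot, LinearMap.ker_eq_bot']
    intro x hx
    have := hnorm x
    rw [← hAa, hx, norm_zero] at this
    exact Subtype.ext (norm_le_zero_iff.1 this)
  -- The range is the image of the graph of `H`, complete because `H` is closed, under a bounded map
  -- that is bounded below.
  have hclosed : IsClosed (LinearMap.range A : Set 𝓗) := by
    have hc : IsClosed (H.graph : Set (𝓗 × 𝓗)) := hH.isClosed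
    have : CompleteSpace H.graph := hc.completeSpace_coe
    let B : H.graph →L[ℂ] 𝓗 := (ContinuousLinearMap.snd ℂ 𝓗 𝓗 -
      z • ContinuousLinearMap.fst ℂ 𝓗 𝓗).comp H.graph.subtypeL
    have hB : AntilipschitzWith 1 B := by
      refine AddMonoidHomClass.antilipschitz_of_bound B fun p => ?_
      obtain ⟨⟨a, b⟩, hp⟩ := p
      obtain ⟨y, hy1, hy2⟩ := H.mem_graph_iff.1 hp
      simp only at hy1 hy2
      have h3 : B ⟨(a, b), hp⟩ = H y - z • (y : 𝓗) := by
        change b - z • a = _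
        rw [hy1, hy2]
      rw [h3]
      simp only [NNReal.coe_one, one_mul]
      change ‖(a, b)‖ ≤ _
      rw [Prod.norm_def]
      refine max_le ?_ ?_
      · rw [← hy1]; exact hnorm y
      · rw [← hy2]; exact hnorm' y
    have h4 := hB.isClosed_range B.uniformContinuous
    convert h4 using 1
    ext v
    constructor
    · rintro ⟨x, rfl⟩
      exact ⟨⟨((x : 𝓗), H x), H.mem_graph x⟩, rfl⟩
    · rintro ⟨⟨⟨a, b⟩, hp⟩, rfl⟩
      obtain ⟨y, hy1, hy2⟩ := H.mem_graph_iff.1 hp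
      simp only at hy1 hy2
      refine ⟨y, ?_⟩
      change H y - z • (y : 𝓗) = b - z • a
      rw [hy1, hy2]
  have horth : (LinearMap.range A)ᗮ = ⊥ := by
    rw [Submodule.eq_bot_iff]
    intro v hv
    have hv' : ∀ x : H.domain, ⟪(starRingEnd ℂ z) • v, (x : 𝓗)⟫_ℂ = ⟪v, H x⟫_ℂ := by
      intro x
      have h1 := (Submodule.mem_orthogonal' _ _).1 hv (A x) ⟨x, rfl⟩
      rw [hAa, inner_sub_right, sub_eq_zero, inner_smul_right] at h1
      rw [h1, inner_smul_left, starRingEnd_self_apply]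
    have hvd : v ∈ H.domain := by
      have := LinearPMap.mem_adjoint_domain_of_exists (T := H) v ⟨_, hv'⟩
      rwa [LinearPMap.isSelfAdjoint_def.1 hH] at this
    have h2 := hv' ⟨v, hvd⟩
    have h3 := hH.inner_apply_left ⟨v, hvd⟩ ⟨v, hvd⟩
    simp only at h2 h3
    rw [inner_smul_left, starRingEnd_self_apply] at h2
    have h5 := congrArg (starRingEnd ℂ) h2
    rw [map_mul, inner_conj_symm, inner_conj_symm, h3, ← h2] at h5
    have h4 : (z - starRingEnd ℂ z) * ⟪v, v⟫_ℂ = 0 := by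
      rw [sub_mul, sub_eq_zero, h5]
    rcases mul_eq_zero.1 h4 with h5 | h5
    · exfalso
      have h6 := congrArg Complex.im h5
      rcases hz with rfl | rfl <;> norm_num at h6
    · exact inner_self_eq_zero.1 h5
  have hsurj : Function.Surjective A := by
    rw [← LinearMap.range_eq_top]
    have : CompleteSpace (LinearMap.range A) := hclosed.completeSpace_coe
    exact Submodule.orthogonal_eq_bot_iff.1 horth
  let e := LinearEquiv.ofBijective A ⟨hinj, hsurj⟩
  have he : ∀ φ, A (e.symm φ) = φ := fun φ => e.apply_symm_apply φ
  refine ⟨(H.domain.subtype ∘ₗ (e.symm : 𝓗 →ₗ[ℂ] H.domain)).mkContinuous 1 fun φ => ?_,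
    fun φ => ?_, fun φ => ?_⟩
  · rw [one_mul]
    have := hnorm (e.symm φ)
    rwa [← hAa, he] at this
  · exact ⟨(e.symm φ).2, he φ⟩
  · have : e.symm (A φ) = φ := e.symm_apply_apply φ
    exact congrArg Subtype.val this

theorem _root_.IsSelfAdjoint.isResolventAt [CompleteSpace 𝓗] {H : 𝓗 →ₗ.[ℂ] 𝓗}
    (hH : IsSelfAdjoint H) {z : ℂ} (hz : z = Complex.I ∨ z = -Complex.I) :
    IsResolventAt H z (resolventAt H z) := by
  obtain ⟨R, hR⟩ := hH.exists_isResolventAt hz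
  rwa [← hR.eq_resolventAt]

theorem _root_.IsSelfAdjoint.norm_resolventAt_le [CompleteSpace 𝓗] {H : 𝓗 →ₗ.[ℂ] 𝓗}
    (hH : IsSelfAdjoint H) : ‖resolventAt H Complex.I‖ ≤ 1 := by
  refine ContinuousLinearMap.opNorm_le_bound _ zero_le_one fun φ => ?_
  obtain ⟨hd, h1⟩ := (hH.isResolventAt (Or.inl rfl)).1 φ
  have h2 := hH.norm_sub_smul_sq (Or.inl rfl) ⟨_, hd⟩
  rw [h1] at h2
  rw [one_mul]
  exact le_of_sq_le_sq (by rw [h2]; nlinarith [sq_nonneg ‖H ⟨_, hd⟩‖]) (norm_nonneg _)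

theorem _root_.IsSelfAdjoint.adjoint_resolventAt [CompleteSpace 𝓗] {H : 𝓗 →ₗ.[ℂ] 𝓗}
    (hH : IsSelfAdjoint H) :
    ContinuousLinearMap.adjoint (resolventAt H Complex.I) = resolventAt H (-Complex.I) := by
  symm
  rw [ContinuousLinearMap.eq_adjoint_iff]
  intro x y
  obtain ⟨hx, h1⟩ := (hH.isResolventAt (Or.inr rfl)).1 x
  obtain ⟨hy, h2⟩ := (hH.isResolventAt (Or.inl rfl)).1 y
  nth_rewrite 2 [← h1]
  nth_rewrite 1 [← h2]
  have h3 := hH.inner_apply_left ⟨_, hx⟩ ⟨_, hy⟩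
  simp only at h3
  rw [inner_sub_right, inner_sub_left, h3, inner_smul_left, inner_smul_right]
  simp

/-- The sum is symmetric. Conversely, as `W` is bounded, any vector in the domain of the adjoint of
`H + W` is in the domain of the adjoint of `H`, which is the domain of `H`. -/
theorem isSelfAdjoint_perturb [CompleteSpace 𝓗] {H : 𝓗 →ₗ.[ℂ] 𝓗} (hH : IsSelfAdjoint H)
    {W : 𝓗 →L[ℂ] 𝓗} (hW : IsSelfAdjoint W) : IsSelfAdjoint (perturb H W) := by
  have hd : Dense ((perturb H W).domain : Set 𝓗) := hH.dense_domain
  have hWs : ∀ x y : 𝓗, ⟪W x, y⟫_ℂ = ⟪x, W y⟫_ℂ :=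
    ContinuousLinearMap.isSelfAdjoint_iff_isSymmetric.mp hW
  have hap : ∀ x : (perturb H W).domain, perturb H W x = W x + H ⟨x, x.2⟩ := fun x => rfl
  have hfa : (perturb H W).IsFormalAdjoint (perturb H W) := by
    intro x y
    rw [hap, hap, inner_add_left, inner_add_right, hWs]
    congr 1
    exact hH.inner_apply_left ⟨x, x.2⟩ ⟨y, y.2⟩
  have hle := LinearPMap.IsFormalAdjoint.le_adjoint hd hfa
  refine (LinearPMap.eq_of_le_of_domain_eq hle (le_antisymm hle.1 fun y hy => ?_)).symm
  have h1 := LinearPMap.adjoint_isFormalAdjoint hd ⟨y, hy⟩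
  have h2 : y ∈ H.adjoint.domain := by
    refine LinearPMap.mem_adjoint_domain_of_exists y
      ⟨(perturb H W).adjoint ⟨y, hy⟩ - W y, fun x => ?_⟩
    have h3 := h1 ⟨x, x.2⟩
    rw [inner_sub_left, h3, hap, inner_add_right, hWs]
    simp
  rwa [LinearPMap.isSelfAdjoint_def.1 hH] at h2

/-- The second resolvent identity, arranged with the unperturbed resolvent on the left: this is the
form `R K` used in the trace estimate. -/
theorem resolventAt_perturb [CompleteSpace 𝓗] {H : 𝓗 →ₗ.[ℂ] 𝓗} (hH : IsSelfAdjoint H)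
    {W : 𝓗 →L[ℂ] 𝓗} (hW : IsSelfAdjoint W) :
    resolventAt (perturb H W) Complex.I =
      resolventAt H Complex.I * (1 - W * resolventAt (perturb H W) Complex.I) := by
  ext φ
  obtain ⟨hd, h1⟩ := ((isSelfAdjoint_perturb hH hW).isResolventAt (Or.inl rfl)).1 φ
  have h2 := (hH.isResolventAt (Or.inl rfl)).2 ⟨_, hd⟩
  refine h2.symm.trans (congrArg _ ?_)
  exact eq_sub_of_add_eq' ((add_sub_assoc _ _ _).symm.trans h1)

end

section

variable {𝓗 : Type*} [NormedAddCommGroup 𝓗] [InnerProductSpace ℂ 𝓗] [CompleteSpace 𝓗]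

/-! ### Eigenbases of self-adjoint operators with compact resolvent -/

/-- The restriction of `R` to `G` is normal, compact and nonzero. Its spectral radius equals its
norm, so it has a nonzero spectral value `z`, which is an eigenvalue. An eigenvector of `R` for `z`
is one of `H` for `i + z⁻¹`, and this number is real by symmetry. -/
theorem exists_isEigenvec_mem {H : 𝓗 →ₗ.[ℂ] 𝓗} (hH : IsSelfAdjoint H)
    (hc : IsCompactOperator (resolventAt H Complex.I)) (G : Submodule ℂ 𝓗) [CompleteSpace G]
    (h1 : ∀ x ∈ G, resolventAt H Complex.I x ∈ G) (h2 : ∀ x ∈ G, resolventAt H (-Complex.I) x ∈ G)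
    (hG : G ≠ ⊥) : ∃ x ∈ G, ‖x‖ = 1 ∧ ∃ l : ℝ, IsEigenvec H l x := by
  have hR := hH.isResolventAt (Or.inl rfl)
  let S : G →L[ℂ] G := (resolventAt H Complex.I).restrict h1
  let S' : G →L[ℂ] G := (resolventAt H (-Complex.I)).restrict h2
  have hSS' : ContinuousLinearMap.adjoint S = S' := by
    symm
    rw [ContinuousLinearMap.eq_adjoint_iff]
    intro x y
    change ⟪resolventAt H (-Complex.I) x, (y : 𝓗)⟫_ℂ = ⟪(x : 𝓗), resolventAt H Complex.I y⟫_ℂ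
    rw [← hH.adjoint_resolventAt, ContinuousLinearMap.adjoint_inner_left]
  have hSn : IsStarNormal S := by
    constructor
    rw [ContinuousLinearMap.star_eq_adjoint, hSS']
    ext φ
    exact (hH.isResolventAt (Or.inr rfl)).commute hR φ
  have hSc : IsCompactOperator S := hc.restrict' h1
  have : Nontrivial G := Submodule.nontrivial_iff_ne_bot.2 hG
  have hS0 : S ≠ 0 := by
    intro h
    obtain ⟨x, hx⟩ := exists_ne (0 : G)
    have h3 : resolventAt H Complex.I x = 0 := congrArg Subtype.val (DFunLike.congr_fun h x)
    obtain ⟨hd, h4⟩ := hR.1 x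
    have h5 : H ⟨_, hd⟩ = 0 := by
      have : (⟨_, hd⟩ : H.domain) = 0 := Subtype.ext h3
      rw [this, LinearPMap.map_zero]
    rw [h5, h3, smul_zero, sub_zero] at h4
    exact hx (Subtype.ext h4.symm)
  obtain ⟨z, hz, hzn⟩ := spectrum.exists_nnnorm_eq_spectralRadius S
  replace hzn := hzn.trans (IsStarNormal.spectralRadius_eq_nnnorm S)
  have hz0 : z ≠ 0 := by
    rintro rfl
    rw [nnnorm_zero, ENNReal.coe_inj] at hzn
    have h0 : ‖S‖ = 0 := congrArg NNReal.toReal hzn.symm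
    exact hS0 (ContinuousLinearMap.ext fun x => norm_le_zero_iff.1
      ((S.le_opNorm x).trans (by rw [h0, zero_mul])))
  obtain ⟨x, hx⟩ := ((hSc.hasEigenvalue_iff_mem_spectrum hz0).2 hz).exists_hasEigenvector
  have hx1 : resolventAt H Complex.I x = z • (x : 𝓗) := congrArg Subtype.val hx.apply_eq_smul
  have hx0 : (x : 𝓗) ≠ 0 := fun h => hx.2 (Subtype.ext h)
  set u : 𝓗 := ((‖(x : 𝓗)‖ : ℂ))⁻¹ • (x : 𝓗) with hu
  have hu1 : ‖u‖ = 1 := by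
    rw [hu, norm_smul, norm_inv, Complex.norm_real, norm_norm,
      inv_mul_cancel₀ (norm_ne_zero_iff.2 hx0)]
  have hRu : resolventAt H Complex.I u = z • u := by
    rw [hu, map_smul, hx1, smul_comm]
  obtain ⟨hd, h4⟩ := hR.1 u
  have hud : u ∈ H.domain := by
    have : u = z⁻¹ • resolventAt H Complex.I u := by rw [hRu, inv_smul_smul₀ hz0]
    rw [this]
    exact H.domain.smul_mem _ hd
  have h5 : H ⟨u, hud⟩ = (Complex.I + z⁻¹) • u := by
    have h6 : (⟨_, hd⟩ : H.domain) = z • ⟨u, hud⟩ := Subtype.ext hRu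
    rw [h6, LinearPMap.map_smul, hRu] at h4
    have h7 : z⁻¹ • u = z⁻¹ • (z • H ⟨u, hud⟩ - Complex.I • z • u) := by rw [h4]
    rw [smul_sub, inv_smul_smul₀ hz0, smul_comm Complex.I, inv_smul_smul₀ hz0] at h7
    rw [add_smul, h7]
    abel
  have h8 : (starRingEnd ℂ) (Complex.I + z⁻¹) = Complex.I + z⁻¹ := by
    have h9 := hH.inner_apply_left ⟨u, hud⟩ ⟨u, hud⟩
    rw [h5] at h9
    simpa [inner_smul_left, inner_smul_right, inner_self_eq_norm_sq_to_K, hu1] using h9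
  refine ⟨u, G.smul_mem _ x.2, hu1, (Complex.I + z⁻¹).re, hud, ?_⟩
  rw [h5, Complex.conj_eq_iff_re.1 h8]

/-- An orthonormal basis of eigenvectors of `H`, with eigenvalues tending to infinity. -/
structure EigenSystem (H : 𝓗 →ₗ.[ℂ] 𝓗) where
  /-- the index set -/
  ι : Set 𝓗
  /-- the eigenvectors -/
  basis : HilbertBasis ι ℂ 𝓗
  /-- the eigenvalues -/
  ev : ι → ℝ
  isEigenvec : ∀ i, IsEigenvec H (ev i) (basis i)
  finite : ∀ C : ℝ, {i | |ev i| ≤ C}.Finite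

/-- If `|ev i| ≤ C`, then `R (b i)` has norm at least `1 / (C + 1)`, and these vectors are
orthogonal. Infinitely many of them would have no convergent subsequence. -/
theorem finite_eigenvalues_le {H : 𝓗 →ₗ.[ℂ] 𝓗} (hH : IsSelfAdjoint H)
    (hc : IsCompactOperator (resolventAt H Complex.I)) {ι : Type*} {b : ι → 𝓗}
    (hb : Orthonormal ℂ b) {ev : ι → ℝ} (he : ∀ i, IsEigenvec H (ev i) (b i)) (C : ℝ) :
    {i | |ev i| ≤ C}.Finite := by
  by_contra hinf
  have hinf : {i | |ev i| ≤ C}.Infinite := hinf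
  let g : ℕ → ι := fun n => hinf.natEmbedding _ n
  have hg : Function.Injective g := fun m n h =>
    (hinf.natEmbedding _).injective (Subtype.ext h)
  have hgC : ∀ n, |ev (g n)| ≤ C := fun n => (hinf.natEmbedding _ n).2
  have hC : 0 ≤ C := (abs_nonneg _).trans (hgC 0)
  obtain ⟨K, hK, hK'⟩ := hc.image_closedBall_subset_compact 1
  obtain ⟨y, -, ψ, hψ, hψy⟩ := hK.tendsto_subseq (x := fun n => resolventAt H Complex.I (b (g n)))
    (fun n => hK' ⟨b (g n), by simp [hb.1], rfl⟩)
  have hcau := hψy.cauchySeq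
  rw [Metric.cauchySeq_iff'] at hcau
  obtain ⟨N, hN⟩ := hcau (C + 1)⁻¹ (by positivity)
  have h1 := hN (N + 1) (Nat.le_succ N)
  have hne : g (ψ (N + 1)) ≠ g (ψ N) := fun h => by
    have := hψ.injective (hg h)
    omega
  set i := g (ψ (N + 1)) with hi
  set k := g (ψ N) with hk
  have hR := hH.isResolventAt (Or.inl rfl)
  simp only [Function.comp] at h1
  rw [hR.apply_eigenvec (ofReal_sub_I_ne_zero _) (he _),
    hR.apply_eigenvec (ofReal_sub_I_ne_zero _) (he _), ← hi, ← hk, dist_eq_norm] at h1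
  have h2 : ‖((ev i : ℂ) - Complex.I)⁻¹‖ ≤
      ‖((ev i : ℂ) - Complex.I)⁻¹ • b i - ((ev k : ℂ) - Complex.I)⁻¹ • b k‖ := by
    have h3 : ⟪b i, ((ev i : ℂ) - Complex.I)⁻¹ • b i - ((ev k : ℂ) - Complex.I)⁻¹ • b k⟫_ℂ =
        ((ev i : ℂ) - Complex.I)⁻¹ := by
      rw [inner_sub_right, inner_smul_right, inner_smul_right, hb.2 hne,
        inner_self_eq_norm_sq_to_K, hb.1]
      simp
    rw [← h3]
    refine (norm_inner_le_norm _ _).trans ?_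
    rw [hb.1, one_mul, h3]
  have h4 : (C + 1)⁻¹ ≤ ‖((ev i : ℂ) - Complex.I)⁻¹‖ := by
    rw [norm_inv]
    refine inv_anti₀ (norm_pos_iff.2 (ofReal_sub_I_ne_zero _)) ((norm_sub_le _ _).trans ?_)
    rw [Complex.norm_real, Complex.norm_I, Real.norm_eq_abs]
    exact add_le_add_left (hgC _) 1
  linarith

/-- A maximal orthonormal set of eigenvectors is complete: its orthogonal complement is invariant
under the resolvents at `±i`, so if nonzero it would contain a further eigenvector. -/
theorem exists_eigenSystem {H : 𝓗 →ₗ.[ℂ] 𝓗} (hH : IsSelfAdjoint H)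
    (hc : IsCompactOperator (resolventAt H Complex.I)) : Nonempty (EigenSystem H) := by
  obtain ⟨s, hs⟩ := zorn_subset {s : Set 𝓗 | Orthonormal ℂ (fun x : s => (x : 𝓗)) ∧
      ∀ x ∈ s, ∃ l : ℝ, IsEigenvec H l x} (by
    intro c hc cc
    refine ⟨⋃₀ c, ⟨orthonormal_sUnion_of_directed cc.directedOn fun x xc => (hc xc).1, ?_⟩,
      fun _ => Set.subset_sUnion_of_mem⟩
    rintro x ⟨t, htc, hxt⟩
    exact (hc htc).2 x hxt)
  obtain ⟨hso, hse⟩ := hs.prop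
  have hbot : (Submodule.span ℂ s)ᗮ = ⊥ := by
    by_contra hne
    have hinv : ∀ z w : ℂ, z = Complex.I ∨ z = -Complex.I → w = Complex.I ∨ w = -Complex.I →
        ContinuousLinearMap.adjoint (resolventAt H w) = resolventAt H z →
        ∀ x ∈ (Submodule.span ℂ s)ᗮ, resolventAt H w x ∈ (Submodule.span ℂ s)ᗮ := by
      intro z w hz hw hzw x hx
      rw [Submodule.mem_orthogonal]
      intro v hv
      induction hv using Submodule.span_induction with
      | mem v hv =>
        obtain ⟨l, hl⟩ := hse v hv
        have hlz : (l : ℂ) - z ≠ 0 := by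
          rcases hz with rfl | rfl
          · exact ofReal_sub_I_ne_zero l
          · exact ofReal_add_I_ne_zero l
        rw [← ContinuousLinearMap.adjoint_inner_left, hzw,
          (hH.isResolventAt hz).apply_eigenvec hlz hl, inner_smul_left,
          (Submodule.mem_orthogonal _ _).1 hx v (Submodule.subset_span hv), mul_zero]
      | zero => simp
      | add a b _ _ ha hb => rw [inner_add_left, ha, hb, add_zero]
      | smul c a _ ha => rw [inner_smul_left, ha, mul_zero]
    have had := hH.adjoint_resolventAt
    obtain ⟨u, huG, hu1, l, hl⟩ := exists_isEigenvec_mem hH hc (Submodule.span ℂ s)ᗮ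
      (hinv _ _ (Or.inr rfl) (Or.inl rfl) had)
      (hinv _ _ (Or.inl rfl) (Or.inr rfl) (by
        rw [← had, ContinuousLinearMap.adjoint_adjoint])) hne
    have hus : ∀ v ∈ s, ⟪v, u⟫_ℂ = 0 := fun v hv =>
      (Submodule.mem_orthogonal _ _).1 huG v (Submodule.subset_span hv)
    have hins : insert u s ∈ {s : Set 𝓗 | Orthonormal ℂ (fun x : s => (x : 𝓗)) ∧
        ∀ x ∈ s, ∃ l : ℝ, IsEigenvec H l x} := by
      constructor
      · refine ⟨fun x => ?_, fun x y hxy => ?_⟩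
        · rcases x.2 with hx | hx
          · simp only [hx, hu1]
          · exact hso.1 ⟨x, hx⟩
        · have hxy' : (x : 𝓗) ≠ y := fun h => hxy (Subtype.ext h)
          rcases x.2 with hx | hx <;> rcases y.2 with hy | hy
          · exact absurd (hx.trans hy.symm) hxy'
          · simp only
            rw [hx, ← inner_conj_symm, hus _ hy, map_zero]
          · simp only
            rw [hy, hus _ hx]
          · exact hso.2 (i := ⟨x, hx⟩) (j := ⟨y, hy⟩) fun h => hxy' (Subtype.mk.inj h)
      · rintro x (rfl | hx)
        · exact ⟨l, hl⟩
        · exact hse x hx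
    have hmem : u ∈ s := hs.le_of_ge hins (Set.subset_insert u s) (Set.mem_insert u s)
    have := hus u hmem
    rw [inner_self_eq_zero] at this
    rw [this, norm_zero] at hu1
    exact zero_ne_one hu1
  have hspan : (Submodule.span ℂ (Set.range fun x : s => (x : 𝓗)))ᗮ = ⊥ := by
    rwa [Subtype.range_coe]
  choose ev hev using fun x : s => hse x x.2
  refine ⟨⟨s, HilbertBasis.mkOfOrthogonalEqBot hso hspan, ev, fun i => ?_,
    finite_eigenvalues_le hH hc hso hev⟩⟩
  rw [HilbertBasis.coe_mkOfOrthogonalEqBot]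
  exact hev i

end

section

variable {𝓗 : Type*} [NormedAddCommGroup 𝓗] [InnerProductSpace ℂ 𝓗] [CompleteSpace 𝓗]

/-! ### Spectral measures -/

namespace ProjValuedMeasure

theorem inner_proj_proj (P : ProjValuedMeasure 𝓗) {S : Set ℝ} (hS : MeasurableSet S) (φ ψ : 𝓗) :
    ⟪P.proj S φ, ψ⟫_ℂ = ⟪φ, P.proj S ψ⟫_ℂ :=
  ContinuousLinearMap.isSelfAdjoint_iff_isSymmetric.mp (P.isStarProjection S hS).isSelfAdjoint φ ψ

theorem proj_proj (P : ProjValuedMeasure 𝓗) {S T : Set ℝ} (hS : MeasurableSet S)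
    (hT : MeasurableSet T) (ψ : 𝓗) : P.proj S (P.proj T ψ) = P.proj (S ∩ T) ψ := by
  rw [P.inter S T hS hT]; rfl

theorem re_inner_eq_norm_sq (P : ProjValuedMeasure 𝓗) {S : Set ℝ} (hS : MeasurableSet S) (ψ : 𝓗) :
    RCLike.re ⟪ψ, P.proj S ψ⟫_ℂ = ‖P.proj S ψ‖ ^ 2 := by
  rw [← inner_self_eq_norm_sq (𝕜 := ℂ), P.inner_proj_proj hS, P.proj_proj hS hS, Set.inter_self]

theorem scalarMeasure_apply (P : ProjValuedMeasure 𝓗) (ψ : 𝓗) {S : Set ℝ} (hS : MeasurableSet S) :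
    P.scalarMeasure ψ S = ENNReal.ofReal (RCLike.re ⟪ψ, P.proj S ψ⟫_ℂ) :=
  Measure.ofMeasurable_apply S hS

theorem scalarMeasure_apply' (P : ProjValuedMeasure 𝓗) (ψ : 𝓗) {S : Set ℝ}
    (hS : MeasurableSet S) : P.scalarMeasure ψ S = ENNReal.ofReal (‖P.proj S ψ‖ ^ 2) := by
  rw [P.scalarMeasure_apply ψ hS, P.re_inner_eq_norm_sq hS]

instance isFiniteMeasure_scalarMeasure (P : ProjValuedMeasure 𝓗) (ψ : 𝓗) :
    IsFiniteMeasure (P.scalarMeasure ψ) :=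
  ⟨by rw [P.scalarMeasure_apply' ψ MeasurableSet.univ]; exact ENNReal.ofReal_lt_top⟩

theorem scalarMeasure_proj (P : ProjValuedMeasure 𝓗) {S : Set ℝ} (hS : MeasurableSet S) (ψ : 𝓗) :
    P.scalarMeasure (P.proj S ψ) = (P.scalarMeasure ψ).restrict S := by
  ext A hA
  rw [Measure.restrict_apply hA, P.scalarMeasure_apply' _ hA, P.proj_proj hA hS,
    P.scalarMeasure_apply' _ (hA.inter hS)]

/-- `1 - 2 P(S)` is a unitary commuting with every `P(A)`. -/
theorem scalarMeasure_reflection (P : ProjValuedMeasure 𝓗) {S : Set ℝ} (hS : MeasurableSet S)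
    (ψ : 𝓗) : P.scalarMeasure (ψ - (2 : ℂ) • P.proj S ψ) = P.scalarMeasure ψ := by
  ext A hA
  rw [P.scalarMeasure_apply _ hA, P.scalarMeasure_apply _ hA]
  congr 2
  have h1 : ⟪P.proj S ψ, P.proj A ψ⟫_ℂ = ⟪ψ, P.proj (S ∩ A) ψ⟫_ℂ := by
    rw [P.inner_proj_proj hS, P.proj_proj hS hA]
  simp only [map_sub, map_smul, inner_sub_left, inner_sub_right, inner_smul_left, inner_smul_right,
    P.proj_proj hA hS, h1, P.inner_proj_proj hS, P.proj_proj hS (hA.inter hS)]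
  have h2 : S ∩ (A ∩ S) = S ∩ A := by
    ext x; simp only [Set.mem_inter_iff]; tauto
  rw [h2, Set.inter_comm A S]
  rw [show (starRingEnd ℂ) 2 = 2 from Complex.conj_ofNat 2]
  ring

theorem integrable_scalarMeasure {P : ProjValuedMeasure 𝓗} {H : 𝓗 →ₗ.[ℂ] 𝓗}
    (hP : P.IsSpectralMeasureOf H) {ψ : 𝓗} (hψ : ψ ∈ H.domain) :
    Integrable (fun x : ℝ => x) (P.scalarMeasure ψ) := by
  have h1 : Integrable (fun x : ℝ => x ^ 2) (P.scalarMeasure ψ) := by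
    refine ⟨by fun_prop, ?_⟩
    rw [hasFiniteIntegral_iff_ofReal (Eventually.of_forall fun x => sq_nonneg x)]
    exact (hP.1 ψ).1 hψ
  refine (h1.add (integrable_const 1)).mono' (by fun_prop) (Eventually.of_forall fun x => ?_)
  simp only [Pi.add_apply, Real.norm_eq_abs]
  nlinarith [sq_abs x, sq_nonneg (|x| - 1)]

/-- `IsSpectralMeasureOf` prescribes only the domain and the quadratic form, so commutation of `H`
with `P(S)` is not available. Instead the forms at `e` and at its reflection `e - 2 P(S) e` are
compared; they have the same scalar measure. For `ψ = P(S) e` this yields `⟪ψ, H ψ⟫ = l ⟪ψ, ψ⟫`,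
whose left side is the integral of `x` over `S`. -/
theorem setIntegral_scalarMeasure_eigenvec {P : ProjValuedMeasure 𝓗} {H : 𝓗 →ₗ.[ℂ] 𝓗}
    (hP : P.IsSpectralMeasureOf H) (hH : IsSelfAdjoint H) {l : ℝ} {e : 𝓗} (he : IsEigenvec H l e)
    {S : Set ℝ} (hS : MeasurableSet S) : ∫ x in S, (x - l) ∂(P.scalarMeasure e) = 0 := by
  obtain ⟨hd, he⟩ := he
  set ψ := P.proj S e with hψ
  have hψd : ψ ∈ H.domain := by
    rw [hP.1, hψ, P.scalarMeasure_proj hS]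
    exact (lintegral_mono' Measure.restrict_le_self le_rfl).trans_lt ((hP.1 e).1 hd)
  have hχd : e - (2 : ℂ) • ψ ∈ H.domain := H.domain.sub_mem hd (H.domain.smul_mem _ hψd)
  have h1 := hP.2 ⟨_, hχd⟩
  have h2 := hP.2 ⟨_, hd⟩
  have h3 := hP.2 ⟨_, hψd⟩
  have h0 : P.scalarMeasure (e - (2 : ℂ) • ψ) = P.scalarMeasure e :=
    P.scalarMeasure_reflection hS e
  simp only at h1 h2 h3
  rw [h0, ← h2] at h1
  have h4 : H ⟨e - (2 : ℂ) • ψ, hχd⟩ = H ⟨e, hd⟩ - (2 : ℂ) • H ⟨ψ, hψd⟩ := by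
    rw [← LinearPMap.map_smul, ← LinearPMap.map_sub]; rfl
  have h5 := hH.inner_apply_left ⟨e, hd⟩ ⟨ψ, hψd⟩
  simp only at h5
  have h6 : ⟪e, ψ⟫_ℂ = ⟪ψ, ψ⟫_ℂ := by
    rw [hψ, P.inner_proj_proj hS, P.proj_proj hS hS, Set.inter_self]
  have h7 : ⟪ψ, e⟫_ℂ = ⟪ψ, ψ⟫_ℂ := by
    rw [← inner_conj_symm, h6, inner_conj_symm]
  have h8 : ⟪ψ, H ⟨ψ, hψd⟩⟫_ℂ = l * ⟪ψ, ψ⟫_ℂ := by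
    rw [h4, he] at h1
    rw [he, inner_smul_left, Complex.conj_ofReal, h6] at h5
    simp only [inner_sub_left, inner_sub_right, inner_smul_left, inner_smul_right, ← h5, h7]
      at h1
    simp only [Complex.conj_ofNat] at h1
    -- Each of the two cross terms contributes `-2 l ⟪ψ, ψ⟫` and the square term `4 ⟪ψ, H ψ⟫`.
    linear_combination (1 / 4 : ℂ) * h1
  have h9 : ∫ x in S, x ∂(P.scalarMeasure e) = l * (P.scalarMeasure e).real S := by
    rw [← P.scalarMeasure_proj hS, ← hψ]
    have h10 : ⟪ψ, ψ⟫_ℂ = (((P.scalarMeasure e).real S : ℝ) : ℂ) := by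
      rw [measureReal_def, P.scalarMeasure_apply' _ hS, ← hψ, ENNReal.toReal_ofReal (sq_nonneg _),
        inner_self_eq_norm_sq_to_K]
      simp
    rw [h3, h10] at h8
    exact_mod_cast h8
  rw [integral_sub (integrable_scalarMeasure hP hd).integrableOn (integrable_const l), h9]
  simp [mul_comm]

/-- On the open half lines on either side of `l` the function `x - l` has constant sign and zero
integral, so the scalar measure of `e` is concentrated at `l`. This determines, on eigenvectors,
whichever measure `spectralMeasure` selects. -/
theorem proj_eigenvec {P : ProjValuedMeasure 𝓗} {H : 𝓗 →ₗ.[ℂ] 𝓗}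
    (hP : P.IsSpectralMeasureOf H) (hH : IsSelfAdjoint H) {l : ℝ} {e : 𝓗} (he : IsEigenvec H l e)
    {S : Set ℝ} (hS : MeasurableSet S) [Decidable (l ∈ S)] :
    P.proj S e = if l ∈ S then e else 0 := by
  have hint : Integrable (fun x : ℝ => x - l) (P.scalarMeasure e) :=
    (integrable_scalarMeasure hP he.1).sub (integrable_const l)
  have hgt : P.scalarMeasure e (Set.Ioi l) = 0 := by
    have h1 := setIntegral_scalarMeasure_eigenvec hP hH he (measurableSet_Ioi (a := l))
    rw [setIntegral_eq_zero_iff_of_nonneg_ae (ae_restrict_of_forall_mem measurableSet_Ioi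
      fun x hx => sub_nonneg.2 (le_of_lt hx)) hint.integrableOn] at h1
    rw [Filter.EventuallyEq, ae_restrict_iff' measurableSet_Ioi] at h1
    refine measure_mono_null (fun x hx => ?_) h1
    simp only [Set.mem_compl_iff, Set.mem_ofPred_eq]
    intro h2
    have h3 := h2 hx
    simp only [Pi.zero_apply, sub_eq_zero] at h3
    exact absurd h3 (ne_of_gt hx)
  have hlt : P.scalarMeasure e (Set.Iio l) = 0 := by
    have h1 := setIntegral_scalarMeasure_eigenvec hP hH he (measurableSet_Iio (a := l))
    have h0 : ∫ x in Set.Iio l, (l - x) ∂(P.scalarMeasure e) = 0 := by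
      rw [← neg_eq_zero, ← integral_neg, ← h1]
      congr 1
      ext x
      ring
    rw [setIntegral_eq_zero_iff_of_nonneg_ae (ae_restrict_of_forall_mem measurableSet_Iio
      fun x hx => sub_nonneg.2 (le_of_lt hx)) (by
        refine (hint.neg.congr (Eventually.of_forall fun x => ?_)).integrableOn
        simp)] at h0
    rw [Filter.EventuallyEq, ae_restrict_iff' measurableSet_Iio] at h0
    refine measure_mono_null (fun x hx => ?_) h0
    simp only [Set.mem_compl_iff, Set.mem_ofPred_eq]
    intro h2
    have h3 := h2 hx
    simp only [Pi.zero_apply, sub_eq_zero] at h3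
    exact absurd h3 (ne_of_gt hx)
  have hnull : ∀ T : Set ℝ, MeasurableSet T → l ∉ T → P.proj T e = 0 := by
    intro T hT hl
    have h1 : P.scalarMeasure e T = 0 := by
      refine measure_mono_null (t := Set.Ioi l ∪ Set.Iio l) (fun x hx => ?_)
        (measure_union_null hgt hlt)
      rcases lt_trichotomy x l with h | h | h
      · exact Or.inr h
      · exact absurd (h ▸ hx) hl
      · exact Or.inl h
    rw [P.scalarMeasure_apply' _ hT, ENNReal.ofReal_eq_zero] at h1
    exact norm_eq_zero.1 (pow_eq_zero_iff two_ne_zero |>.1 (le_antisymm h1 (sq_nonneg _)))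
  split_ifs with hl
  · have h1 := hnull Sᶜ hS.compl (by simpa using hl)
    have h2 := measure_add_measure_compl (μ := P.scalarMeasure e) hS
    rw [P.scalarMeasure_apply' _ hS.compl, h1, P.scalarMeasure_apply' _ hS,
      P.scalarMeasure_apply' _ MeasurableSet.univ, P.univ] at h2
    simp only [norm_zero, ne_eq, OfNat.ofNat_ne_zero, not_false_eq_true, zero_pow,
      ENNReal.ofReal_zero, add_zero, one_apply_eq_self] at h2
    rw [ENNReal.ofReal_eq_ofReal_iff (sq_nonneg _) (sq_nonneg _)] at h2
    have h3 : ‖e - P.proj S e‖ ^ 2 = 0 := by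
      rw [norm_sub_sq (𝕜 := ℂ), P.re_inner_eq_norm_sq hS, h2]
      ring
    exact (sub_eq_zero.1 (norm_eq_zero.1 (pow_eq_zero_iff two_ne_zero |>.1 h3))).symm
  · exact hnull S hS hl

end ProjValuedMeasure

/-! ### Existence of the spectral measure, from an eigenbasis -/

namespace EigenSystem

variable {H : 𝓗 →ₗ.[ℂ] 𝓗} (E : EigenSystem H)

open scoped Classical in
/-- The projection onto the closed span of the eigenvectors with eigenvalue in `S`. -/
def spectralProj (S : Set ℝ) : 𝓗 →L[ℂ] 𝓗 :=
  (Submodule.span ℂ (E.basis '' {i | E.ev i ∈ S})).topologicalClosure.starProjection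

open scoped Classical in
theorem spectralProj_apply_basis (S : Set ℝ) (i : E.ι) :
    E.spectralProj S (E.basis i) = if E.ev i ∈ S then E.basis i else 0 := by
  split_ifs with h
  · refine Submodule.starProjection_eq_self_iff.2 (Submodule.le_topologicalClosure _ ?_)
    exact Submodule.subset_span ⟨i, h, rfl⟩
  · rw [spectralProj, Submodule.starProjection_apply_eq_zero_iff, Submodule.orthogonal_closure,
      Submodule.mem_orthogonal]
    intro v hv
    induction hv using Submodule.span_induction with
    | mem v hv =>
      obtain ⟨k, hk, rfl⟩ := hv
      exact E.basis.orthonormal.2 fun hki => h (hki ▸ hk)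
    | zero => simp
    | add a b _ _ ha hb => rw [inner_add_left, ha, hb, add_zero]
    | smul c a _ ha => rw [inner_smul_left, ha, mul_zero]

theorem isStarProjection_spectralProj (S : Set ℝ) : IsStarProjection (E.spectralProj S) :=
  isStarProjection_starProjection

open scoped Classical in
theorem inner_spectralProj (S : Set ℝ) (i : E.ι) (ψ : 𝓗) :
    ⟪E.basis i, E.spectralProj S ψ⟫_ℂ = if E.ev i ∈ S then ⟪E.basis i, ψ⟫_ℂ else 0 := by
  have h := ContinuousLinearMap.isSelfAdjoint_iff_isSymmetric.mp
    (E.isStarProjection_spectralProj S).isSelfAdjoint (E.basis i) ψ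
  refine h.symm.trans ?_
  simp only [ContinuousLinearMap.coe_coe, E.spectralProj_apply_basis]
  split_ifs <;> simp

open scoped Classical in
theorem hasSum_spectralProj (S : Set ℝ) (ψ : 𝓗) :
    HasSum (fun i => if E.ev i ∈ S then ⟪E.basis i, ψ⟫_ℂ • E.basis i else 0)
      (E.spectralProj S ψ) := by
  have h := E.basis.hasSum_repr (E.spectralProj S ψ)
  simp only [E.basis.repr_apply_apply, E.inner_spectralProj, ite_smul, zero_smul] at h
  exact h

open scoped Classical in
/-- The projection-valued measure of an eigenbasis. -/
def projValuedMeasure : ProjValuedMeasure 𝓗 where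
  proj := E.spectralProj
  isStarProjection S _ := E.isStarProjection_spectralProj S
  empty := E.basis.clm_ext fun i => by simp [E.spectralProj_apply_basis]
  univ := E.basis.clm_ext fun i => by simp [E.spectralProj_apply_basis]
  inter S T _ _ := E.basis.clm_ext fun i => by
    rw [mul_apply_eq_comp]
    simp only [E.spectralProj_apply_basis, Set.mem_inter_iff]
    by_cases h1 : E.ev i ∈ S <;> by_cases h2 : E.ev i ∈ T <;>
      simp [h1, h2, E.spectralProj_apply_basis]
  iUnion S _ hd ψ := by
    -- The expansion over the union, reindexed by pairs `(m, i)` with `ev i ∈ S m`: by disjointness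
    -- each `i` occurs at most once. Summation over the fibres then gives countable additivity.
    have h0 : HasSum (fun p : ℕ × E.ι =>
        if E.ev p.2 ∈ S p.1 then ⟪E.basis p.2, ψ⟫_ℂ • E.basis p.2 else 0)
        (E.spectralProj (⋃ k, S k) ψ) := by
      have h1 := E.hasSum_spectralProj (⋃ k, S k) ψ
      have h2 : Function.support (fun i => if E.ev i ∈ ⋃ k, S k then
          ⟪E.basis i, ψ⟫_ℂ • E.basis i else 0) ⊆ {i | E.ev i ∈ ⋃ k, S k} := by
        intro i hi
        by_contra h
        exact hi (if_neg h)
      rw [← hasSum_subtype_iff_of_support_subset h2] at h1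
      choose k hk using fun i : {i | E.ev i ∈ ⋃ k, S k} => Set.mem_iUnion.1 i.2
      have hinj : Function.Injective
          fun i : {i | E.ev i ∈ ⋃ k, S k} => ((k i, (i : E.ι)) : ℕ × E.ι) :=
        fun i j hij => Subtype.ext (congrArg Prod.snd hij)
      rw [← hinj.hasSum_iff]
      · convert h1 using 1
        ext i
        simp only [Function.comp]
        rw [if_pos (hk i), if_pos (show E.ev i ∈ ⋃ k, S k from i.2)]
      · rintro ⟨m, i⟩ hmi
        simp only
        split_ifs with him
        · exfalso
          have hi : E.ev i ∈ ⋃ k, S k := Set.mem_iUnion.2 ⟨m, him⟩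
          have hkm : k ⟨i, hi⟩ = m := by
            by_contra hne
            exact Set.disjoint_left.1 (hd hne) (hk ⟨i, hi⟩) him
          exact hmi ⟨⟨i, hi⟩, by simp [hkm]⟩
        · rfl
    exact h0.prod_fiberwise fun m => E.hasSum_spectralProj (S m) ψ

theorem scalarMeasure_eq (ψ : 𝓗) : E.projValuedMeasure.scalarMeasure ψ =
    Measure.sum fun i => ENNReal.ofReal (‖⟪E.basis i, ψ⟫_ℂ‖ ^ 2) • Measure.dirac (E.ev i) := by
  classical
  ext S hS
  rw [E.projValuedMeasure.scalarMeasure_apply ψ hS, Measure.sum_apply _ hS]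
  have h1 := (E.basis.hasSum_inner_mul_inner ψ (E.spectralProj S ψ)).mapL (RCLike.reCLM (K := ℂ))
  have h2 : ∀ i, RCLike.reCLM (K := ℂ) (⟪ψ, E.basis i⟫_ℂ * ⟪E.basis i, E.spectralProj S ψ⟫_ℂ) =
      if E.ev i ∈ S then ‖⟪E.basis i, ψ⟫_ℂ‖ ^ 2 else 0 := by
    intro i
    rw [E.inner_spectralProj]
    split_ifs
    · rw [← inner_conj_symm ψ, Complex.conj_mul']
      simp [← Complex.ofReal_pow]
    · simp
  simp only [h2] at h1
  have h3 : RCLike.re ⟪ψ, E.projValuedMeasure.proj S ψ⟫_ℂ =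
      ∑' i, if E.ev i ∈ S then ‖⟪E.basis i, ψ⟫_ℂ‖ ^ 2 else 0 := h1.tsum_eq.symm
  rw [h3, ENNReal.ofReal_tsum_of_nonneg (fun i => by split_ifs <;> positivity) h1.summable]
  congr 1
  ext i
  rw [Measure.smul_apply, Measure.dirac_apply' _ hS]
  by_cases h : E.ev i ∈ S <;> simp [h]

theorem inner_basis_apply (hH : IsSelfAdjoint H) (ψ : H.domain) (i : E.ι) :
    ⟪E.basis i, H ψ⟫_ℂ = E.ev i * ⟪E.basis i, (ψ : 𝓗)⟫_ℂ := by
  obtain ⟨hd, he⟩ := E.isEigenvec i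
  have h := hH.inner_apply_left ⟨_, hd⟩ ψ
  rw [he, inner_smul_left, Complex.conj_ofReal] at h
  exact h.symm

/-- Such a `ψ` is `R φ`, where `φ` has the square summable coordinates `(ev i - i) ⟪b i, ψ⟫`. -/
theorem mem_domain (hH : IsSelfAdjoint H) {ψ : 𝓗}
    (h : Summable fun i => E.ev i ^ 2 * ‖⟪E.basis i, ψ⟫_ℂ‖ ^ 2) : ψ ∈ H.domain := by
  have h1 := E.basis.orthonormal.inner_products_summable ψ
  have hnorm : ∀ i, ‖((E.ev i : ℂ) - Complex.I) * ⟪E.basis i, ψ⟫_ℂ‖ ^ 2 =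
      E.ev i ^ 2 * ‖⟪E.basis i, ψ⟫_ℂ‖ ^ 2 + ‖⟪E.basis i, ψ⟫_ℂ‖ ^ 2 := by
    intro i
    rw [norm_mul, mul_pow, ← Complex.normSq_eq_norm_sq, Complex.normSq_apply]
    simp
    ring
  have hmem : Memℓp (fun i => ((E.ev i : ℂ) - Complex.I) * ⟪E.basis i, ψ⟫_ℂ) 2 := by
    refine memℓp_gen ?_
    simp only [ENNReal.toReal_ofNat, Real.rpow_ofNat, hnorm]
    exact h.add h1
  set φ := E.basis.repr.symm ⟨_, hmem⟩ with hφ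
  have hφi : ∀ i, ⟪E.basis i, φ⟫_ℂ = ((E.ev i : ℂ) - Complex.I) * ⟪E.basis i, ψ⟫_ℂ := by
    intro i
    rw [← E.basis.repr_apply_apply, hφ, LinearIsometryEquiv.apply_symm_apply]
  have hR : resolventAt H Complex.I φ = ψ := by
    refine E.basis.eq_of_inner fun i => ?_
    rw [← ContinuousLinearMap.adjoint_inner_left, hH.adjoint_resolventAt,
      (hH.isResolventAt (Or.inr rfl)).apply_eigenvec (ofReal_add_I_ne_zero _) (E.isEigenvec i),
      inner_smul_left, hφi, ← mul_assoc]
    have : (starRingEnd ℂ) (((E.ev i : ℂ) - -Complex.I)⁻¹) = ((E.ev i : ℂ) - Complex.I)⁻¹ := by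
      simp [sub_eq_add_neg]
    rw [this, inv_mul_cancel₀ (ofReal_sub_I_ne_zero _), one_mul]
  obtain ⟨hd, -⟩ := (hH.isResolventAt (Or.inl rfl)).1 φ
  rwa [hR] at hd

/-- The scalar measure of `ψ` is a sum of point masses `|⟪b i, ψ⟫|²` at the eigenvalues, so the
conditions reduce to Parseval expansions for `H ψ`, together with `mem_domain`. -/
theorem isSpectralMeasureOf (hH : IsSelfAdjoint H) :
    E.projValuedMeasure.IsSpectralMeasureOf H := by
  have hl : ∀ ψ, ∫⁻ x, ENNReal.ofReal (x ^ 2) ∂(E.projValuedMeasure.scalarMeasure ψ) =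
      ∑' i, ENNReal.ofReal (E.ev i ^ 2 * ‖⟪E.basis i, ψ⟫_ℂ‖ ^ 2) := by
    intro ψ
    rw [E.scalarMeasure_eq, lintegral_sum_measure]
    congr 1
    ext i
    rw [lintegral_smul_measure, lintegral_dirac, smul_eq_mul, mul_comm,
      ENNReal.ofReal_mul (sq_nonneg _)]
  have hdom : ∀ ψ : 𝓗, ψ ∈ H.domain ↔
      ∫⁻ x, ENNReal.ofReal (x ^ 2) ∂(E.projValuedMeasure.scalarMeasure ψ) < ∞ := by
    intro ψ
    rw [hl]
    constructor
    · intro hψ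
      have h1 := E.basis.orthonormal.inner_products_summable (H ⟨ψ, hψ⟩)
      simp only [E.inner_basis_apply hH ⟨ψ, hψ⟩, norm_mul, mul_pow, Complex.norm_real,
        Real.norm_eq_abs, sq_abs] at h1
      exact h1.tsum_ofReal_lt_top
    · intro h
      refine E.mem_domain hH ?_
      have h2 := ENNReal.summable_toReal h.ne
      refine h2.congr fun i => ?_
      rw [ENNReal.toReal_ofReal (by positivity)]
  refine ⟨hdom, fun ψ => ?_⟩
  have h1 : Integrable (fun x : ℝ => x) (E.projValuedMeasure.scalarMeasure (ψ : 𝓗)) := by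
    have h1 : Integrable (fun x : ℝ => x ^ 2) (E.projValuedMeasure.scalarMeasure (ψ : 𝓗)) := by
      refine ⟨by fun_prop, ?_⟩
      rw [hasFiniteIntegral_iff_ofReal (Eventually.of_forall fun x => sq_nonneg x)]
      exact (hdom ψ).1 ψ.2
    refine (h1.add (integrable_const 1)).mono' (by fun_prop) (Eventually.of_forall fun x => ?_)
    simp only [Pi.add_apply, Real.norm_eq_abs]
    nlinarith [sq_abs x, sq_nonneg (|x| - 1)]
  rw [E.scalarMeasure_eq] at h1 ⊢
  have h2 := (hasSum_integral_measure h1).mapL Complex.ofRealCLM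
  refine (E.basis.hasSum_inner_mul_inner ψ (H ψ)).unique ?_
  refine Eq.mp (congrArg (HasSum · _) (funext fun i => ?_)) h2
  rw [Complex.ofRealCLM_apply]
  rw [integral_smul_measure, integral_dirac, E.inner_basis_apply hH, ← inner_conj_symm (ψ : 𝓗),
    ENNReal.toReal_ofReal (sq_nonneg _)]
  rw [mul_left_comm, Complex.conj_mul']
  simp [mul_comm]

open scoped Classical in
theorem spectralMeasure_apply_basis (hH : IsSelfAdjoint H) {S : Set ℝ} (hS : MeasurableSet S)
    (i : E.ι) : spectralMeasure H S (E.basis i) = if E.ev i ∈ S then E.basis i else 0 := by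
  have h : ∃ P : ProjValuedMeasure 𝓗, P.IsSpectralMeasureOf H :=
    ⟨_, E.isSpectralMeasureOf hH⟩
  rw [spectralMeasure, dif_pos h]
  exact ProjValuedMeasure.proj_eigenvec h.choose_spec hH (E.isEigenvec i) hS

theorem resolventAt_apply_basis (hH : IsSelfAdjoint H) (i : E.ι) :
    resolventAt H Complex.I (E.basis i) = ((E.ev i : ℂ) - Complex.I)⁻¹ • E.basis i :=
  (hH.isResolventAt (Or.inl rfl)).apply_eigenvec (ofReal_sub_I_ne_zero _) (E.isEigenvec i)

end EigenSystem

end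

section

variable {𝓗 : Type*} [NormedAddCommGroup 𝓗] [InnerProductSpace ℂ 𝓗]

/-! ### Compactness of Schatten class operators -/

theorem isCompactOperator_rankOne (x y : 𝓗) :
    IsCompactOperator (InnerProductSpace.rankOne ℂ x y) := by
  rw [InnerProductSpace.rankOne_def']
  have h : IsCompactOperator (innerSL ℂ y : 𝓗 →L[ℂ] ℂ) :=
    isCompactOperator_of_locallyCompactSpace_dom _
  exact h.clm_comp (ContinuousLinearMap.toSpanSingleton ℂ x)

variable [CompleteSpace 𝓗]

/-- Hilbert–Schmidt operators are compact. -/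
theorem isCompactOperator_of_summable_norm_sq {ι : Type*} (b : HilbertBasis ι ℂ 𝓗)
    {B : 𝓗 →L[ℂ] 𝓗} (hB : IsSelfAdjoint B) (h : Summable fun k => ‖B (b k)‖ ^ 2) :
    IsCompactOperator B := by
  classical
  let Q : Finset ι → 𝓗 →L[ℂ] 𝓗 := fun F => ∑ k ∈ F, InnerProductSpace.rankOne ℂ (b k) (b k)
  have hQ : ∀ F k y, ⟪b k, Q F y⟫_ℂ = if k ∈ F then ⟪b k, y⟫_ℂ else 0 := by
    intro F k y
    simp only [Q, sum_apply, InnerProductSpace.rankOne_apply, inner_sum,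
      inner_smul_right, orthonormal_iff_ite.1 b.orthonormal, mul_ite, mul_one, mul_zero]
    rw [Finset.sum_ite_eq]
  have hBs : ∀ x y : 𝓗, ⟪B x, y⟫_ℂ = ⟪x, B y⟫_ℂ :=
    ContinuousLinearMap.isSelfAdjoint_iff_isSymmetric.mp hB
  set f : ι → ℝ := fun k => ‖B (b k)‖ ^ 2 with hf
  -- Off `F`, the `k`-th coordinate of `B y` is `⟪B (b k), y⟫`, so Parseval bounds the error by the
  -- tail of the Hilbert–Schmidt sum.
  have hle : ∀ F : Finset ι, ‖B - Q F * B‖ ≤ √(∑' k, f k - ∑ k ∈ F, f k) := by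
    intro F
    refine ContinuousLinearMap.opNorm_le_bound _ (Real.sqrt_nonneg _) fun y => ?_
    refine le_of_sq_le_sq ?_ (by positivity)
    have hnn : 0 ≤ ∑' k, f k - ∑ k ∈ F, f k :=
      sub_nonneg.2 (h.sum_le_tsum F fun k _ => sq_nonneg _)
    rw [mul_pow, Real.sq_sqrt hnn]
    set z := (B - Q F * B) y with hz
    have hzk : ∀ k, ⟪b k, z⟫_ℂ = if k ∈ F then 0 else ⟪b k, B y⟫_ℂ := by
      intro k
      have : z = B y - Q F (B y) := rfl
      rw [this, inner_sub_right, hQ]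
      split_ifs <;> simp
    have h1 : HasSum (fun k => ‖⟪b k, z⟫_ℂ‖ ^ 2) (‖z‖ ^ 2) := by
      have h2 := (b.hasSum_inner_mul_inner z z).mapL (RCLike.reCLM (K := ℂ))
      refine Eq.mp (congrArg₂ HasSum (funext fun i => ?_) ?_) h2
      · rw [← inner_conj_symm z, Complex.conj_mul']
        simp [← Complex.ofReal_pow]
      · rw [RCLike.reCLM_apply, inner_self_eq_norm_sq]
    have h3 : HasSum (fun k => f k * ‖y‖ ^ 2) ((∑' k, f k) * ‖y‖ ^ 2) := h.hasSum.mul_right _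
    have h4 : HasSum (fun k => if k ∈ F then f k * ‖y‖ ^ 2 else 0)
        (∑ k ∈ F, f k * ‖y‖ ^ 2) := by
      have : HasSum (fun k => if k ∈ F then f k * ‖y‖ ^ 2 else 0)
          (∑ k ∈ F, if k ∈ F then f k * ‖y‖ ^ 2 else 0) :=
        hasSum_sum_of_ne_finset_zero fun k hk => if_neg hk
      rwa [Finset.sum_congr rfl fun k hk => if_pos hk] at this
    have hpt : ∀ k, ‖⟪b k, z⟫_ℂ‖ ^ 2 + (if k ∈ F then f k * ‖y‖ ^ 2 else 0) ≤
        f k * ‖y‖ ^ 2 := by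
      intro k
      rw [hzk]
      split_ifs with hk
      · simp
      · rw [add_zero, ← hBs]
        have h6 := norm_inner_le_norm (𝕜 := ℂ) (B (b k)) y
        rw [hf, ← mul_pow]
        exact pow_le_pow_left₀ (norm_nonneg _) h6 2
    have h5 := hasSum_le hpt (h1.add h4) h3
    rw [sub_mul, Finset.sum_mul]
    linarith
  have hlim : Tendsto (fun F => Q F * B) atTop (𝓝 B) := by
    rw [tendsto_iff_norm_sub_tendsto_zero]
    refine squeeze_zero (fun _ => norm_nonneg _) (fun F => ?_)
      (g := fun F => √(∑' k, f k - ∑ k ∈ F, f k)) ?_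
    · rw [norm_sub_rev]; exact hle F
    · have h7 : Tendsto (fun F => ∑' k, f k - ∑ k ∈ F, f k) atTop (𝓝 0) := by
        simpa using (tendsto_const_nhds (x := ∑' k, f k)).sub h.hasSum
      have h8 := (Real.continuous_sqrt.tendsto 0).comp h7
      rwa [Real.sqrt_zero] at h8
  refine isCompactOperator_of_tendsto hlim (Eventually.of_forall fun F => ?_)
  exact (isCompactOperator_finset_sum F _ fun k _ => isCompactOperator_rankOne _ _).comp_clm B

/-- `⟪b, T b⟫ = ‖T^{1/2} b‖²`, so the square root of `T` is Hilbert–Schmidt. -/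
theorem isCompactOperator_of_posTrace {T : 𝓗 →L[ℂ] 𝓗} (hT : 0 ≤ T) (h : posTrace T < ∞) :
    IsCompactOperator T := by
  set b := (exists_hilbertBasis ℂ 𝓗).choose_spec.choose with hb
  set B := CFC.sqrt T with hBdef
  have hB : IsSelfAdjoint B := (CFC.sqrt_nonneg T).isSelfAdjoint
  have hBB : B * B = T := CFC.sqrt_mul_sqrt_self T hT
  have hBs : ∀ x y : 𝓗, ⟪B x, y⟫_ℂ = ⟪x, B y⟫_ℂ :=
    ContinuousLinearMap.isSelfAdjoint_iff_isSymmetric.mp hB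
  have h1 : ∀ x, RCLike.re ⟪x, T x⟫_ℂ = ‖B x‖ ^ 2 := by
    intro x
    rw [← hBB, mul_apply_eq_comp, ← hBs, inner_self_eq_norm_sq]
  have h2 : Summable fun k => ‖B (b k)‖ ^ 2 := by
    have h3 : posTrace T = ∑' i, ENNReal.ofReal (RCLike.re ⟪b i, T (b i)⟫_ℂ) := rfl
    rw [h3] at h
    refine (ENNReal.summable_toReal h.ne).congr fun k => ?_
    rw [h1, ENNReal.toReal_ofReal (sq_nonneg _)]
  rw [← hBB]
  exact (isCompactOperator_of_summable_norm_sq b hB h2).comp_clm B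

/-- By `‖T w‖² ≤ ‖T* T w‖ ‖w‖`, applied to differences `w` of points of the unit ball, a finite `ε²
/ 4`-net for the image under `T* T` yields a finite `ε`-net for the image under `T`. -/
theorem isCompactOperator_of_star_mul_self {T : 𝓗 →L[ℂ] 𝓗}
    (h : IsCompactOperator (star T * T : 𝓗 →L[ℂ] 𝓗)) : IsCompactOperator T := by
  have h1 := h.isCompact_closure_image_closedBall (f := (star T * T : 𝓗 →L[ℂ] 𝓗).toLinearMap) 1
  have h2 : TotallyBounded ((star T * T : 𝓗 →L[ℂ] 𝓗) '' Metric.closedBall 0 1) :=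
    h1.totallyBounded.subset subset_closure
  have h3 : TotallyBounded (T '' Metric.closedBall 0 1) := by
    rw [Metric.totallyBounded_iff]
    intro ε hε
    obtain ⟨t, hts, htf, htc⟩ := Metric.finite_approx_of_totallyBounded h2 (ε ^ 2 / 4)
      (by positivity)
    have hex : ∀ y ∈ t, ∃ x ∈ Metric.closedBall (0 : 𝓗) 1, (star T * T : 𝓗 →L[ℂ] 𝓗) x = y :=
      fun y hy => hts hy
    choose! g hg hg' using hex
    refine ⟨(T ∘ g) '' t, htf.image _, ?_⟩
    rintro _ ⟨x, hx, rfl⟩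
    obtain ⟨y, hy, hxy⟩ := Set.mem_iUnion₂.1 (htc ⟨x, hx, rfl⟩)
    refine Set.mem_iUnion₂.2 ⟨T (g y), ⟨y, hy, rfl⟩, ?_⟩
    rw [Metric.mem_ball, dist_eq_norm] at hxy ⊢
    rw [← hg' y hy, ← map_sub] at hxy
    rw [← map_sub]
    set w := x - g y with hw
    have hw2 : ‖w‖ ≤ 2 := by
      have h4 := hg y hy
      rw [mem_closedBall_zero_iff] at hx h4
      exact (norm_sub_le _ _).trans (by linarith)
    have h5 : ‖T w‖ ^ 2 ≤ ‖(star T * T : 𝓗 →L[ℂ] 𝓗) w‖ * ‖w‖ := by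
      rw [← inner_self_eq_norm_sq (𝕜 := ℂ), ← ContinuousLinearMap.adjoint_inner_left]
      exact (RCLike.re_le_norm _).trans (norm_inner_le_norm _ _)
    have h6 : ‖T w‖ ^ 2 < ε ^ 2 := by
      refine lt_of_le_of_lt (h5.trans (mul_le_mul_of_nonneg_left hw2 (norm_nonneg _))) ?_
      nlinarith
    exact lt_of_pow_lt_pow_left₀ 2 hε.le h6
  refine (isCompactOperator_iff_isCompact_closure_image_closedBall (T : 𝓗 →ₗ[ℂ] 𝓗)
    one_pos).2 ?_
  exact h3.closure.isCompact_of_isClosed isClosed_closure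

theorem schattenTrace_natCast (s : ℕ) (T : 𝓗 →L[ℂ] 𝓗) :
    schattenTrace s T = posTrace (CFC.abs T ^ s) := by
  rw [schattenTrace, CFC.rpow_natCast _ _ (CFC.abs_nonneg T)]

/-- `|T|^s` has finite trace and is compact. Compactness descends from the square of a self-adjoint
operator to the operator, so the exponent is first raised to `2 ^ s` and then halved `s` times;
finally `T* T = |T|²`. -/
theorem MemSchatten.isCompactOperator {s : ℕ} {T : 𝓗 →L[ℂ] 𝓗} (h : MemSchatten s T) :
    IsCompactOperator T := by
  rw [MemSchatten, schattenTrace_natCast] at h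
  set A := CFC.abs T with hA
  have hA0 : 0 ≤ A := CFC.abs_nonneg T
  have hAs : IsSelfAdjoint A := hA0.isSelfAdjoint
  have h1 : IsCompactOperator (A ^ s : 𝓗 →L[ℂ] 𝓗) :=
    isCompactOperator_of_posTrace ((by
      rw [← CFC.rpow_natCast A s hA0]; exact CFC.rpow_nonneg)) h
  have h2 : IsCompactOperator (A ^ (2 ^ s) : 𝓗 →L[ℂ] 𝓗) := by
    have h3 : s ≤ 2 ^ s := Nat.lt_two_pow_self.le
    rw [← Nat.sub_add_cancel h3, pow_add]
    exact h1.clm_comp (A ^ (2 ^ s - s))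
  have h4 : ∀ k : ℕ, IsCompactOperator (A ^ (2 ^ k) : 𝓗 →L[ℂ] 𝓗) → IsCompactOperator A := by
    intro k
    induction k with
    | zero => intro h; simpa using h
    | succ k ih =>
      intro h
      refine ih (isCompactOperator_of_star_mul_self ?_)
      rw [star_pow, hAs.star_eq, ← pow_add, ← two_mul, ← pow_succ']
      exact h
  refine isCompactOperator_of_star_mul_self ?_
  rw [← CFC.abs_mul_abs]
  exact (h4 s h2).comp_clm A

/-! ### The Schatten norm of a diagonal operator -/

/-- `v = |T| e - ‖r‖ e` satisfies `|T| v = -‖r‖ v`, and positivity of `|T|` forces `v = 0`. -/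
theorem abs_apply_of_eigenvec {T : 𝓗 →L[ℂ] 𝓗} {r : ℂ} (hr : r ≠ 0) {e : 𝓗}
    (h1 : T e = r • e) (h2 : star T e = (starRingEnd ℂ) r • e) :
    CFC.abs T e = (‖r‖ : ℂ) • e := by
  have hA0 : 0 ≤ CFC.abs T := CFC.abs_nonneg T
  have hpos := (ContinuousLinearMap.nonneg_iff_isPositive _).1 hA0
  have h3 : CFC.abs T (CFC.abs T e) = ((‖r‖ : ℂ) ^ 2) • e := by
    have := DFunLike.congr_fun (CFC.abs_mul_abs T) e
    rw [mul_apply_eq_comp, mul_apply_eq_comp, h1, map_smul, h2, smul_smul,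
      Complex.mul_conj'] at this
    exact this
  set v := CFC.abs T e - (‖r‖ : ℂ) • e with hv
  have h4 : CFC.abs T v = -(‖r‖ : ℂ) • v := by
    rw [hv, map_sub, map_smul, h3, smul_sub, smul_smul]
    module
  have h5 := hpos.re_inner_nonneg_left v
  rw [h4, inner_smul_left, inner_self_eq_norm_sq_to_K] at h5
  have h6 : RCLike.re ((starRingEnd ℂ) (-(‖r‖ : ℂ)) * ((‖v‖ : ℂ)) ^ 2) = -(‖r‖ * ‖v‖ ^ 2) := by
    rw [map_neg, Complex.conj_ofReal, ← Complex.ofReal_pow, neg_mul, ← Complex.ofReal_mul,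
      ← Complex.ofReal_neg]
    rfl
  have h7 : 0 ≤ -(‖r‖ * ‖v‖ ^ 2) := h6 ▸ h5
  have h8 : 0 < ‖r‖ := norm_pos_iff.2 hr
  have h9 : ‖v‖ ^ 2 = 0 := by
    have := sq_nonneg ‖v‖
    nlinarith
  exact sub_eq_zero.1 (norm_eq_zero.1 (pow_eq_zero_iff two_ne_zero |>.1 h9))

/-- The trace is defined by a fixed basis unrelated to `b`. Expanding in `b` and exchanging the sums
of nonnegative terms passes from one to the other. -/
theorem schattenTrace_of_eigenbasis {ι : Type*} (b : HilbertBasis ι ℂ 𝓗) {T : 𝓗 →L[ℂ] 𝓗}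
    {r : ι → ℂ} (hr : ∀ i, r i ≠ 0) (h1 : ∀ i, T (b i) = r i • b i)
    (h2 : ∀ i, star T (b i) = (starRingEnd ℂ) (r i) • b i) (s : ℕ) :
    schattenTrace s T = ∑' i, ENNReal.ofReal (‖r i‖ ^ s) := by
  rw [schattenTrace_natCast]
  set c := (exists_hilbertBasis ℂ 𝓗).choose_spec.choose with hc
  have h3 : posTrace (CFC.abs T ^ s) =
    ∑' k, ENNReal.ofReal (RCLike.re ⟪c k, (CFC.abs T ^ s) (c k)⟫_ℂ) := rfl
  have h4 : ∀ i, (CFC.abs T ^ s) (b i) = ((‖r i‖ ^ s : ℝ) : ℂ) • b i := by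
    intro i
    induction s with
    | zero => simp
    | succ s ih =>
      rw [pow_succ, mul_apply_eq_comp, abs_apply_of_eigenvec (hr i) (h1 i) (h2 i), map_smul,
        ih rfl, smul_smul, pow_succ]
      push_cast
      rw [mul_comm]
  have hsa : ∀ x y : 𝓗, ⟪(CFC.abs T ^ s) x, y⟫_ℂ = ⟪x, (CFC.abs T ^ s) y⟫_ℂ :=
    ContinuousLinearMap.isSelfAdjoint_iff_isSymmetric.mp
      ((CFC.abs_nonneg T).isSelfAdjoint.pow s)
  have h5 : ∀ k, ENNReal.ofReal (RCLike.re ⟪c k, (CFC.abs T ^ s) (c k)⟫_ℂ) =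
      ∑' i, ENNReal.ofReal (‖r i‖ ^ s) * ENNReal.ofReal (‖⟪c k, b i⟫_ℂ‖ ^ 2) := by
    intro k
    have h6 := (b.hasSum_inner_mul_inner (c k) ((CFC.abs T ^ s) (c k))).mapL
      (RCLike.reCLM (K := ℂ))
    have h7 : ∀ i, RCLike.reCLM (K := ℂ) (⟪c k, b i⟫_ℂ * ⟪b i, (CFC.abs T ^ s) (c k)⟫_ℂ) =
        ‖r i‖ ^ s * ‖⟪c k, b i⟫_ℂ‖ ^ 2 := by
      intro i
      rw [← hsa, h4, inner_smul_left, Complex.conj_ofReal, ← inner_conj_symm (b i), mul_left_comm,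
        Complex.mul_conj', ← Complex.ofReal_pow, ← Complex.ofReal_mul]
      rfl
    simp only [h7] at h6
    have h8 : RCLike.re ⟪c k, (CFC.abs T ^ s) (c k)⟫_ℂ = ∑' i, ‖r i‖ ^ s * ‖⟪c k, b i⟫_ℂ‖ ^ 2 :=
      h6.tsum_eq.symm
    rw [h8, ENNReal.ofReal_tsum_of_nonneg (fun i => by positivity) h6.summable]
    congr 1
    ext i
    rw [ENNReal.ofReal_mul (by positivity)]
  have h9 : ∀ i, ∑' k, ENNReal.ofReal (‖⟪c k, b i⟫_ℂ‖ ^ 2) = 1 := by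
    intro i
    have h6 := (c.hasSum_inner_mul_inner (b i) (b i)).mapL (RCLike.reCLM (K := ℂ))
    have h7 : ∀ k, RCLike.reCLM (K := ℂ) (⟪b i, c k⟫_ℂ * ⟪c k, b i⟫_ℂ) = ‖⟪c k, b i⟫_ℂ‖ ^ 2 := by
      intro k
      rw [← inner_conj_symm (b i), Complex.conj_mul', ← Complex.ofReal_pow]
      rfl
    simp only [h7] at h6
    rw [← ENNReal.ofReal_tsum_of_nonneg (fun k => by positivity) h6.summable, h6.tsum_eq,
      RCLike.reCLM_apply, inner_self_eq_norm_sq, b.orthonormal.1]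
    simp
  rw [h3, tsum_congr h5, ENNReal.tsum_comm]
  refine tsum_congr fun i => ?_
  rw [ENNReal.tsum_mul_left, h9, mul_one]

end

section

variable {𝓗 : Type*} [NormedAddCommGroup 𝓗] [InnerProductSpace ℂ 𝓗]

/-! ### Trace norm bounds by duality -/

/-- A functional on the bounded operators of norm at most one on the rank one operators. -/
def IsTraceDual (ℓ : (𝓗 →L[ℂ] 𝓗) →L[ℂ] ℂ) : Prop :=
  ∀ x y : 𝓗, ‖ℓ (InnerProductSpace.rankOne ℂ x y)‖ ≤ ‖x‖ * ‖y‖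

/-- The trace norm of `T` is at most `C`, expressed by duality. -/
def TraceBound (T : 𝓗 →L[ℂ] 𝓗) (C : ℝ) : Prop :=
  ∀ ℓ : (𝓗 →L[ℂ] 𝓗) →L[ℂ] ℂ, IsTraceDual ℓ → ‖ℓ T‖ ≤ C

variable [CompleteSpace 𝓗]

/-- On a rank one operator the sum is controlled by Cauchy–Schwarz and Bessel's inequality. -/
theorem exists_isTraceDual {ι : Type*} {b : ι → 𝓗} (hb : Orthonormal ℂ b) (F : Finset ι)
    (U : 𝓗 →L[ℂ] 𝓗) (hU : ‖U‖ ≤ 1) :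
    ∃ ℓ : (𝓗 →L[ℂ] 𝓗) →L[ℂ] ℂ, IsTraceDual ℓ ∧ ∀ X, ℓ X = ∑ k ∈ F, ⟪U (b k), X (b k)⟫_ℂ := by
  refine ⟨∑ k ∈ F, (innerSL ℂ (U (b k))) ∘L (ContinuousLinearMap.apply ℂ 𝓗 (b k)), ?_, ?_⟩
  swap
  · intro X
    simp
  intro x y
  have h1 : (∑ k ∈ F, (innerSL ℂ (U (b k))) ∘L (ContinuousLinearMap.apply ℂ 𝓗 (b k)))
      (InnerProductSpace.rankOne ℂ x y) =
      ∑ k ∈ F, ⟪y, b k⟫_ℂ * ⟪b k, ContinuousLinearMap.adjoint U x⟫_ℂ := by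
    simp [ContinuousLinearMap.adjoint_inner_right]
  rw [h1]
  refine (norm_sum_le _ _).trans ?_
  simp only [norm_mul]
  refine (Real.sum_mul_le_sqrt_mul_sqrt _ _ _).trans ?_
  have h2 : ∑ k ∈ F, ‖⟪y, b k⟫_ℂ‖ ^ 2 ≤ ‖y‖ ^ 2 := by
    simp only [norm_inner_symm y]
    exact hb.sum_inner_products_le y
  have h3 : ∑ k ∈ F, ‖⟪b k, ContinuousLinearMap.adjoint U x⟫_ℂ‖ ^ 2 ≤ ‖x‖ ^ 2 := by
    refine (hb.sum_inner_products_le _).trans (pow_le_pow_left₀ (norm_nonneg _) ?_ 2)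
    refine (ContinuousLinearMap.le_opNorm _ _).trans ?_
    rw [LinearIsometryEquiv.norm_map]
    exact mul_le_of_le_one_left (norm_nonneg _) hU
  rw [mul_comm ‖x‖]
  exact mul_le_mul (Real.sqrt_le_iff.2 ⟨norm_nonneg _, h2⟩)
    (Real.sqrt_le_iff.2 ⟨norm_nonneg _, h3⟩) (Real.sqrt_nonneg _) (norm_nonneg _)

theorem norm_abs_apply (T : 𝓗 →L[ℂ] 𝓗) (x : 𝓗) : ‖CFC.abs T x‖ = ‖T x‖ := by
  have hA : ∀ x y : 𝓗, ⟪CFC.abs T x, y⟫_ℂ = ⟪x, CFC.abs T y⟫_ℂ :=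
    ContinuousLinearMap.isSelfAdjoint_iff_isSymmetric.mp (CFC.abs_nonneg T).isSelfAdjoint
  have h1 : CFC.abs T (CFC.abs T x) = ContinuousLinearMap.adjoint T (T x) :=
    DFunLike.congr_fun (CFC.abs_mul_abs T) x
  have h2 : ‖CFC.abs T x‖ ^ 2 = ‖T x‖ ^ 2 := by
    rw [← inner_self_eq_norm_sq (𝕜 := ℂ), hA, h1, ContinuousLinearMap.adjoint_inner_right,
      inner_self_eq_norm_sq]
  exact (pow_left_inj₀ (norm_nonneg _) (norm_nonneg _) two_ne_zero).1 h2

/-- An approximate polar decomposition. -/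
theorem exists_approx_polar (T : 𝓗 →L[ℂ] 𝓗) {ε : ℝ} (hε : 0 < ε) :
    ∃ U : 𝓗 →L[ℂ] 𝓗, ‖U‖ ≤ 1 ∧ ∀ b : 𝓗, RCLike.re ⟪b, CFC.abs T b⟫_ℂ ≤
      RCLike.re ⟪U b, T b⟫_ℂ + ε * ‖b‖ ^ 2 := by
  set A := CFC.abs T with hAdef
  have hA0 : 0 ≤ A := CFC.abs_nonneg T
  have hpos := (ContinuousLinearMap.nonneg_iff_isPositive _).1 hA0
  have hA : ∀ x y : 𝓗, ⟪A x, y⟫_ℂ = ⟪x, A y⟫_ℂ :=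
    ContinuousLinearMap.isSelfAdjoint_iff_isSymmetric.mp hA0.isSelfAdjoint
  have hu : IsUnit (A + algebraMap ℝ (𝓗 →L[ℂ] 𝓗) ε) := by
    have h1 : -ε ∉ spectrum ℝ A := fun h => by
      have := spectrum_nonneg_of_nonneg hA0 h
      linarith
    rw [spectrum.notMem_iff, map_neg, ← IsUnit.neg_iff] at h1
    convert h1 using 1
    abel
  obtain ⟨u, hu⟩ := hu
  set G : 𝓗 →L[ℂ] 𝓗 := ↑u⁻¹ with hG
  have hGb : ∀ b, A (G b) + (ε : ℂ) • G b = b := by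
    intro b
    have h1 : (A + algebraMap ℝ (𝓗 →L[ℂ] 𝓗) ε) * G = 1 := by rw [← hu]; exact u.mul_inv
    have h2 := DFunLike.congr_fun h1 b
    simpa [mul_apply_eq_comp, Algebra.algebraMap_eq_smul_one] using h2
  have key : ∀ g : 𝓗, ‖A g‖ ^ 2 ≤ ‖A g + (ε : ℂ) • g‖ ^ 2 := by
    intro g
    rw [norm_add_sq (𝕜 := ℂ), inner_smul_right]
    have h1 := hpos.re_inner_nonneg_left g
    have h2 : RCLike.re ((ε : ℂ) * ⟪A g, g⟫_ℂ) = ε * RCLike.re ⟪A g, g⟫_ℂ :=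
      RCLike.re_ofReal_mul (K := ℂ) ε _
    rw [h2]
    have := mul_nonneg hε.le h1
    have := sq_nonneg ‖(ε : ℂ) • g‖
    linarith
  -- With `G = (|T| + ε)⁻¹`, the operator `T G` replaces the partial isometry of the polar
  -- decomposition; `‖T G b‖ = ‖|T| G b‖ ≤ ‖b‖`.
  refine ⟨T * G, ?_, fun b => ?_⟩
  · refine ContinuousLinearMap.opNorm_le_bound _ zero_le_one fun b => ?_
    rw [one_mul, mul_apply_eq_comp, ← norm_abs_apply]
    have := key (G b)
    rw [hGb] at this
    exact (pow_le_pow_iff_left₀ (norm_nonneg _) (norm_nonneg _) two_ne_zero).1 this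
  · have h1 : ⟪(T * G) b, T b⟫_ℂ = ⟪A (G b), A b⟫_ℂ := by
      have h1 : A (A b) = ContinuousLinearMap.adjoint T (T b) :=
        DFunLike.congr_fun (CFC.abs_mul_abs T) b
      rw [mul_apply_eq_comp, ← ContinuousLinearMap.adjoint_inner_right, ← h1, hA]
    have h2 : A (G b) = b - (ε : ℂ) • G b := eq_sub_of_add_eq (hGb b)
    have h3 : ⟪(T * G) b, T b⟫_ℂ = ⟪b, A b⟫_ℂ - ε * ⟪A (G b), b⟫_ℂ := by
      rw [h1, hA (G b) b]
      nth_rewrite 1 [h2]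
      rw [inner_sub_left, inner_smul_left, Complex.conj_ofReal]
    have h4 : RCLike.re ((ε : ℂ) * ⟪A (G b), b⟫_ℂ) = ε * RCLike.re ⟪A (G b), b⟫_ℂ :=
      RCLike.re_ofReal_mul (K := ℂ) ε _
    have h5 : RCLike.re ⟪A (G b), b⟫_ℂ ≤ ‖b‖ ^ 2 := by
      have h6 := key (G b)
      rw [hGb] at h6
      have h7 := (pow_le_pow_iff_left₀ (norm_nonneg _) (norm_nonneg _) two_ne_zero).1 h6
      refine (RCLike.re_le_norm _).trans ((norm_inner_le_norm _ _).trans ?_)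
      rw [sq]
      exact mul_le_mul_of_nonneg_right h7 (norm_nonneg _)
    have h8 := mul_le_mul_of_nonneg_left h5 hε.le
    rw [h3, map_sub, h4]
    linarith

/-- Each finite partial sum of `Tr |T|` is, up to an error that vanishes with `ε`, at most the real
part of `ℓ T`, for the functional `ℓ` built from an approximate polar factor. -/
theorem TraceBound.schattenTrace_le {T : 𝓗 →L[ℂ] 𝓗} {C : ℝ} (h : TraceBound T C) :
    schattenTrace 1 T ≤ ENNReal.ofReal C := by
  have h0 : schattenTrace 1 T = posTrace (CFC.abs T) := by
    have := schattenTrace_natCast 1 T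
    rwa [Nat.cast_one, pow_one] at this
  rw [h0]
  set b := (exists_hilbertBasis ℂ 𝓗).choose_spec.choose with hb
  have h1 : posTrace (CFC.abs T) = ∑' i, ENNReal.ofReal (RCLike.re ⟪b i, CFC.abs T (b i)⟫_ℂ) := rfl
  have hpos := (ContinuousLinearMap.nonneg_iff_isPositive _).1 (CFC.abs_nonneg T)
  rw [h1, ENNReal.tsum_eq_iSup_sum]
  refine iSup_le fun F => ?_
  rw [← ENNReal.ofReal_sum_of_nonneg fun i _ => hpos.re_inner_nonneg_right _]
  refine ENNReal.ofReal_le_ofReal ?_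
  have h2 : ∀ ε > 0, ∑ i ∈ F, RCLike.re ⟪b i, CFC.abs T (b i)⟫_ℂ ≤ C + ε * F.card := by
    intro ε hε
    obtain ⟨U, hU, hUb⟩ := exists_approx_polar T hε
    obtain ⟨ℓ, hℓ, hℓX⟩ := exists_isTraceDual b.orthonormal F U hU
    calc ∑ i ∈ F, RCLike.re ⟪b i, CFC.abs T (b i)⟫_ℂ
        ≤ ∑ i ∈ F, (RCLike.re ⟪U (b i), T (b i)⟫_ℂ + ε) := Finset.sum_le_sum fun i _ => by
          simpa [b.orthonormal.1] using hUb (b i)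
      _ = RCLike.re (ℓ T) + ε * F.card := by
          rw [Finset.sum_add_distrib, hℓX, map_sum, Finset.sum_const, nsmul_eq_mul, mul_comm ε]
      _ ≤ C + ε * F.card := by
          gcongr
          exact (RCLike.re_le_norm _).trans (h ℓ hℓ)
  have h3 : Tendsto (fun ε : ℝ => C + ε * F.card) (𝓝[>] 0) (𝓝 (C + 0 * F.card)) :=
    ((continuous_const.add (continuous_id.mul continuous_const)).tendsto 0).mono_left
      nhdsWithin_le_nhds
  rw [zero_mul, add_zero] at h3
  exact ge_of_tendsto h3 (eventually_mem_nhdsWithin.mono fun ε hε => h2 ε hε)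

end

section

/-! ### A layer cake inequality for multilinear sums -/

/-- Writing `d i` as the integral of the indicator of `[0, d i)` turns the weighted sum into an
integral over `t` of unweighted sums over the superlevel sets `E j = {i | t j < d i}`. The
hypothesis bounds these by `K` times the cardinality of the smallest `E j`, and integrating that
cardinality gives `∑ d i ^ s`. -/
theorem norm_sum_prod_mul_le {ι : Type*} {s : ℕ} (hs : 0 < s) (G : Finset ι)
    (c : (Fin s → ι) → ℂ) {K : ℝ} (hK : 0 ≤ K)
    (hc : ∀ E : Fin s → Finset ι, (∀ j, E j ⊆ G) → ∀ j,
      ‖∑ r ∈ Fintype.piFinset E, c r‖ ≤ K * (E j).card)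
    {d : ι → ℝ} (hd : ∀ i, 0 ≤ d i) :
    ‖∑ r ∈ Fintype.piFinset (fun _ : Fin s => G), (∏ j, (d (r j) : ℂ)) * c r‖ ≤
      K * ∑ i ∈ G, d i ^ s := by
  classical
  have : Nonempty (Fin s) := ⟨⟨0, hs⟩⟩
  let B : (Fin s → ι) → Set (Fin s → ℝ) := fun r => Set.univ.pi fun j => Set.Ico 0 (d (r j))
  have hBm : ∀ r, MeasurableSet (B r) := fun r =>
    MeasurableSet.univ_pi fun j => measurableSet_Ico
  have hBv : ∀ r, volume.real (B r) = ∏ j, d (r j) := by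
    intro r
    have := Real.volume_pi_Ico_toReal (a := fun _ : Fin s => (0 : ℝ)) (b := fun j => d (r j))
      (fun j => hd (r j))
    simpa [Measure.real] using this
  have hBf : ∀ r, volume (B r) ≠ ∞ := by
    intro r
    have := Real.volume_pi_Ico (a := fun _ : Fin s => (0 : ℝ)) (b := fun j => d (r j))
    rw [this]
    exact ENNReal.prod_ne_top fun j _ => ENNReal.ofReal_ne_top
  have hint : ∀ r, Integrable ((B r).indicator fun _ => c r) := fun r =>
    (integrable_indicator_iff (hBm r)).2 (integrableOn_const (hBf r))
  have hint' : ∀ i : ι, Integrable ((B fun _ => i).indicator fun _ => (1 : ℝ)) := fun i =>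
    (integrable_indicator_iff (hBm _)).2 (integrableOn_const (hBf _))
  have h1 : ∑ r ∈ Fintype.piFinset (fun _ : Fin s => G), (∏ j, (d (r j) : ℂ)) * c r =
      ∫ t, ∑ r ∈ Fintype.piFinset (fun _ : Fin s => G), (B r).indicator (fun _ => c r) t := by
    rw [integral_finsetSum _ fun r _ => hint r]
    refine Finset.sum_congr rfl fun r _ => ?_
    rw [integral_indicator_const _ (hBm r), hBv, Complex.real_smul, Complex.ofReal_prod]
  have h2 : K * ∑ i ∈ G, d i ^ s =
      ∫ t, K * ∑ i ∈ G, (B fun _ => i).indicator (fun _ => (1 : ℝ)) t := by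
    rw [integral_const_mul, integral_finsetSum _ fun i _ => hint' i]
    congr 1
    refine Finset.sum_congr rfl fun i _ => ?_
    rw [integral_indicator_const _ (hBm _), hBv]
    simp
  rw [h1, h2]
  refine norm_integral_le_of_norm_le ((integrable_finsetSum _ fun i _ => hint' i).const_mul K)
    (Eventually.of_forall fun t => ?_)
  let E : Fin s → Finset ι := fun j => G.filter fun i => t j ∈ Set.Ico 0 (d i)
  have hEG : ∀ j, E j ⊆ G := fun j => Finset.filter_subset _ _
  have h3 : ∑ r ∈ Fintype.piFinset (fun _ : Fin s => G), (B r).indicator (fun _ => c r) t =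
      ∑ r ∈ Fintype.piFinset E, c r := by
    simp only [Set.indicator_apply]
    rw [← Finset.sum_filter]
    congr 1
    ext r
    simp only [Finset.mem_filter, Fintype.mem_piFinset, E, B, Set.mem_univ_pi]
    exact forall_and.symm
  rw [h3]
  by_cases h0 : ∃ j, t j < 0
  · obtain ⟨j, hj⟩ := h0
    have h4 : E j = ∅ := Finset.filter_eq_empty_iff.2 fun i _ h => absurd h.1 (not_le.2 hj)
    refine (hc E hEG j).trans ?_
    rw [h4, Finset.card_empty, Nat.cast_zero, mul_zero]
    exact mul_nonneg hK (Finset.sum_nonneg fun i _ =>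
      Set.indicator_nonneg (fun _ _ => zero_le_one) _)
  · push Not at h0
    -- For the largest `t j`, membership in `E j` implies `t k < d i` for every `k`.
    obtain ⟨j, hj⟩ := Finite.exists_max t
    refine (hc E hEG j).trans (mul_le_mul_of_nonneg_left ?_ hK)
    simp only [Set.indicator_apply]
    rw [← Finset.sum_filter, Finset.sum_const, nsmul_eq_mul, mul_one, Nat.cast_le]
    refine Finset.card_le_card fun i hi => ?_
    simp only [Finset.mem_filter, E, B, Set.mem_univ_pi] at hi ⊢
    exact ⟨hi.1, fun k => ⟨h0 k, (hj k).trans_lt hi.2.2⟩⟩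

variable {𝓗 : Type*} [NormedAddCommGroup 𝓗] [InnerProductSpace ℂ 𝓗]

/-! ### Products of operators and diagonal operators -/

theorem prod_ofFn_sum {B ι : Type*} [Ring B] [Algebra ℂ B] {s : ℕ} (g : Fin s → ι → B)
    (E : Fin s → Finset ι) : (List.ofFn fun k => ∑ i ∈ E k, g k i).prod =
      ∑ q ∈ Fintype.piFinset E, (List.ofFn fun k => g k (q k)).prod :=
  (MultilinearMap.mkPiAlgebraFin ℂ s B).map_sum_finset g E

theorem prod_ofFn_smul {B : Type*} [Ring B] [Algebra ℂ B] {s : ℕ} (c : Fin s → ℂ) (m : Fin s → B) :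
    (List.ofFn fun k => c k • m k).prod = (∏ k, c k) • (List.ofFn m).prod :=
  (MultilinearMap.mkPiAlgebraFin ℂ s B).map_smul_univ c m

theorem norm_prod_ofFn_le {s : ℕ} (f : Fin s → 𝓗 →L[ℂ] 𝓗) :
    ‖(List.ofFn f).prod‖ ≤ ∏ j, ‖f j‖ := by
  induction s with
  | zero => simpa using! (ContinuousLinearMap.norm_id_le (𝕜 := ℂ) (E := 𝓗))
  | succ s ih =>
    rw [List.ofFn_succ, List.prod_cons, Fin.prod_univ_succ]
    exact (norm_mul_le _ _).trans (mul_le_mul_of_nonneg_left (ih _) (norm_nonneg _))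

theorem norm_prod_ofFn_le_of_le {s : ℕ} {f : Fin s → 𝓗 →L[ℂ] 𝓗} {c : Fin s → ℝ}
    (h : ∀ j, ‖f j‖ ≤ c j) : ‖(List.ofFn f).prod‖ ≤ ∏ j, c j :=
  (norm_prod_ofFn_le f).trans (Finset.prod_le_prod (fun _ _ => norm_nonneg _) fun j _ => h j)

theorem IsTraceDual.norm_apply_le {ℓ : (𝓗 →L[ℂ] 𝓗) →L[ℂ] ℂ} (hℓ : IsTraceDual ℓ)
    {T : 𝓗 →L[ℂ] 𝓗} (hT : ∃ x y, T = InnerProductSpace.rankOne ℂ x y) : ‖ℓ T‖ ≤ ‖T‖ := by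
  obtain ⟨x, y, rfl⟩ := hT
  rw [InnerProductSpace.norm_rankOne]
  exact hℓ x y

/-- The projection onto the line spanned by the unit vector `e`. -/
abbrev lineProj (e : 𝓗) : 𝓗 →L[ℂ] 𝓗 := InnerProductSpace.rankOne ℂ e e

theorem _root_.HilbertBasis.lineProj_apply {ι : Type*} [DecidableEq ι] (b : HilbertBasis ι ℂ 𝓗)
    (i k : ι) : lineProj (b i) (b k) = if k = i then b i else 0 := by
  rw [InnerProductSpace.rankOne_apply, orthonormal_iff_ite.1 b.orthonormal]
  simp only [ite_smul, one_smul, zero_smul, eq_comm]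

theorem _root_.HilbertBasis.sum_lineProj_apply {ι : Type*} [DecidableEq ι]
    (b : HilbertBasis ι ℂ 𝓗) (F : Finset ι) (c : ι → ℂ) (k : ι) :
    (∑ i ∈ F, c i • lineProj (b i)) (b k) = (if k ∈ F then c k else 0) • b k := by
  simp only [sum_apply, smul_apply, b.lineProj_apply, smul_ite, smul_zero, ite_smul, zero_smul]
  rw [Finset.sum_ite_eq]

theorem _root_.HilbertBasis.norm_le_of_apply {ι : Type*} (b : HilbertBasis ι ℂ 𝓗)
    {T : 𝓗 →L[ℂ] 𝓗} {c : ι → ℂ} (hT : ∀ i, T (b i) = c i • b i) {M : ℝ} (hM : 0 ≤ M)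
    (hc : ∀ i, ‖c i‖ ≤ M) : ‖T‖ ≤ M := by
  classical
  refine ContinuousLinearMap.opNorm_le_bound _ hM fun x => ?_
  have hcoord : ∀ i, ⟪b i, T x⟫_ℂ = c i * ⟪b i, x⟫_ℂ := by
    intro i
    have h1 : innerSL ℂ (b i) ∘L T = c i • innerSL ℂ (b i) := by
      refine ContinuousLinearMap.ext_on (s := Set.range b) ?_ ?_
      · rw [Submodule.dense_iff_topologicalClosure_eq_top]
        exact b.dense_span
      · rintro _ ⟨k, rfl⟩
        simp only [ContinuousLinearMap.comp_apply, hT, innerSL_apply_apply, inner_smul_right,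
          smul_apply, orthonormal_iff_ite.1 b.orthonormal, smul_eq_mul]
        split_ifs with h
        · rw [h]
        · simp
    exact DFunLike.congr_fun h1 x
  have hpars : ∀ z : 𝓗, HasSum (fun k => ‖⟪b k, z⟫_ℂ‖ ^ 2) (‖z‖ ^ 2) := by
    intro z
    have h2 := (b.hasSum_inner_mul_inner z z).mapL (RCLike.reCLM (K := ℂ))
    refine Eq.mp (congrArg₂ HasSum (funext fun i => ?_) ?_) h2
    · rw [← inner_conj_symm z, Complex.conj_mul']
      simp [← Complex.ofReal_pow]
    · rw [RCLike.reCLM_apply, inner_self_eq_norm_sq]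
  refine (pow_le_pow_iff_left₀ (norm_nonneg _) (by positivity) two_ne_zero).1 ?_
  rw [mul_pow]
  refine hasSum_le (fun i => ?_) (hpars (T x)) ((hpars x).mul_left (M ^ 2))
  rw [hcoord, norm_mul, mul_pow]
  exact mul_le_mul_of_nonneg_right (pow_le_pow_left₀ (norm_nonneg _) (hc i) 2) (sq_nonneg _)

theorem _root_.HilbertBasis.norm_sum_lineProj_le {ι : Type*} (b : HilbertBasis ι ℂ 𝓗)
    (F : Finset ι) {c : ι → ℂ} {M : ℝ} (hM : 0 ≤ M) (hc : ∀ i ∈ F, ‖c i‖ ≤ M) :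
    ‖∑ i ∈ F, c i • lineProj (b i)‖ ≤ M := by
  classical
  refine b.norm_le_of_apply (b.sum_lineProj_apply F c) hM fun i => ?_
  split_ifs with h
  · exact hc i h
  · simpa using hM

end

section

variable {𝓗 : Type*} [NormedAddCommGroup 𝓗] [InnerProductSpace ℂ 𝓗]

/-! ### A Hölder inequality -/

theorem exists_rankOne_prod {𝓗 : Type*} [NormedAddCommGroup 𝓗] [InnerProductSpace ℂ 𝓗]
    [CompleteSpace 𝓗] (l : List (𝓗 →L[ℂ] 𝓗))
    (h : ∃ T ∈ l, ∃ x y, T = InnerProductSpace.rankOne ℂ x y) :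
    ∃ x y, l.prod = InnerProductSpace.rankOne ℂ x y := by
  induction l with
  | nil => simp at h
  | cons T l ih =>
    obtain ⟨S, hS, x, y, hxy⟩ := h
    rw [List.prod_cons]
    rcases List.mem_cons.1 hS with rfl | hS
    · exact ⟨x, ContinuousLinearMap.adjoint l.prod y, by
        rw [hxy]; exact InnerProductSpace.rankOne_comp x y _⟩
    · obtain ⟨x', y', h'⟩ := ih ⟨S, hS, x, y, hxy⟩
      exact ⟨T x', y', by rw [h']; exact InnerProductSpace.comp_rankOne x' y' _⟩

theorem tendsto_sum_lineProj {ι : Type*} (b : HilbertBasis ι ℂ 𝓗) {R : 𝓗 →L[ℂ] 𝓗} {r : ι → ℂ}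
    (hR : ∀ i, R (b i) = r i • b i) (hr : Tendsto r cofinite (𝓝 0)) :
    Tendsto (fun G : Finset ι => ∑ i ∈ G, r i • lineProj (b i)) atTop (𝓝 R) := by
  classical
  rw [Metric.tendsto_atTop]
  intro ε hε
  have h1 : {i | ¬ ‖r i‖ < ε / 2}.Finite := by
    have := Metric.tendsto_nhds.1 hr (ε / 2) (half_pos hε)
    simpa using this
  refine ⟨h1.toFinset, fun G hG => ?_⟩
  rw [dist_comm, dist_eq_norm]
  refine lt_of_le_of_lt (b.norm_le_of_apply (c := fun i => if i ∈ G then 0 else r i) ?_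
    (half_pos hε).le ?_) (half_lt_self hε)
  · intro i
    rw [sub_apply, b.sum_lineProj_apply, hR, ← sub_smul]
    congr 1
    split_ifs <;> simp
  · intro i
    split_ifs with h
    · simpa using (half_pos hε).le
    · by_contra h2
      exact h (hG (h1.mem_toFinset.2 fun h3 => h2 h3.le))

variable [CompleteSpace 𝓗]

/-- Only the `j`-th factor is expanded. Every resulting product has rank one, so `ℓ` is bounded on
it by the operator norm. The free choice of `j` is what the layer cake inequality requires. -/
theorem norm_apply_prod_sum_le {ι : Type*} [DecidableEq ι] (b : HilbertBasis ι ℂ 𝓗)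
    {ℓ : (𝓗 →L[ℂ] 𝓗) →L[ℂ] ℂ} (hℓ : IsTraceDual ℓ) {s : ℕ} (A : Fin s → 𝓗 →L[ℂ] 𝓗)
    {u : ι → ℂ} (hu : ∀ i, ‖u i‖ ≤ 1) (E : Fin s → Finset ι) (j : Fin s) :
    ‖ℓ (List.ofFn fun k => A k * ∑ i ∈ E k, u i • lineProj (b i)).prod‖ ≤
      (∏ k, ‖A k‖) * (E j).card := by
  set m : Fin s → 𝓗 →L[ℂ] 𝓗 := fun k => A k * ∑ i ∈ E k, u i • lineProj (b i) with hm
  have hmn : ∀ k, ‖m k‖ ≤ ‖A k‖ := fun k => (norm_mul_le _ _).trans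
    (mul_le_of_le_one_right (norm_nonneg _)
      (b.norm_sum_lineProj_le _ zero_le_one fun i _ => hu i))
  have h1 : (List.ofFn m).prod =
      ∑ i ∈ E j, (List.ofFn (Function.update m j (A j * u i • lineProj (b i)))).prod := by
    have h2 := (MultilinearMap.mkPiAlgebraFin ℂ s (𝓗 →L[ℂ] 𝓗)).map_update_sum (E j) j
      (fun i => A j * u i • lineProj (b i)) m
    rw [← Finset.mul_sum] at h2
    simp only [MultilinearMap.mkPiAlgebraFin_apply] at h2
    rw [← h2, Function.update_eq_self_iff.2 rfl]
  rw [h1, map_sum]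
  refine (norm_sum_le_of_le (E j) (f := fun i => ℓ _) (n := fun _ => ∏ k, ‖A k‖)
    fun i _ => ?_).trans (by rw [Finset.sum_const, nsmul_eq_mul, mul_comm])
  refine (hℓ.norm_apply_le (exists_rankOne_prod _ ?_)).trans (norm_prod_ofFn_le_of_le fun k => ?_)
  · refine ⟨A j * u i • lineProj (b i), ?_, A j (u i • b i), b i, ?_⟩
    · rw [List.mem_ofFn]
      exact ⟨j, Function.update_self _ _ _⟩
    · rw [lineProj, ← smul_apply, ← map_smul]
      exact InnerProductSpace.comp_rankOne _ _ _
  · rcases eq_or_ne k j with rfl | hk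
    · rw [Function.update_self]
      refine (norm_mul_le _ _).trans (mul_le_of_le_one_right (norm_nonneg _) ?_)
      rw [norm_smul, InnerProductSpace.norm_rankOne, b.orthonormal.1]
      simpa using hu i
    · rw [Function.update_of_ne hk]
      exact hmn k

theorem norm_apply_prod_le_of_finset {ι : Type*} (b : HilbertBasis ι ℂ 𝓗)
    {ℓ : (𝓗 →L[ℂ] 𝓗) →L[ℂ] ℂ} (hℓ : IsTraceDual ℓ) {s : ℕ} (hs : 0 < s)
    (A : Fin s → 𝓗 →L[ℂ] 𝓗) (r : ι → ℂ) (G : Finset ι) :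
    ‖ℓ (List.ofFn fun k => A k * ∑ i ∈ G, r i • lineProj (b i)).prod‖ ≤
      (∏ k, ‖A k‖) * ∑ i ∈ G, ‖r i‖ ^ s := by
  classical
  -- The phases of the eigenvalues (zero where `r i = 0`); the moduli are the heights in the layer
  -- cake inequality.
  set u : ι → ℂ := fun i => r i / ‖r i‖ with hu
  have hu1 : ∀ i, ‖u i‖ ≤ 1 := by
    intro i
    rw [hu, norm_div, Complex.norm_real, norm_norm]
    exact div_self_le_one _
  have hru : ∀ i, r i = (‖r i‖ : ℂ) * u i := by
    intro i
    rcases eq_or_ne (r i) 0 with h | h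
    · simp [h]
    · rw [hu, mul_div_cancel₀]
      exact_mod_cast norm_ne_zero_iff.2 h
  have hE : ∀ E : Fin s → Finset ι,
      (List.ofFn fun k => A k * ∑ i ∈ E k, u i • lineProj (b i)).prod =
      ∑ q ∈ Fintype.piFinset E, (List.ofFn fun k => A k * u (q k) • lineProj (b (q k))).prod := by
    intro E
    simp only [Finset.mul_sum]
    exact prod_ofFn_sum _ E
  have h1 : (List.ofFn fun k => A k * ∑ i ∈ G, r i • lineProj (b i)).prod =
      ∑ q ∈ Fintype.piFinset (fun _ : Fin s => G), (∏ k, (‖r (q k)‖ : ℂ)) •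
        (List.ofFn fun k => A k * u (q k) • lineProj (b (q k))).prod := by
    have h2 : ∀ i, r i • lineProj (b i) = (‖r i‖ : ℂ) • u i • lineProj (b i) := by
      intro i
      rw [smul_smul, ← hru]
    have h3 : (fun k => A k * ∑ i ∈ G, r i • lineProj (b i)) =
        fun k => ∑ i ∈ G, (‖r i‖ : ℂ) • (A k * u i • lineProj (b i)) := by
      funext k
      rw [Finset.mul_sum]
      exact Finset.sum_congr rfl fun i _ => by rw [h2, mul_smul_comm]
    rw [h3, prod_ofFn_sum]
    exact Finset.sum_congr rfl fun q _ => prod_ofFn_smul _ _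
  set c : (Fin s → ι) → ℂ := fun q =>
    ℓ (List.ofFn fun k => A k * u (q k) • lineProj (b (q k))).prod with hc
  have h5 : ℓ (List.ofFn fun k => A k * ∑ i ∈ G, r i • lineProj (b i)).prod =
      ∑ q ∈ Fintype.piFinset (fun _ : Fin s => G), (∏ k, (‖r (q k)‖ : ℂ)) * c q := by
    rw [h1, map_sum]
    exact Finset.sum_congr rfl fun q _ => map_smul _ _ _
  have h6 : ∀ E : Fin s → Finset ι, (∀ j, E j ⊆ G) → ∀ j,
      ‖∑ q ∈ Fintype.piFinset E, c q‖ ≤ (∏ k, ‖A k‖) * (E j).card := by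
    intro E _ j
    rw [hc, ← map_sum, ← hE]
    exact norm_apply_prod_sum_le b hℓ A hu1 E j
  rw [h5]
  exact norm_sum_prod_mul_le (d := fun i => ‖r i‖) hs G c
    (Finset.prod_nonneg fun _ _ => norm_nonneg _) h6 fun i => norm_nonneg (r i)

theorem tendsto_cofinite_of_summable_pow {ι : Type*} {r : ι → ℂ} {s : ℕ}
    (h : Summable fun i => ‖r i‖ ^ s) : Tendsto r cofinite (𝓝 0) := by
  rw [tendsto_zero_iff_norm_tendsto_zero]
  have h1 := h.tendsto_cofinite_zero
  refine Metric.tendsto_nhds.2 fun ε hε => ?_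
  filter_upwards [h1.eventually (gt_mem_nhds (pow_pos hε s))] with i hi
  rw [dist_zero_right, norm_norm]
  exact lt_of_pow_lt_pow_left₀ s hε.le hi

/-- Hölder's inequality for a product of `s` copies of an operator in the Schatten class `S^s`. -/
theorem norm_apply_prod_le {ι : Type*} (b : HilbertBasis ι ℂ 𝓗)
    {ℓ : (𝓗 →L[ℂ] 𝓗) →L[ℂ] ℂ} (hℓ : IsTraceDual ℓ) {s : ℕ} (hs : 0 < s)
    (A : Fin s → 𝓗 →L[ℂ] 𝓗) {R : 𝓗 →L[ℂ] 𝓗} {r : ι → ℂ}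
    (hR : ∀ i, R (b i) = r i • b i) (hr : Summable fun i => ‖r i‖ ^ s) :
    ‖ℓ (List.ofFn fun k => A k * R).prod‖ ≤ (∏ k, ‖A k‖) * ∑' i, ‖r i‖ ^ s := by
  have h1 : Tendsto (fun G : Finset ι =>
      ‖ℓ (List.ofFn fun k => A k * ∑ i ∈ G, r i • lineProj (b i)).prod‖) atTop
      (𝓝 ‖ℓ (List.ofFn fun k => A k * R).prod‖) := by
    have h2 : Continuous fun X : 𝓗 →L[ℂ] 𝓗 => ‖ℓ (List.ofFn fun k => A k * X).prod‖ := by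
      have h3 : Continuous fun X : 𝓗 →L[ℂ] 𝓗 => (List.ofFn fun k => A k * X).prod :=
        (ContinuousMultilinearMap.mkPiAlgebraFin ℂ s (𝓗 →L[ℂ] 𝓗)).cont.comp
          (continuous_pi fun k => continuous_const.mul continuous_id)
      exact (ℓ.continuous.comp h3).norm
    exact (h2.tendsto R).comp (tendsto_sum_lineProj b hR
      (tendsto_cofinite_of_summable_pow hr))
  refine le_of_tendsto h1 (Eventually.of_forall fun G => ?_)
  refine (norm_apply_prod_le_of_finset b hℓ hs A r G).trans ?_
  exact mul_le_mul_of_nonneg_left (hr.sum_le_tsum G fun i _ => by positivity)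
    (Finset.prod_nonneg fun _ _ => norm_nonneg _)

theorem TraceBound.prod_mul {ι : Type*} (b : HilbertBasis ι ℂ 𝓗) {s : ℕ} (hs : 0 < s)
    (A : Fin s → 𝓗 →L[ℂ] 𝓗) {R : 𝓗 →L[ℂ] 𝓗} {r : ι → ℂ}
    (hR : ∀ i, R (b i) = r i • b i) (hr : Summable fun i => ‖r i‖ ^ s) (A' : 𝓗 →L[ℂ] 𝓗) :
    TraceBound ((List.ofFn fun k => A k * R).prod * A')
      ((∏ k, ‖A k‖) * (∑' i, ‖r i‖ ^ s) * ‖A'‖) := by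
  intro ℓ hℓ
  rcases eq_or_ne A' 0 with rfl | hA'
  · simp
  have h0 : 0 < ‖A'‖ := norm_pos_iff.2 hA'
  -- Right multiplication by `A'` is absorbed into the functional, and division by `‖A'‖` restores
  -- the bound on rank one operators.
  set ℓ' : (𝓗 →L[ℂ] 𝓗) →L[ℂ] ℂ :=
    ((‖A'‖⁻¹ : ℝ) : ℂ) • ℓ ∘L (ContinuousLinearMap.mul ℂ (𝓗 →L[ℂ] 𝓗)).flip A' with hℓ'
  have h1 : ∀ X, ‖ℓ' X‖ = ‖A'‖⁻¹ * ‖ℓ (X * A')‖ := by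
    intro X
    simp [hℓ']
  have h2 : IsTraceDual ℓ' := by
    intro x y
    have h3 : (InnerProductSpace.rankOne ℂ x y : 𝓗 →L[ℂ] 𝓗) * A' =
        InnerProductSpace.rankOne ℂ x (ContinuousLinearMap.adjoint A' y) :=
      InnerProductSpace.rankOne_comp x y _
    rw [h1, h3, inv_mul_le_iff₀ h0]
    refine (hℓ _ _).trans ?_
    have h4 : ‖ContinuousLinearMap.adjoint A' y‖ ≤ ‖A'‖ * ‖y‖ := by
      refine (ContinuousLinearMap.le_opNorm _ _).trans ?_
      rw [LinearIsometryEquiv.norm_map]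
    calc ‖x‖ * ‖ContinuousLinearMap.adjoint A' y‖ ≤ ‖x‖ * (‖A'‖ * ‖y‖) := by gcongr
      _ = _ := by ring
  have h5 := norm_apply_prod_le b h2 hs A hR hr
  rw [h1, inv_mul_le_iff₀ h0] at h5
  rwa [mul_comm] at h5

end

section

/-! ### Interlaced products -/

/-- The product `D₀ V₁ D₁ V₂ D₂ ⋯ Vₙ Dₙ`. -/
def interlace {B : Type*} [Ring B] {n : ℕ} (V : Fin n → B) (D : Fin (n + 1) → B) : B :=
  D 0 * (List.ofFn fun j : Fin n => V j * D j.succ).prod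

section Interlace

variable {B : Type*} [Ring B] {n : ℕ}

theorem interlace_eq (V : Fin n → B) (D : Fin (n + 1) → B) :
    interlace V D = (List.ofFn fun j => (Fin.cons 1 V : Fin (n + 1) → B) j * D j).prod := by
  simp [interlace, List.ofFn_succ]

theorem interlace_succ (V : Fin (n + 1) → B) (D : Fin (n + 2) → B) :
    interlace V D = D 0 * (V 0 * interlace (fun j => V j.succ) fun j => D j.succ) := by
  simp [interlace, List.ofFn_succ, mul_assoc]

variable [Algebra ℂ B]

theorem interlace_sum {ι : Fin (n + 1) → Type*} (V : Fin n → B) (g : ∀ j, ι j → B)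
    (E : ∀ j, Finset (ι j)) : interlace V (fun j => ∑ i ∈ E j, g j i) =
      ∑ r ∈ Fintype.piFinset E, interlace V fun j => g j (r j) := by
  simp only [interlace_eq, Finset.mul_sum]
  exact (MultilinearMap.mkPiAlgebraFin ℂ (n + 1) B).map_sum_finset
    (fun j i => (Fin.cons 1 V : Fin (n + 1) → B) j * g j i) E

theorem interlace_smul (V : Fin n → B) (c : Fin (n + 1) → ℂ) (D : Fin (n + 1) → B) :
    interlace V (fun j => c j • D j) = (∏ j, c j) • interlace V D := by
  simp only [interlace_eq, mul_smul_comm]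
  exact prod_ofFn_smul _ _

end Interlace

variable {𝓗 : Type*} [NormedAddCommGroup 𝓗] [InnerProductSpace ℂ 𝓗] {n : ℕ}

theorem norm_interlace_le {V : Fin n → 𝓗 →L[ℂ] 𝓗} {D : Fin (n + 1) → 𝓗 →L[ℂ] 𝓗}
    {M : Fin (n + 1) → ℝ} (h : ∀ j, ‖D j‖ ≤ M j) :
    ‖interlace V D‖ ≤ (∏ j, M j) * ∏ j, ‖V j‖ := by
  have hM : ∀ j, 0 ≤ M j := fun j => (norm_nonneg _).trans (h j)
  rw [interlace, Fin.prod_univ_succ, mul_assoc, ← Finset.prod_mul_distrib]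
  refine (norm_mul_le _ _).trans (mul_le_mul (h 0) (norm_prod_ofFn_le_of_le fun j => ?_)
    (norm_nonneg _) (hM 0))
  rw [mul_comm]
  exact (norm_mul_le _ _).trans (mul_le_mul_of_nonneg_left (h _) (norm_nonneg _))

theorem norm_interlace_sub_le {V : Fin n → 𝓗 →L[ℂ] 𝓗} {D D' : Fin (n + 1) → 𝓗 →L[ℂ] 𝓗}
    (h : ∀ j, ‖D j‖ ≤ 1) (h' : ∀ j, ‖D' j‖ ≤ 1) :
    ‖interlace V D - interlace V D'‖ ≤ (∑ j, ‖D j - D' j‖) * ∏ j, ‖V j‖ := by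
  induction n with
  | zero => simp [interlace]
  | succ n ih =>
    rw [interlace_succ, interlace_succ, Fin.sum_univ_succ, Fin.prod_univ_succ]
    set X := interlace (fun j => V j.succ) fun j => D j.succ
    set X' := interlace (fun j => V j.succ) fun j => D' j.succ
    have h1 : D 0 * (V 0 * X) - D' 0 * (V 0 * X') =
        (D 0 - D' 0) * (V 0 * X) + D' 0 * (V 0 * (X - X')) := by noncomm_ring
    have h2 : ‖X‖ ≤ ∏ j : Fin n, ‖V j.succ‖ := by
      simpa using norm_interlace_le (V := fun j => V j.succ) (D := fun j => D j.succ)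
        (M := fun _ => 1) fun j => h j.succ
    have h3 : ‖X - X'‖ ≤ (∑ j : Fin (n + 1), ‖D j.succ - D' j.succ‖) *
        ∏ j : Fin n, ‖V j.succ‖ :=
      ih (V := fun j => V j.succ) (fun j => h j.succ) fun j => h' j.succ
    rw [h1]
    calc _ ≤ ‖D 0 - D' 0‖ * (‖V 0‖ * ‖X‖) + ‖D' 0‖ * (‖V 0‖ * ‖X - X'‖) :=
          (norm_add_le _ _).trans (add_le_add
            ((norm_mul_le _ _).trans (mul_le_mul_of_nonneg_left (norm_mul_le _ _) (norm_nonneg _)))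
            ((norm_mul_le _ _).trans (mul_le_mul_of_nonneg_left (norm_mul_le _ _) (norm_nonneg _))))
      _ ≤ ‖D 0 - D' 0‖ * (‖V 0‖ * ∏ j : Fin n, ‖V j.succ‖) +
          1 * (‖V 0‖ * ((∑ j : Fin (n + 1), ‖D j.succ - D' j.succ‖) *
            ∏ j : Fin n, ‖V j.succ‖)) := by
          gcongr
          exact h' 0
      _ = _ := by ring

/-! ### Sums over eigenvectors -/

variable {ι : Fin (n + 1) → Type*}

/-- The sum `∑_r ψ(r₀, …, rₙ) P_{r₀} V₁ P_{r₁} ⋯ Vₙ P_{rₙ}` over `r ∈ E₀ × ⋯ × Eₙ`, where `P_i` is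
the projection onto the line spanned by the `i`-th basis vector. -/
def symbolSum (b : ∀ j, HilbertBasis (ι j) ℂ 𝓗) (V : Fin n → 𝓗 →L[ℂ] 𝓗)
    (E : ∀ j, Finset (ι j)) (ψ : (∀ j, ι j) → ℂ) : 𝓗 →L[ℂ] 𝓗 :=
  ∑ r ∈ Fintype.piFinset E, ψ r • interlace V fun j => lineProj (b j (r j))

variable (b : ∀ j, HilbertBasis (ι j) ℂ 𝓗) (V : Fin n → 𝓗 →L[ℂ] 𝓗) (E : ∀ j, Finset (ι j))

theorem symbolSum_sub (ψ ψ' : (∀ j, ι j) → ℂ) :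
    symbolSum b V E (fun r => ψ r - ψ' r) = symbolSum b V E ψ - symbolSum b V E ψ' := by
  simp only [symbolSum, sub_smul, Finset.sum_sub_distrib]

theorem symbolSum_prod (α : ∀ j, ι j → ℂ) :
    symbolSum b V E (fun r => ∏ j, α j (r j)) =
      interlace V fun j => ∑ i ∈ E j, α j i • lineProj (b j i) := by
  rw [interlace_sum]
  exact Finset.sum_congr rfl fun r _ => (interlace_smul _ _ _).symm

section Integral

variable {Ω : Type*} [MeasurableSpace Ω] {μ : Measure Ω} {w : Ω → ℂ} {α : Ω → ∀ j, ι j → ℂ}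
  {M : Fin (n + 1) → ℝ}

theorem integrable_mul_prod (hw : Integrable w μ) (hα : ∀ j i, Measurable fun ω => α ω j i)
    (r : ∀ j, ι j) (hM : ∀ ω j, ‖α ω j (r j)‖ ≤ M j) :
    Integrable (fun ω => w ω * ∏ j, α ω j (r j)) μ := by
  refine hw.mul_bdd (c := ∏ j, M j) ?_ (Eventually.of_forall fun ω => ?_)
  · exact (Finset.measurable_fun_prod _ fun j _ => hα j (r j)).aestronglyMeasurable
  · rw [norm_prod]
    exact Finset.prod_le_prod (fun _ _ => norm_nonneg _) fun j _ => hM ω j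

theorem symbolSum_mul_prod (w : ℂ) (α : ∀ j, ι j → ℂ) :
    symbolSum b V E (fun r => w * ∏ j, α j (r j)) =
      w • interlace V fun j => ∑ i ∈ E j, α j i • lineProj (b j i) := by
  rw [← symbolSum_prod, symbolSum, symbolSum, Finset.smul_sum]
  exact Finset.sum_congr rfl fun r _ => mul_smul _ _ _

/-- For fixed `ω` the symbol is a product, so the multiple sum collapses to a single interlaced
product of diagonal operators. -/
theorem symbolSum_integral [CompleteSpace 𝓗] (hw : Integrable w μ)
    (hα : ∀ j i, Measurable fun ω => α ω j i) (hM : ∀ ω j, ∀ i ∈ E j, ‖α ω j i‖ ≤ M j) :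
    Integrable (fun ω => w ω • interlace V fun j => ∑ i ∈ E j, α ω j i • lineProj (b j i)) μ ∧
    symbolSum b V E (fun r => ∫ ω, w ω * ∏ j, α ω j (r j) ∂μ) =
      ∫ ω, w ω • interlace V (fun j => ∑ i ∈ E j, α ω j i • lineProj (b j i)) ∂μ := by
  have h1 : ∀ r ∈ Fintype.piFinset E, Integrable (fun ω => (w ω * ∏ j, α ω j (r j)) •
      interlace V fun j => lineProj (b j (r j))) μ := fun r hr =>
    (integrable_mul_prod hw hα r fun ω j => hM ω j _ (Fintype.mem_piFinset.1 hr j)).smul_const _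
  simp only [← symbolSum_mul_prod]
  refine ⟨integrable_finsetSum _ h1, ?_⟩
  simp only [symbolSum]
  rw [integral_finsetSum _ h1]
  exact Finset.sum_congr rfl fun r _ => (integral_smul_const _ _).symm

theorem norm_symbolSum_integral_le [CompleteSpace 𝓗] (hw : Integrable w μ)
    (hα : ∀ j i, Measurable fun ω => α ω j i) (hM0 : ∀ j, 0 ≤ M j)
    (hM : ∀ ω j, ∀ i ∈ E j, ‖α ω j i‖ ≤ M j) :
    ‖symbolSum b V E (fun r => ∫ ω, w ω * ∏ j, α ω j (r j) ∂μ)‖ ≤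
      (∫ ω, ‖w ω‖ ∂μ) * ((∏ j, M j) * ∏ j, ‖V j‖) := by
  rw [(symbolSum_integral b V E hw hα hM).2, ← integral_mul_const]
  refine norm_integral_le_of_norm_le (hw.norm.mul_const _) (Eventually.of_forall fun ω => ?_)
  rw [norm_smul]
  exact mul_le_mul_of_nonneg_left (norm_interlace_le fun j =>
    (b j).norm_sum_lineProj_le _ (hM0 j) (hM ω j)) (norm_nonneg _)

end Integral

theorem measurable_exp_mul {Ω : Type*} [MeasurableSpace Ω] {θ : Ω → ℝ} (hθ : Measurable θ)
    (x : ℝ) : Measurable fun ω => Complex.exp ((θ ω * x : ℝ) * Complex.I) := by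
  fun_prop

theorem norm_symbolSum_le_of_isFourierIntegral [CompleteSpace 𝓗] {φ : (Fin (n + 1) → ℝ) → ℂ}
    {C : ℝ} (hφ : IsFourierIntegral φ C) (a : ∀ j, ι j → ℝ) {β : ∀ j, ι j → ℂ}
    {M : Fin (n + 1) → ℝ} (hM0 : ∀ j, 0 ≤ M j) (hM : ∀ j, ∀ i ∈ E j, ‖β j i‖ ≤ M j) :
    ‖symbolSum b V E (fun r => (∏ j, β j (r j)) * φ fun j => a j (r j))‖ ≤
      C * ((∏ j, M j) * ∏ j, ‖V j‖) := by
  obtain ⟨Ω, mΩ, μ, w, θ, hw, hθ, hC, hφ⟩ := hφ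
  have h1 := norm_symbolSum_integral_le b V E (M := M)
    (α := fun ω j i => β j i * Complex.exp ((θ ω j * a j i : ℝ) * Complex.I)) hw
    (fun j i => (measurable_exp_mul (hθ j) _).const_mul _) hM0 (fun ω j i hi => by
      rw [norm_mul, Complex.norm_exp_ofReal_mul_I, mul_one]
      exact hM j i hi)
  have h2 : (fun r : ∀ j, ι j => (∏ j, β j (r j)) * φ fun j => a j (r j)) = fun r =>
      ∫ ω, w ω * ∏ j, (β j (r j) * Complex.exp ((θ ω j * a j (r j) : ℝ) * Complex.I)) ∂μ := by
    funext r
    rw [hφ, ← integral_const_mul]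
    congr 1
    funext ω
    rw [Finset.prod_mul_distrib]
    ring
  rw [h2]
  exact h1.trans (mul_le_mul_of_nonneg_right hC (mul_nonneg
    (Finset.prod_nonneg fun j _ => hM0 j) (Finset.prod_nonneg fun j _ => norm_nonneg _)))

theorem norm_symbolSum_le [CompleteSpace 𝓗] {φ : (Fin (n + 1) → ℝ) → ℂ}
    {C : ℝ} (hφ : IsFourierIntegral φ C) (a : ∀ j, ι j → ℝ) :
    ‖symbolSum b V E (fun r => φ fun j => a j (r j))‖ ≤ C * ∏ j, ‖V j‖ := by
  simpa using norm_symbolSum_le_of_isFourierIntegral b V E hφ a (β := fun _ _ => 1)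
    (M := fun _ => 1) (fun _ => zero_le_one) fun _ _ _ => by simp

theorem norm_exp_sub_exp_le (t x y : ℝ) : ‖Complex.exp ((t * x : ℝ) * Complex.I) -
    Complex.exp ((t * y : ℝ) * Complex.I)‖ ≤ min 2 (|t| * |x - y|) := by
  refine le_min ?_ ?_
  · refine (norm_sub_le _ _).trans ?_
    rw [Complex.norm_exp_ofReal_mul_I, Complex.norm_exp_ofReal_mul_I]
    norm_num
  · have h1 : Complex.exp ((t * x : ℝ) * Complex.I) - Complex.exp ((t * y : ℝ) * Complex.I) =
        Complex.exp ((t * y : ℝ) * Complex.I) *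
          (Complex.exp (Complex.I * (t * (x - y) : ℝ)) - 1) := by
      rw [mul_sub, ← Complex.exp_add, mul_one]
      congr 2
      push_cast
      ring
    rw [h1, norm_mul, Complex.norm_exp_ofReal_mul_I, one_mul, ← abs_mul, ← Real.norm_eq_abs]
    exact Real.norm_exp_I_mul_ofReal_sub_one_le

/-- Sums of a fixed symbol at nearby points are close, uniformly in the set of summation. -/
theorem exists_symbolSum_sub_le [CompleteSpace 𝓗] {φ : (Fin (n + 1) → ℝ) → ℂ}
    {C : ℝ} (hφ : IsFourierIntegral φ C) :
    ∃ ε : ℕ → ℝ, Tendsto ε atTop (𝓝 0) ∧ ∀ (m : ℕ) (a a' : ∀ j, ι j → ℝ),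
      (∀ j i, |a j i - a' j i| ≤ 1 / m) → ∀ E : ∀ j, Finset (ι j),
        ‖symbolSum b V E (fun r => φ fun j => a j (r j)) -
          symbolSum b V E (fun r => φ fun j => a' j (r j))‖ ≤ ε m := by
  obtain ⟨Ω, mΩ, μ, w, θ, hw, hθ, hC, hφ⟩ := hφ
  -- No integrability of `|θ| ‖w‖` is assumed, so there is no rate in `1 / m`; the cap `2` permits
  -- dominated convergence.
  set δ : ℕ → Ω → ℝ := fun m ω => ∑ j, min 2 (|θ ω j| * (1 / m)) with hδ
  have hδm : ∀ m, Measurable (δ m) := fun m => by fun_prop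
  have hδ0 : ∀ m ω, 0 ≤ δ m ω := fun m ω => Finset.sum_nonneg fun j _ => by positivity
  have hδ2 : ∀ m ω, δ m ω ≤ (n + 1) * 2 := fun m ω => by
    refine (Finset.sum_le_sum fun j _ => min_le_left _ _).trans ?_
    simp
  refine ⟨fun m => ∫ ω, ‖w ω‖ * (δ m ω * ∏ j, ‖V j‖) ∂μ, ?_, fun m a a' haa E => ?_⟩
  · have h0 : (0 : ℝ) = ∫ ω, ‖w ω‖ * (0 * ∏ j, ‖V j‖) ∂μ := by simp
    rw [h0]
    refine tendsto_integral_of_dominated_convergence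
      (fun ω => ‖w ω‖ * (((n + 1) * 2) * ∏ j, ‖V j‖)) (fun m => ?_) (hw.norm.mul_const _)
      (fun m => Eventually.of_forall fun ω => ?_) (Eventually.of_forall fun ω => ?_)
    · exact hw.norm.aestronglyMeasurable.mul ((hδm m).mul_const _).aestronglyMeasurable
    · rw [Real.norm_of_nonneg (mul_nonneg (norm_nonneg _) (mul_nonneg (hδ0 m ω)
        (Finset.prod_nonneg fun j _ => norm_nonneg _)))]
      gcongr
      exact hδ2 m ω
    · refine Tendsto.const_mul _ (Tendsto.mul_const _ ?_)
      have h1 : (0 : ℝ) = ∑ j : Fin (n + 1), min 2 (|θ ω j| * 0) := by simp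
      rw [h1]
      exact tendsto_finsetSum _ fun j _ => tendsto_const_nhds.min
        (tendsto_one_div_atTop_nhds_zero_nat.const_mul _)
  · have key : ∀ a : ∀ j, ι j → ℝ, Integrable (fun ω => w ω • interlace V fun j =>
          ∑ i ∈ E j, Complex.exp ((θ ω j * a j i : ℝ) * Complex.I) • lineProj (b j i)) μ ∧
        symbolSum b V E (fun r => φ fun j => a j (r j)) =
          ∫ ω, w ω • interlace V (fun j =>
            ∑ i ∈ E j, Complex.exp ((θ ω j * a j i : ℝ) * Complex.I) • lineProj (b j i)) ∂μ := by
      intro a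
      simp only [hφ]
      exact symbolSum_integral b V E (M := fun _ => 1)
        (α := fun ω j i => Complex.exp ((θ ω j * a j i : ℝ) * Complex.I)) hw
        (fun j i => measurable_exp_mul (hθ j) _)
        fun ω j i _ => (Complex.norm_exp_ofReal_mul_I _).le
    rw [(key a).2, (key a').2, ← integral_sub (key a).1 (key a').1]
    refine norm_integral_le_of_norm_le ?_ (Eventually.of_forall fun ω => ?_)
    · refine hw.norm.mul_bdd (c := ((n + 1) * 2) * ∏ j, ‖V j‖)
        ((hδm m).mul_const _).aestronglyMeasurable (Eventually.of_forall fun ω => ?_)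
      rw [Real.norm_of_nonneg (mul_nonneg (hδ0 m ω)
        (Finset.prod_nonneg fun j _ => norm_nonneg _))]
      gcongr
      exact hδ2 m ω
    · rw [← smul_sub, norm_smul]
      refine mul_le_mul_of_nonneg_left ((norm_interlace_sub_le (fun j => ?_) fun j => ?_).trans
        (mul_le_mul_of_nonneg_right (Finset.sum_le_sum fun j _ => ?_)
          (Finset.prod_nonneg fun j _ => norm_nonneg _))) (norm_nonneg _)
      · exact (b j).norm_sum_lineProj_le _ zero_le_one
          fun i _ => (Complex.norm_exp_ofReal_mul_I _).le
      · exact (b j).norm_sum_lineProj_le _ zero_le_one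
          fun i _ => (Complex.norm_exp_ofReal_mul_I _).le
      · rw [← Finset.sum_sub_distrib]
        simp only [← sub_smul]
        refine (b j).norm_sum_lineProj_le _ (by positivity) fun i _ => ?_
        refine (norm_exp_sub_exp_le _ _ _).trans (min_le_min_left _ ?_)
        exact mul_le_mul_of_nonneg_left (haa j i) (abs_nonneg _)

end

section

/-! ### Convergence along finite sets -/

/-- A family `F ⊇ G` is reached from `G` one coordinate at a time. By `hadd`, changing the `j`-th
coordinate adds a value of `T` whose `j`-th set is `F j \ G j`, which is small by `htail`. -/
theorem cauchySeq_of_coordinatewise {k : ℕ} {ι : Fin k → Type*} [∀ j, DecidableEq (ι j)]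
    {X : Type*} [NormedAddCommGroup X] {T : (∀ j, Finset (ι j)) → X}
    (hadd : ∀ E j A, A ⊆ E j →
      T E - T (Function.update E j A) = T (Function.update E j (E j \ A)))
    (htail : ∀ ε > 0, ∀ j, ∃ G : Finset (ι j), ∀ E, Disjoint (E j) G → ‖T E‖ ≤ ε) :
    CauchySeq T := by
  rw [Metric.cauchySeq_iff']
  intro ε hε
  -- The `k` changes cost `k ε / (k + 1)` in total, which is strictly less than `ε`.
  have hη : 0 < ε / (k + 1) := by positivity
  choose G hG using htail _ hη
  refine ⟨G, fun F hF => ?_⟩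
  have key : ∀ J : Finset (Fin k), ‖T (J.piecewise F G) - T G‖ ≤ J.card * (ε / (k + 1)) := by
    intro J
    induction J using Finset.induction_on with
    | empty => simp
    | insert j J hj ih =>
      set E := (insert j J).piecewise F G with hE
      have hEj : E j = F j := by simp [hE]
      have h1 : Function.update E j (G j) = J.piecewise F G := by
        rw [hE, Finset.piecewise_insert, Function.update_idem, Function.update_eq_self_iff,
          Finset.piecewise_eq_of_notMem _ _ _ hj]
      have h2 := hadd E j (G j) (hEj ▸ hF j)
      have h3 : ‖T E - T (J.piecewise F G)‖ ≤ ε / (k + 1) := by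
        rw [← h1, h2]
        refine hG j _ ?_
        rw [Function.update_self]
        exact Finset.sdiff_disjoint
      have h4 : T E - T G = (T E - T (J.piecewise F G)) + (T (J.piecewise F G) - T G) := by abel
      rw [h4, Finset.card_insert_of_notMem hj]
      push_cast
      refine (norm_add_le _ _).trans ?_
      linarith
  have h5 := key Finset.univ
  rw [Finset.piecewise_univ, Finset.card_univ, Fintype.card_fin] at h5
  rw [dist_eq_norm]
  refine h5.trans_lt ?_
  rw [mul_div_assoc', div_lt_iff₀ (by positivity)]
  nlinarith

/-- The omitted variable receives frequency zero. -/
theorem IsFourierIntegral.comp_succAbove {k : ℕ} {φ : (Fin k → ℝ) → ℂ} {C : ℝ}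
    (h : IsFourierIntegral φ C) (j : Fin (k + 1)) :
    IsFourierIntegral (fun x : Fin (k + 1) → ℝ => φ fun i => x (j.succAbove i)) C := by
  obtain ⟨Ω, mΩ, μ, w, θ, hw, hθ, hC, hφ⟩ := h
  refine ⟨Ω, mΩ, μ, w, fun ω => j.insertNth 0 (θ ω), hw, fun i => ?_, hC, fun x => ?_⟩
  · induction i using Fin.succAboveCases j with
    | x => simp
    | p i => simpa using hθ i
  · refine (hφ _).trans ?_
    congr 1
    funext ω
    rw [Fin.prod_univ_succAbove _ j]
    simp

theorem isFourierIntegral_zero (k : ℕ) : IsFourierIntegral (fun _ : Fin k → ℝ => 0) 0 :=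
  ⟨ℝ, inferInstance, 0, 0, 0, integrable_zero _ _ _, fun _ => measurable_const, by simp,
    fun _ => by simp⟩

/-- The bound for the Fourier representation of `(f u^m)^{[n-1]}`, and `0` for `n = 0`. -/
def predFourierBound (f : ℝ → ℂ) (m : ℕ) : ℕ → ℝ
  | 0 => 0
  | n + 1 => fourierNorm (iteratedDeriv n (weighted f m)) / n.factorial

theorem isFourierIntegral_predDividedDiff {s n : ℕ} {f : ℝ → ℂ} (hf : f ∈ classW s n) {m : ℕ}
    (hm : m ≤ s) :
    IsFourierIntegral (predDividedDiff (weighted f m) n) (predFourierBound f m n) := by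
  cases n with
  | zero => exact isFourierIntegral_zero 0
  | succ n => exact isFourierIntegral_dividedDiff_weighted hf hm n.le_succ

variable {𝓗 : Type*} [NormedAddCommGroup 𝓗] [InnerProductSpace ℂ 𝓗] {n : ℕ}
  {ι : Fin (n + 1) → Type*}
  (b : ∀ j, HilbertBasis (ι j) ℂ 𝓗) (V : Fin n → 𝓗 →L[ℂ] 𝓗)

theorem symbolSum_sub_update [∀ j, DecidableEq (ι j)] (ψ : (∀ j, ι j) → ℂ)
    (E : ∀ j, Finset (ι j)) (j : Fin (n + 1)) (A : Finset (ι j)) (hA : A ⊆ E j) :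
    symbolSum b V E ψ - symbolSum b V (Function.update E j A) ψ =
      symbolSum b V (Function.update E j (E j \ A)) ψ := by
  have h1 : (Fintype.piFinset E).filter (fun r => r j ∈ A) =
      Fintype.piFinset (Function.update E j A) := by
    ext r
    simp only [Finset.mem_filter, Fintype.mem_piFinset]
    constructor
    · rintro ⟨h, hj⟩ k
      rcases eq_or_ne k j with rfl | hk
      · rwa [Function.update_self]
      · rw [Function.update_of_ne hk]
        exact h k
    · intro h
      have hj : r j ∈ A := by simpa using h j
      refine ⟨fun k => ?_, hj⟩
      rcases eq_or_ne k j with rfl | hk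
      · exact hA hj
      · simpa [Function.update_of_ne hk] using h k
  have h2 : (Fintype.piFinset E).filter (fun r => ¬ r j ∈ A) =
      Fintype.piFinset (Function.update E j (E j \ A)) := by
    ext r
    simp only [Finset.mem_filter, Fintype.mem_piFinset]
    constructor
    · rintro ⟨h, hj⟩ k
      rcases eq_or_ne k j with rfl | hk
      · rw [Function.update_self]
        exact Finset.mem_sdiff.2 ⟨h k, hj⟩
      · rw [Function.update_of_ne hk]
        exact h k
    · intro h
      have hj : r j ∈ E j \ A := by simpa using h j
      rw [Finset.mem_sdiff] at hj
      refine ⟨fun k => ?_, hj.2⟩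
      rcases eq_or_ne k j with rfl | hk
      · exact hj.1
      · simpa [Function.update_of_ne hk] using h k
  rw [symbolSum, symbolSum, symbolSum, ← h1, ← h2, sub_eq_iff_eq_add']
  exact (Finset.sum_filter_add_sum_filter_not _ _ _).symm

theorem norm_inv_sub_I_le {x δ : ℝ} (hδ : 0 < δ) (h : δ⁻¹ ≤ |x|) :
    ‖((x : ℂ) - Complex.I)⁻¹‖ ≤ δ := by
  rw [norm_inv]
  refine inv_le_of_inv_le₀ hδ (h.trans ?_)
  simpa using Complex.abs_re_le_norm ((x : ℂ) - Complex.I)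

variable [CompleteSpace 𝓗]

theorem norm_symbolSum_inv_mul_le {φ : (Fin (n + 1) → ℝ) → ℂ} {C : ℝ}
    (hφ : IsFourierIntegral φ C) (a : ∀ j, ι j → ℝ) (E : ∀ j, Finset (ι j)) (j : Fin (n + 1))
    {δ : ℝ} (hδ : 0 ≤ δ) (h : ∀ i ∈ E j, ‖((a j i : ℂ) - Complex.I)⁻¹‖ ≤ δ) :
    ‖symbolSum b V E fun r => ((a j (r j) : ℂ) - Complex.I)⁻¹ * φ fun k => a k (r k)‖ ≤
      C * (δ * ∏ k, ‖V k‖) := by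
  let β : ∀ k, ι k → ℂ :=
    Function.update (fun _ _ => 1) j fun i => ((a j i : ℂ) - Complex.I)⁻¹
  have h1 := norm_symbolSum_le_of_isFourierIntegral b V E hφ a (β := β)
    (M := Function.update (fun _ => 1) j δ) (fun k => by
      rcases eq_or_ne k j with rfl | hk
      · simpa using hδ
      · simp [Function.update_of_ne hk]) (fun k i hi => by
      rcases eq_or_ne k j with rfl | hk
      · simpa [β] using h i hi
      · simp [β, Function.update_of_ne hk])
  have h2 : ∀ r : ∀ k, ι k, ∏ k, β k (r k) = ((a j (r j) : ℂ) - Complex.I)⁻¹ := by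
    intro r
    rw [Finset.prod_eq_single j (fun k _ hk => by simp [β, Function.update_of_ne hk]) (by simp)]
    simp [β]
  have h3 : ∏ k, Function.update (fun _ : Fin (n + 1) => (1 : ℝ)) j δ k = δ := by
    rw [Finset.prod_eq_single j (fun k _ hk => by simp [Function.update_of_ne hk]) (by simp)]
    simp
  simpa only [h2, h3] using h1

theorem dividedDiff_weighted_eq_inv_mul {s : ℕ} {f : ℝ → ℂ} (hf : f ∈ classW s n) {m : ℕ}
    (hm : m + 1 ≤ s) (x : Fin (n + 1) → ℝ) (j : Fin (n + 1)) :
    dividedDiff (weighted f m) n x =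
      ((x j : ℂ) - Complex.I)⁻¹ * dividedDiff (weighted f (m + 1)) n x -
      ((x j : ℂ) - Complex.I)⁻¹ *
        predDividedDiff (weighted f m) n fun i => x (j.succAbove i) := by
  rw [dividedDiff_weighted_succ hf (Nat.le_of_succ_le hm) le_rfl x j, mul_add, add_sub_cancel_right, ← mul_assoc,
    inv_mul_cancel₀ (ofReal_sub_I_ne_zero _), one_mul]

/-- For each `j`, `f^{[n]}` is `u(x_j)⁻¹` times the difference of `(f u)^{[n]}` and `f^{[n-1]}` with
`x_j` omitted, both with Fourier representations. Outside a finite set of indices `|u⁻¹| ≤ δ` in the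
`j`-th slot; this is where `s ≥ 1` enters. -/
theorem cauchySeq_symbolSum {s : ℕ} (hs : 1 ≤ s) {f : ℝ → ℂ} (hf : f ∈ classW s n)
    {a : ∀ j, ι j → ℝ} (ha : ∀ j C, {i | |a j i| ≤ C}.Finite) :
    CauchySeq fun E : ∀ j, Finset (ι j) =>
      symbolSum b V E fun r => dividedDiff f n fun j => a j (r j) := by
  classical
  refine cauchySeq_of_coordinatewise (symbolSum_sub_update b V _) fun ε hε j => ?_
  have h1 := isFourierIntegral_dividedDiff_weighted hf hs (le_refl n)
  have h2 := (isFourierIntegral_predDividedDiff hf (Nat.zero_le s)).comp_succAbove j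
  set C1 := fourierNorm (iteratedDeriv n (weighted f 1)) / n.factorial
  set C2 := predFourierBound f 0 n
  have hC1 : 0 ≤ C1 := div_nonneg (fourierNorm_nonneg _) (Nat.cast_nonneg _)
  have hC2 : 0 ≤ C2 := by
    cases n with
    | zero => exact le_rfl
    | succ n => exact div_nonneg (fourierNorm_nonneg _) (Nat.cast_nonneg _)
  set W := ∏ k, ‖V k‖
  have hW : 0 ≤ W := Finset.prod_nonneg fun _ _ => norm_nonneg _
  set K := (C1 + C2) * W + 1
  have hK : 0 < K := by positivity
  set δ := ε / K with hδ
  have hδ0 : 0 < δ := div_pos hε hK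
  refine ⟨(ha j δ⁻¹).toFinset, fun E hE => ?_⟩
  have h3 : ∀ i ∈ E j, ‖((a j i : ℂ) - Complex.I)⁻¹‖ ≤ δ := by
    intro i hi
    have h4 := Finset.disjoint_left.1 hE hi
    rw [Set.Finite.mem_toFinset, Set.mem_ofPred_eq, not_le] at h4
    exact norm_inv_sub_I_le hδ0 h4.le
  have h5 : symbolSum b V E (fun r => dividedDiff f n fun j => a j (r j)) =
      symbolSum b V E (fun r => ((a j (r j) : ℂ) - Complex.I)⁻¹ *
        dividedDiff (weighted f (0 + 1)) n fun k => a k (r k)) -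
      symbolSum b V E (fun r => ((a j (r j) : ℂ) - Complex.I)⁻¹ *
        (fun x : Fin (n + 1) → ℝ => predDividedDiff (weighted f 0) n
          fun i => x (j.succAbove i)) fun k => a k (r k)) := by
    rw [← symbolSum_sub]
    congr 1
    funext r
    rw [← dividedDiff_weighted_eq_inv_mul hf hs (fun k => a k (r k)) j, weighted_zero]
  rw [h5]
  refine (norm_sub_le _ _).trans ((add_le_add
    (norm_symbolSum_inv_mul_le b V h1 a E j hδ0.le h3)
    (norm_symbolSum_inv_mul_le b V h2 a E j hδ0.le h3)).trans ?_)
  have h6 : C1 * (δ * W) + C2 * (δ * W) = δ * ((C1 + C2) * W) := by ring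
  rw [h6, ← div_mul_cancel₀ ε hK.ne', ← hδ]
  exact mul_le_mul_of_nonneg_left (by simp [K]) hδ0.le

end

section

/-! ### The constant -/

/-- The constant `c_{q,n}(f u^m)`, by Pascal's recursion. -/
def traceConst (f : ℝ → ℂ) : ℕ → ℕ → ℕ → ℝ
  | 0, m, n => fourierNorm (iteratedDeriv n (weighted f m)) / n.factorial
  | q + 1, m, 0 => traceConst f q (m + 1) 0
  | q + 1, m, n + 1 => traceConst f q (m + 1) (n + 1) + traceConst f q m n

theorem traceConst_nonneg (f : ℝ → ℂ) (q m n : ℕ) : 0 ≤ traceConst f q m n := by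
  induction q generalizing m n with
  | zero => exact div_nonneg (fourierNorm_nonneg _) (Nat.cast_nonneg _)
  | succ q ih =>
    cases n with
    | zero => exact ih _ _
    | succ n => exact add_nonneg (ih _ _) (ih _ _)

/-- Pascal's rule. The cutoff `k ≤ n` stands inside the sum so that the range does not depend on `n`
in the induction. -/
theorem traceConst_eq_sum (f : ℝ → ℂ) (q m n : ℕ) :
    traceConst f q m n = ∑ k ∈ Finset.range (q + 1), (q.choose k : ℝ) *
      if k ≤ n then fourierNorm (iteratedDeriv (n - k) (weighted f (m + q - k))) /
        (n - k).factorial else 0 := by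
  induction q generalizing m n with
  | zero => simp [traceConst]
  | succ q ih =>
    set h : ℕ → ℝ := fun k => if k ≤ n then
      fourierNorm (iteratedDeriv (n - k) (weighted f (m + (q + 1) - k))) / (n - k).factorial
      else 0 with hh
    have h1 : ∑ k ∈ Finset.range (q + 1 + 1), ((q + 1).choose k : ℝ) * h k =
        ∑ k ∈ Finset.range (q + 1), (q.choose k : ℝ) * h k +
          ∑ k ∈ Finset.range (q + 1), (q.choose k : ℝ) * h (k + 1) := by
      rw [Finset.sum_range_succ']
      simp only [Nat.choose_succ_succ, Nat.cast_add, add_mul, Finset.sum_add_distrib]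
      have h2 : ∑ k ∈ Finset.range (q + 1), (q.choose k : ℝ) * h k =
          ∑ k ∈ Finset.range (q + 1 + 1), (q.choose k : ℝ) * h k := by
        rw [Finset.sum_range_succ _ (q + 1)]
        simp
      rw [h2, Finset.sum_range_succ' _ (q + 1)]
      simp only [Nat.succ_eq_add_one, Nat.choose_zero_right]
      ring
    have h3 : ∑ k ∈ Finset.range (q + 1), (q.choose k : ℝ) * h k =
        traceConst f q (m + 1) n := by
      rw [ih]
      refine Finset.sum_congr rfl fun k _ => ?_
      rw [hh]
      simp only [show m + 1 + q = m + (q + 1) by ring]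
    rw [h1, h3]
    cases n with
    | zero => simp [traceConst, hh]
    | succ n =>
      rw [traceConst, ih m n]
      congr 1
      refine Finset.sum_congr rfl fun k _ => ?_
      simp only [hh, add_le_add_iff_right, Nat.add_sub_add_right, ← add_assoc]

theorem traceConst_eq_constC (f : ℝ → ℂ) (s n : ℕ) : traceConst f s 0 n = constC s n f := by
  rw [traceConst_eq_sum, constC]
  simp only [mul_ite, mul_zero, zero_add]
  rw [← Finset.sum_filter]
  refine Finset.sum_congr ?_ fun k _ => (mul_div_assoc _ _ _).symm
  ext k
  simp only [Finset.mem_filter, Finset.mem_range]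
  omega

theorem classW_mono {s n k : ℕ} (hk : k ≤ n) {f : ℝ → ℂ} (hf : f ∈ classW s n) :
    f ∈ classW s k :=
  ⟨hf.1.of_le (by exact_mod_cast hk), fun m hm j hj => hf.2 m hm j (hj.trans hk)⟩

/-! ### Operations on trace bounds, and the trace estimate for finite sums -/

variable {𝓗 : Type*} [NormedAddCommGroup 𝓗] [InnerProductSpace ℂ 𝓗]

theorem TraceBound.mono {T : 𝓗 →L[ℂ] 𝓗} {C C' : ℝ} (h : TraceBound T C) (hC : C ≤ C') :
    TraceBound T C' := fun ℓ hℓ => (h ℓ hℓ).trans hC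

theorem TraceBound.sub {T T' : 𝓗 →L[ℂ] 𝓗} {C C' : ℝ} (h : TraceBound T C)
    (h' : TraceBound T' C') : TraceBound (T - T') (C + C') := fun ℓ hℓ => by
  rw [map_sub]
  exact (norm_sub_le _ _).trans (add_le_add (h ℓ hℓ) (h' ℓ hℓ))

theorem TraceBound.of_tendsto {α : Type*} {l : Filter α} [l.NeBot] {S : α → 𝓗 →L[ℂ] 𝓗}
    {T : 𝓗 →L[ℂ] 𝓗} {C : ℝ} (h : ∀ x, TraceBound (S x) C) (hT : Tendsto S l (𝓝 T)) :
    TraceBound T C := fun ℓ hℓ =>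
  le_of_tendsto (((ℓ.continuous.tendsto T).comp hT).norm)
    (Eventually.of_forall fun x => h x ℓ hℓ)

section

variable {n : ℕ} {ι : Fin (n + 1) → Type*}
  (b : ∀ j, HilbertBasis (ι j) ℂ 𝓗) (V : Fin n → 𝓗 →L[ℂ] 𝓗) (E : ∀ j, Finset (ι j))

theorem mul_lineProj {X : 𝓗 →L[ℂ] 𝓗} {c : ℂ} {e : 𝓗} (h : X e = c • e) :
    X * lineProj e = c • lineProj e := by
  ext x
  rw [mul_apply_eq_comp, smul_apply, InnerProductSpace.rankOne_apply, map_smul, h, smul_comm]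

theorem mul_symbolSum {X : 𝓗 →L[ℂ] 𝓗} {c : ι 0 → ℂ} (hX : ∀ i, X (b 0 i) = c i • b 0 i)
    (ψ : (∀ j, ι j) → ℂ) :
    X * symbolSum b V E ψ = symbolSum b V E fun r => c (r 0) * ψ r := by
  rw [symbolSum, symbolSum, Finset.mul_sum]
  refine Finset.sum_congr rfl fun r _ => ?_
  rw [interlace, mul_smul_comm, ← mul_assoc, mul_lineProj (hX _), smul_mul_assoc, smul_smul,
    mul_comm]

end

/-- When the symbol does not depend on the first variable, the projections in that slot add up to
one projection, so the variable is dropped at the cost of `‖V 0‖` only. -/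
theorem symbolSum_succ {n : ℕ} {ι : Fin (n + 2) → Type*} (b : ∀ j, HilbertBasis (ι j) ℂ 𝓗)
    (V : Fin (n + 1) → 𝓗 →L[ℂ] 𝓗) (E : ∀ j, Finset (ι j))
    (ψ : (∀ j : Fin (n + 1), ι j.succ) → ℂ) :
    symbolSum b V E (fun r => ψ fun j => r j.succ) =
      (∑ i ∈ E 0, lineProj (b 0 i)) * V 0 *
        symbolSum (fun j => b j.succ) (fun j => V j.succ) (fun j => E j.succ) ψ := by
  rw [mul_assoc, symbolSum, symbolSum, Finset.mul_sum, Finset.sum_mul_sum,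
    ← Finset.sum_product']
  refine Finset.sum_nbij' (fun r => (r 0, fun j => r j.succ))
    (fun p => (Fin.cons p.1 p.2 : ∀ j, ι j)) (fun r hr => ?_) (fun p hp => ?_)
    (fun r _ => Fin.cons_self_tail r) (fun p _ => rfl) (fun r _ => ?_)
  · rw [Fintype.mem_piFinset] at hr
    exact Finset.mem_product.2 ⟨hr 0, Fintype.mem_piFinset.2 fun j => hr j.succ⟩
  · rw [Finset.mem_product, Fintype.mem_piFinset] at hp
    exact Fintype.mem_piFinset.2 (Fin.cases hp.1 hp.2)
  · rw [interlace_succ, mul_smul_comm, mul_smul_comm]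

variable [CompleteSpace 𝓗]

/-- The trace norm estimate for finite sums, preceded by a product of operators and copies of `R`
which is used up by Hölder's inequality. -/
theorem traceBound_prod_mul_symbolSum {J : Type*} (e : HilbertBasis J ℂ 𝓗) {R : 𝓗 →L[ℂ] 𝓗}
    {ρ : J → ℂ} (hR : ∀ i, R (e i) = ρ i • e i) {s : ℕ} (hs : 0 < s)
    (hρ : Summable fun i => ‖ρ i‖ ^ s) {κ : ℝ} {f : ℝ → ℂ} (q : ℕ) :
    ∀ {n : ℕ} {ι : Fin (n + 1) → Type*} (b : ∀ j, HilbertBasis (ι j) ℂ 𝓗)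
      (V : Fin n → 𝓗 →L[ℂ] 𝓗) (E : ∀ j, Finset (ι j)) (a : ∀ j, ι j → ℝ)
      (K : Fin (n + 1) → 𝓗 →L[ℂ] 𝓗), (∀ j, ‖K j‖ ≤ κ) →
      (∀ j i, (R * K j) (b j i) = ((a j i : ℂ) - Complex.I)⁻¹ • b j i) →
      f ∈ classW s n → ∀ m, m + q ≤ s → ∀ l : List (𝓗 →L[ℂ] 𝓗), l.length + q = s →
      ∀ C : 𝓗 →L[ℂ] 𝓗,
      TraceBound ((l.map (· * R)).prod * (C * symbolSum b V E fun r =>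
          dividedDiff (weighted f m) n fun j => a j (r j)))
        ((l.map norm).prod * ‖C‖ * (∑' i, ‖ρ i‖ ^ s) * κ ^ q * traceConst f q m n *
          ∏ j, ‖V j‖) := by
  have hτ : 0 ≤ ∑' i, ‖ρ i‖ ^ s := tsum_nonneg fun i => by positivity
  set τ := ∑' i, ‖ρ i‖ ^ s with hτdef
  have hnorm : ∀ l : List (𝓗 →L[ℂ] 𝓗), 0 ≤ (l.map norm).prod := fun l =>
    List.prod_nonneg fun x hx => by
      obtain ⟨T, -, rfl⟩ := List.mem_map.1 hx
      exact norm_nonneg T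
  induction q with
  | zero =>
    intro n ι b V E a K _ _ hf m hm l hl C
    have hl' : l.length = s := hl
    subst hl'
    -- All `s` copies of `R` have been extracted: Hölder's inequality applies to them, and the
    -- remaining sum is bounded in operator norm.
    have h1 := TraceBound.prod_mul e hs l.get hR hρ
      (C * symbolSum b V E fun r => dividedDiff (weighted f m) n fun j => a j (r j))
    have h2 : (List.ofFn fun k => l.get k * R) = l.map (· * R) := by
      rw [← List.ofFn_get (l.map (· * R))]
      simp
    have h3 : ∏ k, ‖l.get k‖ = (l.map norm).prod := by
      rw [← List.prod_ofFn, ← List.ofFn_get (l.map norm)]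
      simp
    rw [h2, h3] at h1
    have h4 := norm_symbolSum_le b V E
      (isFourierIntegral_dividedDiff_weighted hf (by omega : m ≤ l.length) (le_refl n)) a
    refine h1.mono ?_
    have h5 := hnorm l
    rw [traceConst, pow_zero, mul_one]
    calc _ ≤ (l.map norm).prod * τ * (‖C‖ * (fourierNorm (iteratedDeriv n (weighted f m)) /
          n.factorial * ∏ j, ‖V j‖)) := by
          gcongr
          exact (norm_mul_le _ _).trans (mul_le_mul_of_nonneg_left h4 (norm_nonneg _))
      _ = _ := by ring
  | succ q ih =>
    intro n ι b V E a K hK hKR hf m hm l hl C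
    have hκ : 0 ≤ κ := (norm_nonneg _).trans (hK 0)
    have hl' : (l ++ [C]).length + q = s := by
      rw [List.length_append, List.length_singleton, ← hl]; ring
    have hL : ((l ++ [C]).map (· * R)).prod = (l.map (· * R)).prod * (C * R) := by simp
    have hLn : ((l ++ [C]).map norm).prod = (l.map norm).prod * ‖C‖ := by simp
    have hL0 : 0 ≤ (l.map norm).prod * ‖C‖ := mul_nonneg (hnorm l) (norm_nonneg _)
    have hW : 0 ≤ ∏ j, ‖V j‖ := Finset.prod_nonneg fun _ _ => norm_nonneg _
    set S1 := symbolSum b V E fun r => dividedDiff (weighted f (m + 1)) n fun j => a j (r j)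
      with hS1
    set S2 := symbolSum b V E fun r =>
      predDividedDiff (weighted f m) n fun j => a j.succ (r j.succ) with hS2
    -- The product rule at the first node: `u(x₀)⁻¹` acts as left multiplication by `R * K 0`. The
    -- prefactor `C` then joins the list together with the new `R`, and `K 0` starts the next
    -- prefactor.
    have h1 : (symbolSum b V E fun r => dividedDiff (weighted f m) n fun j => a j (r j)) =
        R * K 0 * (S1 - S2) := by
      rw [hS1, hS2, ← symbolSum_sub, mul_symbolSum b V E (hKR 0)]
      congr 1
      funext r
      rw [dividedDiff_weighted_eq_inv_mul hf (by omega) _ 0, mul_sub]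
      simp only [Fin.zero_succAbove]
    have h2 := ih b V E a K hK hKR hf (m + 1) (by omega) (l ++ [C]) hl' (K 0)
    rw [hL, hLn] at h2
    have h3 : (l.map (· * R)).prod * (C * (R * K 0 * (S1 - S2))) =
        (l.map (· * R)).prod * (C * R) * (K 0 * S1) -
          (l.map (· * R)).prod * (C * R) * (K 0 * S2) := by noncomm_ring
    rw [h1, h3]
    have hc := traceConst_nonneg f q (m + 1) n
    have h4 : (l.map norm).prod * ‖C‖ * ‖K 0‖ * τ * κ ^ q * traceConst f q (m + 1) n *
        ∏ j, ‖V j‖ ≤ (l.map norm).prod * ‖C‖ * τ * κ ^ (q + 1) * traceConst f q (m + 1) n *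
        ∏ j, ‖V j‖ := by
      calc _ = ‖K 0‖ * ((l.map norm).prod * ‖C‖ * τ * κ ^ q * traceConst f q (m + 1) n *
            ∏ j, ‖V j‖) := by ring
        _ ≤ κ * ((l.map norm).prod * ‖C‖ * τ * κ ^ q * traceConst f q (m + 1) n *
            ∏ j, ‖V j‖) := by
          gcongr
          exact hK 0
        _ = _ := by ring
    cases n with
    | zero =>
      have h5 : S2 = 0 := by simp [hS2, predDividedDiff, symbolSum]
      rw [h5, mul_zero, mul_zero, sub_zero]
      exact h2.mono h4
    | succ n =>
      have h5 : S2 = (∑ i ∈ E 0, lineProj (b 0 i)) * V 0 *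
          symbolSum (fun j => b j.succ) (fun j => V j.succ) (fun j => E j.succ)
            fun r => dividedDiff (weighted f m) n fun j => a j.succ (r j) :=
        symbolSum_succ b V E fun r => dividedDiff (weighted f m) n fun j => a j.succ (r j)
      -- The term that loses the first node: the projection and `V 0` are moved into the prefactor,
      -- whose norm is at most `κ ‖V 0‖`.
      have h6 := ih (fun j => b j.succ) (fun j => V j.succ) (fun j => E j.succ)
        (fun j => a j.succ) (fun j => K j.succ) (fun j => hK j.succ) (fun j => hKR j.succ)
        (classW_mono n.le_succ hf) m (by omega) (l ++ [C]) hl'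
        (K 0 * ((∑ i ∈ E 0, lineProj (b 0 i)) * V 0))
      rw [hL, hLn, mul_assoc (K 0), ← h5] at h6
      refine (h2.sub h6).mono ((add_le_add (d := (l.map norm).prod * ‖C‖ * τ *
        κ ^ (q + 1) * traceConst f q m n * ∏ j, ‖V j‖) h4 ?_).trans (le_of_eq ?_))
      · have hP : ‖∑ i ∈ E 0, lineProj (b 0 i)‖ ≤ 1 := by
          simpa using (b 0).norm_sum_lineProj_le (E 0) (c := fun _ => 1) zero_le_one
            fun _ _ => by simp
        have h7 : ‖K 0 * ((∑ i ∈ E 0, lineProj (b 0 i)) * V 0)‖ ≤ κ * ‖V 0‖ := by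
          refine (norm_mul_le _ _).trans (mul_le_mul (hK 0) ?_ (norm_nonneg _) hκ)
          exact (norm_mul_le _ _).trans (mul_le_of_le_one_left (norm_nonneg _) hP)
        have hc' := traceConst_nonneg f q m n
        have hW' : 0 ≤ ∏ j : Fin n, ‖V j.succ‖ := Finset.prod_nonneg fun _ _ => norm_nonneg _
        rw [Fin.prod_univ_succ]
        calc _ ≤ (l.map norm).prod * ‖C‖ * (κ * ‖V 0‖) * τ * κ ^ q * traceConst f q m n *
              ∏ j : Fin n, ‖V j.succ‖ := by gcongr
          _ = _ := by ring
      · rw [traceConst]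
        ring

end

section

variable {𝓗 : Type*} [NormedAddCommGroup 𝓗] [InnerProductSpace ℂ 𝓗]

/-! ### Partial sums in terms of eigenvectors -/

namespace EigenSystem

variable {H : 𝓗 →ₗ.[ℂ] 𝓗} (D : EigenSystem H)

/-- The eigenvalues rounded down to multiples of `1 / m`. -/
def roundedEv (m : ℕ) (i : D.ι) : ℝ := (⌊D.ev i * m⌋ : ℝ) / m

theorem abs_roundedEv_sub_ev_le {m : ℕ} (hm : 1 ≤ m) (i : D.ι) :
    |D.roundedEv m i - D.ev i| ≤ 1 / m := by
  have hm' : (0 : ℝ) < m := by exact_mod_cast hm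
  have h1 : D.roundedEv m i - D.ev i = (⌊D.ev i * m⌋ - D.ev i * m) / m := by
    rw [roundedEv, sub_div, mul_div_cancel_right₀ _ hm'.ne']
  rw [h1, abs_div, Nat.abs_cast]
  refine div_le_div_of_nonneg_right ?_ hm'.le
  rw [abs_le]
  have h2 := Int.floor_le (D.ev i * m)
  have h3 := Int.lt_floor_add_one (D.ev i * m)
  constructor <;> linarith

theorem finite_abs_roundedEv_le {m : ℕ} (hm : 1 ≤ m) (C : ℝ) :
    {i | |D.roundedEv m i| ≤ C}.Finite := by
  refine (D.finite (C + 1)).subset fun i hi => ?_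
  have h1 := D.abs_roundedEv_sub_ev_le hm i
  have h2 : (1 : ℝ) / m ≤ 1 := by
    rw [div_le_one (by exact_mod_cast hm)]
    exact_mod_cast hm
  have h3 : |D.roundedEv m i| ≤ C := hi
  have h4 := abs_sub_abs_le_abs_sub (D.ev i) (D.roundedEv m i)
  rw [abs_sub_comm] at h4
  change |D.ev i| ≤ C + 1
  linarith

theorem finite_floor_mem_Ioo {m : ℕ} (hm : 1 ≤ m) (N : ℕ) :
    {i | ⌊D.ev i * m⌋ ∈ Finset.Ioo (-(N : ℤ)) (N : ℤ)}.Finite := by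
  refine (D.finite_abs_roundedEv_le hm N).subset fun i hi => ?_
  have hi' : ⌊D.ev i * m⌋ ∈ Finset.Ioo (-(N : ℤ)) (N : ℤ) := hi
  rw [Finset.mem_Ioo, ← abs_lt] at hi'
  change |D.roundedEv m i| ≤ N
  rw [roundedEv, abs_div, Nat.abs_cast]
  refine (div_le_self (abs_nonneg _) (by exact_mod_cast hm)).trans ?_
  exact_mod_cast hi'.le

/-- The indices of the eigenvalues with rounded value `l / m`, `|l| < N`. -/
def cutoff {m : ℕ} (hm : 1 ≤ m) (N : ℕ) : Finset D.ι := (D.finite_floor_mem_Ioo hm N).toFinset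

theorem mem_cutoff {m : ℕ} (hm : 1 ≤ m) {N : ℕ} {i : D.ι} :
    i ∈ D.cutoff hm N ↔ ⌊D.ev i * m⌋ ∈ Finset.Ioo (-(N : ℤ)) (N : ℤ) :=
  Set.Finite.mem_toFinset _

theorem eventually_subset_cutoff {m : ℕ} (hm : 1 ≤ m) (F : Finset D.ι) :
    ∀ᶠ N in atTop, F ⊆ D.cutoff hm N := by
  have h1 : ∀ i ∈ F, ∀ᶠ N : ℕ in atTop, i ∈ D.cutoff hm N := by
    intro i _
    filter_upwards [eventually_gt_atTop ⌊D.ev i * m⌋.natAbs] with N hN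
    rw [mem_cutoff, Finset.mem_Ioo]
    omega
  filter_upwards [(Finset.eventually_all F).2 h1] with N hN
  exact fun i hi => hN i hi

variable [CompleteSpace 𝓗]

theorem specProj_eq_sum (hH : IsSelfAdjoint H) {m : ℕ} (hm : 1 ≤ m) {N : ℕ} {l : ℤ}
    (hl : l ∈ Finset.Ioo (-(N : ℤ)) (N : ℤ)) :
    specProj H m l = ∑ i ∈ (D.cutoff hm N).filter (fun i => ⌊D.ev i * m⌋ = l),
      lineProj (D.basis i) := by
  classical
  have hm' : (0 : ℝ) < m := by exact_mod_cast hm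
  refine D.basis.clm_ext fun i => ?_
  have h1 := D.basis.sum_lineProj_apply
    ((D.cutoff hm N).filter (fun i => ⌊D.ev i * m⌋ = l)) (fun _ => 1) i
  simp only [one_smul] at h1
  rw [h1, specProj, D.spectralMeasure_apply_basis hH measurableSet_Ico]
  have h2 : D.ev i ∈ Set.Ico ((l : ℝ) / m) (((l : ℝ) + 1) / m) ↔ ⌊D.ev i * m⌋ = l := by
    rw [Set.mem_Ico, div_le_iff₀ hm', lt_div_iff₀ hm', Int.floor_eq_iff]
  have h3 : i ∈ (D.cutoff hm N).filter (fun i => ⌊D.ev i * m⌋ = l) ↔ ⌊D.ev i * m⌋ = l := by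
    rw [Finset.mem_filter, mem_cutoff]
    exact ⟨fun h => h.2, fun h => ⟨h ▸ hl, h⟩⟩
  simp only [h2, h3]
  split_ifs <;> simp

end EigenSystem

variable [CompleteSpace 𝓗]

/-- Each spectral projection of an interval of length `1 / m` is a finite sum of projections onto
eigenlines, so the sum over `l` groups the eigenvectors by `⌊m · ev⌋ = l`, and `φ` is evaluated at
rounded eigenvalues. -/
theorem partialSum_eq_symbolSum {n : ℕ} {H : Fin (n + 1) → 𝓗 →ₗ.[ℂ] 𝓗}
    (hH : ∀ j, IsSelfAdjoint (H j)) (D : ∀ j, EigenSystem (H j)) (φ : (Fin (n + 1) → ℝ) → ℂ)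
    (V : Fin n → 𝓗 →L[ℂ] 𝓗) {m : ℕ} (hm : 1 ≤ m) (N : ℕ) :
    partialSum H φ V m N = symbolSum (fun j => (D j).basis) V (fun j => (D j).cutoff hm N)
      fun r => φ fun j => (D j).roundedEv m (r j) := by
  classical
  let g : (∀ j, (D j).ι) → Fin (n + 1) → ℤ := fun r j => ⌊(D j).ev (r j) * m⌋
  have h1 : ∀ r ∈ Fintype.piFinset fun j => (D j).cutoff hm N,
      g r ∈ Fintype.piFinset fun _ : Fin (n + 1) => Finset.Ioo (-(N : ℤ)) (N : ℤ) := by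
    intro r hr
    rw [Fintype.mem_piFinset] at hr ⊢
    exact fun j => ((D j).mem_cutoff hm).1 (hr j)
  rw [symbolSum, ← Finset.sum_fiberwise_of_maps_to h1, partialSum]
  refine Finset.sum_congr rfl fun l hl => ?_
  rw [Fintype.mem_piFinset] at hl
  have h2 : (Fintype.piFinset fun j => (D j).cutoff hm N).filter (fun r => g r = l) =
      Fintype.piFinset fun j => ((D j).cutoff hm N).filter (fun i => ⌊(D j).ev i * m⌋ = l j) := by
    ext r
    simp only [Finset.mem_filter, Fintype.mem_piFinset, funext_iff, g]
    exact forall_and.symm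
  have h3 : (specProj (H 0) m (l 0) *
      (List.ofFn fun j : Fin n => V j * specProj (H j.succ) m (l j.succ)).prod) =
      interlace V fun j => ∑ i ∈ ((D j).cutoff hm N).filter (fun i => ⌊(D j).ev i * m⌋ = l j),
        lineProj ((D j).basis i) := by
    rw [interlace, (D 0).specProj_eq_sum (hH 0) hm (hl 0)]
    congr 3
    funext j
    rw [(D j.succ).specProj_eq_sum (hH j.succ) hm (hl j.succ)]
  rw [h3, interlace_sum, ← h2, Finset.smul_sum]
  refine Finset.sum_congr rfl fun r hr => ?_
  rw [← (Finset.mem_filter.1 hr).2]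
  rfl

/-- Rounded eigenvalues still have finitely many members in bounded sets, so the limit over `N`
exists for each `m` by the same Cauchy argument. The comparison of rounded and true eigenvalues is
uniform in the index sets and survives the limit, giving convergence as `m → ∞`. -/
theorem exists_isMultipleOperatorIntegral {n s : ℕ} (hs : 1 ≤ s) {f : ℝ → ℂ}
    (hf : f ∈ classW s n) (V : Fin n → 𝓗 →L[ℂ] 𝓗) {H : Fin (n + 1) → 𝓗 →ₗ.[ℂ] 𝓗}
    (hH : ∀ j, IsSelfAdjoint (H j)) (D : ∀ j, EigenSystem (H j)) :
    ∃ T, IsMultipleOperatorIntegral H (dividedDiff f n) V T ∧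
      Tendsto (fun E : ∀ j, Finset (D j).ι => symbolSum (fun j => (D j).basis) V E
        fun r => dividedDiff f n fun j => (D j).ev (r j)) atTop (𝓝 T) := by
  classical
  have hφ := isFourierIntegral_dividedDiff_weighted hf (Nat.zero_le s) (le_refl n)
  rw [weighted_zero] at hφ
  obtain ⟨T, hT⟩ := cauchySeq_tendsto_of_complete
    (cauchySeq_symbolSum (fun j => (D j).basis) V hs hf fun j => (D j).finite)
  have hS : ∀ m : ℕ, ∃ S, 1 ≤ m →
      Tendsto (fun E : ∀ j, Finset (D j).ι => symbolSum (fun j => (D j).basis) V E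
        fun r => dividedDiff f n fun j => (D j).roundedEv m (r j)) atTop (𝓝 S) := by
    intro m
    by_cases hm : 1 ≤ m
    · obtain ⟨S, hS⟩ := cauchySeq_tendsto_of_complete
        (cauchySeq_symbolSum (fun j => (D j).basis) V hs hf
          fun j => (D j).finite_abs_roundedEv_le hm)
      exact ⟨S, fun _ => hS⟩
    · exact ⟨0, fun h => absurd h hm⟩
  choose S hS using hS
  refine ⟨T, ⟨S, fun m hm => ?_, ?_⟩, hT⟩
  · simp only [partialSum_eq_symbolSum hH D _ V hm]
    refine (hS m hm).comp (tendsto_atTop.2 fun F => ?_)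
    filter_upwards [eventually_all.2 fun j => (D j).eventually_subset_cutoff hm (F j)] with N hN
    exact hN
  · obtain ⟨ε, hε, h⟩ := exists_symbolSum_sub_le (fun j => (D j).basis) V hφ
    rw [tendsto_iff_norm_sub_tendsto_zero]
    refine squeeze_zero' (Eventually.of_forall fun _ => norm_nonneg _) ?_ hε
    filter_upwards [eventually_ge_atTop 1] with m hm
    exact le_of_tendsto ((hS m hm).sub hT).norm (Eventually.of_forall fun E =>
      h m _ _ (fun j i => (D j).abs_roundedEv_sub_ev_le hm i) E)

/-! ### The trace class estimate for the integral -/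

theorem schattenNorm_pow {s : ℕ} (hs : s ≠ 0) (T : 𝓗 →L[ℂ] 𝓗) :
    schattenNorm s T ^ s = (schattenTrace s T).toReal := by
  rw [schattenNorm, one_div]
  exact Real.rpow_inv_natCast_pow ENNReal.toReal_nonneg hs

theorem TraceBound.memSchatten_one {T : 𝓗 →L[ℂ] 𝓗} {C : ℝ} (h : TraceBound T C) :
    MemSchatten 1 T := h.schattenTrace_le.trans_lt ENNReal.ofReal_lt_top

theorem TraceBound.schattenNorm_one_le {T : 𝓗 →L[ℂ] 𝓗} {C : ℝ} (hC : 0 ≤ C)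
    (h : TraceBound T C) : schattenNorm 1 T ≤ C := by
  rw [schattenNorm, div_one, Real.rpow_one]
  exact ENNReal.toReal_le_of_le_ofReal hC h.schattenTrace_le

/-- `(H - i)⁻¹` is diagonal in the basis of eigenvectors. -/
theorem EigenSystem.schattenTrace_resolventAt {H : 𝓗 →ₗ.[ℂ] 𝓗} (hH : IsSelfAdjoint H)
    (D : EigenSystem H) (s : ℕ) : schattenTrace s (resolventAt H Complex.I) =
      ∑' i, ENNReal.ofReal (‖((D.ev i : ℂ) - Complex.I)⁻¹‖ ^ s) := by
  refine schattenTrace_of_eigenbasis D.basis (fun i => inv_ne_zero (ofReal_sub_I_ne_zero _))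
    (fun i => D.resolventAt_apply_basis hH i) (fun i => ?_) s
  rw [ContinuousLinearMap.star_eq_adjoint, hH.adjoint_resolventAt,
    (hH.isResolventAt (Or.inr rfl)).apply_eigenvec (ofReal_add_I_ne_zero _) (D.isEigenvec i)]
  simp

/-- All that matters about the operators `H j` is that they are self-adjoint and that their
resolvents are `R K` with `‖K‖ ≤ κ`; this treats the unperturbed and the perturbed case together. -/
theorem exists_isMultipleOperatorIntegral_traceClass {H₀ : 𝓗 →ₗ.[ℂ] 𝓗} (hH₀ : IsSelfAdjoint H₀)
    {n s : ℕ} (hs : 1 ≤ s) (hR : MemSchatten s (resolventAt H₀ Complex.I)) {f : ℝ → ℂ}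
    (hf : f ∈ classW s n) (V : Fin n → 𝓗 →L[ℂ] 𝓗) {H : Fin (n + 1) → 𝓗 →ₗ.[ℂ] 𝓗}
    (hH : ∀ j, IsSelfAdjoint (H j)) {κ : ℝ}
    (hK : ∀ j, ∃ K : 𝓗 →L[ℂ] 𝓗, ‖K‖ ≤ κ ∧
      resolventAt (H j) Complex.I = resolventAt H₀ Complex.I * K) :
    ∃ T, IsMultipleOperatorIntegral H (dividedDiff f n) V T ∧ MemSchatten 1 T ∧
      schattenNorm 1 T ≤ constC s n f * (∏ j, ‖V j‖) * κ ^ s *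
        schattenNorm s (resolventAt H₀ Complex.I) ^ s := by
  classical
  choose K hKn hKR using hK
  have hκ : 0 ≤ κ := (norm_nonneg _).trans (hKn 0)
  have hc := hR.isCompactOperator
  obtain ⟨D₀⟩ := exists_eigenSystem hH₀ hc
  have hD : ∀ j, Nonempty (EigenSystem (H j)) := fun j =>
    exists_eigenSystem (hH j) (by rw [hKR j]; exact hc.comp_clm (K j))
  let D : ∀ j, EigenSystem (H j) := fun j => (hD j).some
  have htr := D₀.schattenTrace_resolventAt hH₀ s
  have hfin : ∑' i, ENNReal.ofReal (‖((D₀.ev i : ℂ) - Complex.I)⁻¹‖ ^ s) ≠ ∞ := by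
    rw [← htr]
    exact hR.ne
  have hsum : Summable fun i => ‖((D₀.ev i : ℂ) - Complex.I)⁻¹‖ ^ s :=
    (ENNReal.summable_toReal hfin).congr fun i => ENNReal.toReal_ofReal (by positivity)
  have hτ : ∑' i, ‖((D₀.ev i : ℂ) - Complex.I)⁻¹‖ ^ s =
      schattenNorm s (resolventAt H₀ Complex.I) ^ s := by
    rw [schattenNorm_pow (by omega), htr, ← ENNReal.ofReal_tsum_of_nonneg
      (fun i => by positivity) hsum, ENNReal.toReal_ofReal (tsum_nonneg fun i => by positivity)]
  obtain ⟨T, hT, hlim⟩ := exists_isMultipleOperatorIntegral hs hf V hH D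
  have hTB : TraceBound T (constC s n f * (∏ j, ‖V j‖) * κ ^ s *
      schattenNorm s (resolventAt H₀ Complex.I) ^ s) := by
    refine TraceBound.of_tendsto (fun E => ?_) hlim
    -- The recursion starts from no extracted factors, prefactor `1`, weight exponent `0` and `s`
    -- resolvents still to be extracted.
    have h1 := traceBound_prod_mul_symbolSum D₀.basis (D₀.resolventAt_apply_basis hH₀)
      (by omega : 0 < s) hsum s (fun j => (D j).basis) V E (fun j => (D j).ev) K hKn
      (fun j i => by rw [← hKR]; exact (D j).resolventAt_apply_basis (hH j) i) hf 0
      (by omega) [] (by simp) 1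
    rw [weighted_zero, traceConst_eq_constC, hτ] at h1
    simp only [List.map_nil, List.prod_nil, one_mul] at h1
    refine h1.mono ?_
    have h2 : ‖(1 : 𝓗 →L[ℂ] 𝓗)‖ ≤ 1 := ContinuousLinearMap.norm_id_le
    have h3 : 0 ≤ constC s n f := traceConst_eq_constC f s n ▸ traceConst_nonneg f s 0 n
    have h4 : 0 ≤ schattenNorm s (resolventAt H₀ Complex.I) ^ s := by
      rw [← hτ]
      exact tsum_nonneg fun i => by positivity
    have h5 : 0 ≤ ∏ j, ‖V j‖ := Finset.prod_nonneg fun _ _ => norm_nonneg _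
    calc _ ≤ 1 * schattenNorm s (resolventAt H₀ Complex.I) ^ s * κ ^ s * constC s n f *
          ∏ j, ‖V j‖ := by gcongr
      _ = _ := by ring
  refine ⟨T, hT, hTB.memSchatten_one, hTB.schattenNorm_one_le ?_⟩
  have h3 : 0 ≤ constC s n f := traceConst_eq_constC f s n ▸ traceConst_nonneg f s 0 n
  have h4 : 0 ≤ schattenNorm s (resolventAt H₀ Complex.I) ^ s := by
    rw [← hτ]
    exact tsum_nonneg fun i => by positivity
  have h5 : 0 ≤ ∏ j, ‖V j‖ := Finset.prod_nonneg fun _ _ => norm_nonneg _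
  positivity

end

end MOI

end

theorem mainTheorem3 {𝓗 : Type*} [NormedAddCommGroup 𝓗] [InnerProductSpace ℂ 𝓗]
    [CompleteSpace 𝓗] [TopologicalSpace.SeparableSpace 𝓗]
    (H : 𝓗 →ₗ.[ℂ] 𝓗) (hH : IsSelfAdjoint H) (s : ℕ) (hs : 1 ≤ s)
    (hR : MOI.MemSchatten s (MOI.resolventAt H Complex.I))
    (n : ℕ) (f : ℝ → ℂ) (hf : f ∈ MOI.classW s n) (V : Fin n → (𝓗 →L[ℂ] 𝓗)) :
    (∃ T : 𝓗 →L[ℂ] 𝓗,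
      MOI.IsMultipleOperatorIntegral (fun _ => H) (MOI.dividedDiff f n) V T ∧
      MOI.MemSchatten 1 T ∧
      MOI.schattenNorm 1 T ≤ MOI.constC s n f * (∏ j, ‖V j‖) *
        MOI.schattenNorm s (MOI.resolventAt H Complex.I) ^ s) ∧
    ∀ W : 𝓗 →L[ℂ] 𝓗, IsSelfAdjoint W →
      ∃ T : 𝓗 →L[ℂ] 𝓗,
        MOI.IsMultipleOperatorIntegral (Fin.cons (MOI.perturb H W) fun _ => H)
          (MOI.dividedDiff f n) V T ∧
        MOI.MemSchatten 1 T ∧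
        MOI.schattenNorm 1 T ≤ MOI.constC s n f * (∏ j, ‖V j‖) * (1 + ‖W‖) ^ s *
          MOI.schattenNorm s (MOI.resolventAt H Complex.I) ^ s := by
  have key := fun {Hs : Fin (n + 1) → 𝓗 →ₗ.[ℂ] 𝓗} {κ : ℝ} =>
    MOI.exists_isMultipleOperatorIntegral_traceClass (H := Hs) (κ := κ) hH hs hR hf V
  refine ⟨?_, fun W hW => ?_⟩
  · obtain ⟨T, hT, hT1, hle⟩ := key (Hs := fun _ => H) (κ := 1) (fun _ => hH)
      fun _ => ⟨1, ContinuousLinearMap.norm_id_le, (mul_one _).symm⟩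
    exact ⟨T, hT, hT1, by simpa using hle⟩
  · have hW' := MOI.isSelfAdjoint_perturb hH hW
    refine key (Hs := Fin.cons (MOI.perturb H W) fun _ => H) (κ := 1 + ‖W‖)
      (Fin.cases hW' fun _ => hH) (Fin.cases ?_ fun _ => ?_)
    -- `κ = 1 + ‖W‖` suffices because the resolvent at `i` of the self-adjoint operator `H + W` has
    -- norm at most one.
    · refine ⟨1 - W * MOI.resolventAt (MOI.perturb H W) Complex.I, ?_,
        MOI.resolventAt_perturb hH hW⟩
      refine (norm_sub_le _ _).trans (add_le_add ContinuousLinearMap.norm_id_le ?_)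
      exact (norm_mul_le _ _).trans (mul_le_of_le_one_right (norm_nonneg _)
        hW'.norm_resolventAt_le)
    · exact ⟨1, ContinuousLinearMap.norm_id_le.trans (le_add_of_nonneg_right (norm_nonneg _)),
        (mul_one _).symm⟩
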